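/- Let $k$ be an algebraically closed field of characteristic zero, and let $H$ be a finite-dimensional semisimple Hopf algebra over $k$. Let $R$ be a filtered Artin–Schelter (AS) regular algebra of dimension $2$: $R$ is a $k$-algebra generated by a finite-dimensional subspace $U$ with $1\notin U$, and for the filtration $F_n=(k1+U)^n$ the connected graded algebra $\operatorname{gr}_F R=\bigoplus_{n\ge 0}F_n/F_{n-1}$ is AS regular of global dimension $2$ (in particular of finite Gelfand–Kirillov dimension). Suppose that $R$ is a left $H$-module algebra such that: * the action preserves the filtration, i.e. $k1+U$ is an $H$-submodule of $R$; * the action is inner-faithful, i.e. $IR\neq 0$ for every nonzero Hopf ideal $I$ of $H$; * the action is not graded, i.e. for every subspace $U'$ that satisfies the above conditions on $U$ (finite-dimensional, generating, $1\notin U'$, associated graded algebra AS regular of dimension $2$, $k1+U'$ an $H$-submodule), with associated filtration $F'$, there is no isomorphism $R\cong\operatorname{gr}_{F'}R$ of left $H$-module algebras; * the homological determinant of the induced $H$-action on $\operatorname{gr}_F R$ is not trivial, i.e. it is not the counit $\epsilon$. (Here, for an action on an AS regular algebra $A$ of dimension $d$ that preserves the grading, if $\mathfrak e\neq 0$ lies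 in the lowest degree nonzero homogeneous component of the graded dual $H^d_{\mathfrak m}(A)^*$ of local cohomology and $\mathfrak e\cdot h=\eta(h)\mathfrak e$, then the homological determinant is $\eta\circ S$, with $S$ the antipode.) Then there are an integer $m\ge 2$, a primitive $m$-th root of unity $\xi\in k$, an isomorphism of Hopf algebras $H\cong kC_m$ with the group algebra of the cyclic group of order $m$, and an isomorphism of algebras $R\cong k\langle u,v\rangle/(vu-uv-v)$ such that $k1+U$ is spanned by $1,u,v$ and a generator $h$ of $C_m$ acts by $h\cdot u=u$, $h\cdot v=\xi v$. The fixed ring $R^H=\{a\in R: h\cdot a=\epsilon(h)a\ \text{for all } h\in H\}$ is the subalgebra generated by $u$ and $v^m$, and it is isomorphic to the Ore extension $k[u][x;\sigma]$, where $\sigma(u)=u+m$ and $xp=\sigma(p)x$ for $p\in k[u]$, by an isomorphism that is the identity on $k[u]$ and sends $x$ to $v^m$. Consequently $R^H$ has (left and right) global dimension $2$. -/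

import Mathlib

open scoped TensorProduct DirectSum Polynomial
open CategoryTheory

universe u

noncomputable section

namespace FilteredHopf

/-! ### Actions of a Hopf algebra on an algebra -/

section Action

variable {k H R : Type*} [Field k] [Ring H] [HopfAlgebra k H] [Ring R] [Algebra k R]

/-- For a left `H`-module `R`, given by `ρ : H → End R`, the linear map `h ↦ h · a`. -/
def orbit {M : Type*} [AddCommGroup M] [Module k M] (ρ : H →ₐ[k] Module.End k M) (a : M) :
    H →ₗ[k] M :=
  (LinearMap.applyₗ a) ∘ₗ ρ.toLinearMap

@[simp] theorem orbit_apply {M : Type*} [AddCommGroup M] [Module k M]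
    (ρ : H →ₐ[k] Module.End k M) (a : M) (h : H) : orbit ρ a h = ρ h a := rfl

/-- `R` is a left `H`-module algebra: `h · 1 = ε(h) 1` and `h · (ab) = ∑ (h₁ · a)(h₂ · b)`. -/
structure IsModuleAlgebra (ρ : H →ₐ[k] Module.End k R) : Prop where
  act_one : ∀ h : H, ρ h 1 = algebraMap k R (Coalgebra.counit h)
  act_mul : ∀ (h : H) (a b : R), ρ h (a * b) =
    LinearMap.mul' k R (TensorProduct.map (orbit ρ a) (orbit ρ b) (Coalgebra.comul h))

/-- The module is inner-faithful: no nonzero Hopf ideal of `H` acts by zero. -/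
def IsInnerFaithful (ρ : H →ₐ[k] Module.End k R) : Prop :=
  ∀ I : Ideal H, I.IsTwoSided → I.IsHopfIdeal k → (∀ h ∈ I, ∀ r : R, ρ h r = 0) → I = ⊥

/-- The subspace `V` is an `H`-submodule. -/
def IsStable (ρ : H →ₐ[k] Module.End k R) (V : Submodule k R) : Prop :=
  ∀ h : H, ∀ x ∈ V, ρ h x ∈ V

theorem IsModuleAlgebra.act_mul_mem {ρ : H →ₐ[k] Module.End k R} (hρ : IsModuleAlgebra ρ)
    {V W : Submodule k R} (hV : IsStable ρ V) (hW : IsStable ρ W) {a b : R} (ha : a ∈ V)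
    (hb : b ∈ W) (h : H) : ρ h (a * b) ∈ V * W := by
  rw [hρ.act_mul]
  induction (Coalgebra.comul h : H ⊗[k] H) with
  | zero => simp
  | tmul x y => simpa using Submodule.mul_mem_mul (hV x a ha) (hW y b hb)
  | add x y hx hy => simpa using add_mem hx hy

theorem IsModuleAlgebra.isStable_pow {ρ : H →ₐ[k] Module.End k R} (hρ : IsModuleAlgebra ρ)
    {V : Submodule k R} (hV : IsStable ρ V) (n : ℕ) : IsStable ρ (V ^ n) := by
  induction n with
  | zero =>
    intro h x hx
    rw [pow_zero, Submodule.mem_one] at hx ⊢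
    obtain ⟨c, rfl⟩ := hx
    refine ⟨c * Coalgebra.counit h, ?_⟩
    rw [Algebra.algebraMap_eq_smul_one c, map_smul, hρ.act_one, map_mul, Algebra.smul_def]
  | succ n ih =>
    intro h x hx
    rw [pow_succ] at hx ⊢
    induction hx using Submodule.mul_induction_on' with
    | mem_mul_mem a ha b hb => exact hρ.act_mul_mem ih hV ha hb h
    | add x _ y _ hx hy => rw [map_add]; exact add_mem hx hy

/-- The fixed subring `R^H = {a | h · a = ε(h) a for all h}`. -/
def fixedSubalgebra (ρ : H →ₐ[k] Module.End k R) (hρ : IsModuleAlgebra ρ) : Subalgebra k R where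
  carrier := {a | ∀ h : H, ρ h a = (Coalgebra.counit h : k) • a}
  mul_mem' := by
    intro a b ha hb h
    have key : TensorProduct.map (orbit ρ a) (orbit ρ b) =
        TensorProduct.map ((LinearMap.toSpanSingleton k R a) ∘ₗ Coalgebra.counit)
          ((LinearMap.toSpanSingleton k R b) ∘ₗ (Coalgebra.counit : H →ₗ[k] k)) := by
      congr 1
      · ext x; simpa using ha x
      · ext x; simpa using hb x
    have e : LinearMap.mul' k R ∘ₗ
        TensorProduct.map ((LinearMap.toSpanSingleton k R a) ∘ₗ Coalgebra.counit)
          ((LinearMap.toSpanSingleton k R b) ∘ₗ (Coalgebra.counit : H →ₗ[k] k)) =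
        (LinearMap.toSpanSingleton k R (a * b)) ∘ₗ (TensorProduct.lid k k).toLinearMap ∘ₗ
          TensorProduct.map LinearMap.id Coalgebra.counit ∘ₗ
          TensorProduct.map (Coalgebra.counit : H →ₗ[k] k) LinearMap.id := by
      ext x y; simp [smul_smul, mul_comm]
    have c : TensorProduct.map (Coalgebra.counit : H →ₗ[k] k) LinearMap.id
        (Coalgebra.comul h) = (1 : k) ⊗ₜ[k] h := Coalgebra.rTensor_counit_comul h
    rw [hρ.act_mul, key]
    have := LinearMap.congr_fun e (Coalgebra.comul h)
    simp only [LinearMap.comp_apply, c] at this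
    simpa using this
  add_mem' := by
    intro a b ha hb h
    rw [map_add, ha h, hb h, smul_add]
  algebraMap_mem' := by
    intro c h
    rw [Algebra.algebraMap_eq_smul_one, map_smul, hρ.act_one, Algebra.algebraMap_eq_smul_one,
      smul_comm]

end Action

/-! ### The associated graded algebra of the filtration `Fₙ = Vⁿ` -/

section Graded

variable {k R : Type*} [Field k] [Ring R] [Algebra k R]

/-- `Fₙ₋₁`, with `F₋₁ = 0`. -/
def prev (V : Submodule k R) : ℕ → Submodule k R
  | 0 => ⊥
  | n + 1 => V ^ n

/-- The homogeneous component `Fₙ / Fₙ₋₁`. -/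
def GrPiece (V : Submodule k R) (n : ℕ) : Type _ :=
  ↥(V ^ n) ⧸ (prev V n).submoduleOf (V ^ n)

instance (V : Submodule k R) (n : ℕ) : AddCommGroup (GrPiece V n) :=
  inferInstanceAs (AddCommGroup (↥(V ^ n) ⧸ (prev V n).submoduleOf (V ^ n)))

instance (V : Submodule k R) (n : ℕ) : Module k (GrPiece V n) :=
  inferInstanceAs (Module k (↥(V ^ n) ⧸ (prev V n).submoduleOf (V ^ n)))

/-- The class in `Fₙ / Fₙ₋₁` of an element of `Fₙ`. -/
def GrPiece.mk (V : Submodule k R) (n : ℕ) : ↥(V ^ n) →ₗ[k] GrPiece V n :=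
  ((prev V n).submoduleOf (V ^ n)).mkQ

theorem GrPiece.mk_eq_zero {V : Submodule k R} {n : ℕ} {x : ↥(V ^ n)} :
    GrPiece.mk V n x = 0 ↔ (x : R) ∈ prev V n :=
  Submodule.Quotient.mk_eq_zero _

theorem GrPiece.exists_mk (V : Submodule k R) (n : ℕ) (a : GrPiece V n) :
    ∃ x, GrPiece.mk V n x = a :=
  Submodule.Quotient.mk_surjective _ a

/-- Linear maps on `Fₙ` that vanish on `Fₙ₋₁` descend to `Fₙ / Fₙ₋₁`. -/
def GrPiece.lift {V : Submodule k R} {n : ℕ} {M : Type*} [AddCommGroup M] [Module k M]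
    (f : ↥(V ^ n) →ₗ[k] M) (hf : ∀ x : ↥(V ^ n), (x : R) ∈ prev V n → f x = 0) :
    GrPiece V n →ₗ[k] M :=
  Submodule.liftQ _ f fun x hx => hf x hx

theorem GrPiece.lift_mk {V : Submodule k R} {n : ℕ} {M : Type*} [AddCommGroup M] [Module k M]
    (f : ↥(V ^ n) →ₗ[k] M) (hf : ∀ x : ↥(V ^ n), (x : R) ∈ prev V n → f x = 0) (x : ↥(V ^ n)) :
    GrPiece.lift f hf (GrPiece.mk V n x) = f x := rfl

theorem prev_mul_mem {V : Submodule k R} {m n : ℕ} {x y : R} (hx : x ∈ prev V m)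
    (hy : y ∈ V ^ n) : x * y ∈ prev V (m + n) := by
  cases m with
  | zero =>
    have : x = 0 := by simpa [prev] using hx
    subst this; simp
  | succ m =>
    rw [Nat.succ_add]
    have := Submodule.mul_mem_mul (show x ∈ V ^ m from hx) hy
    rwa [← pow_add] at this

theorem mul_prev_mem {V : Submodule k R} {m n : ℕ} {x y : R} (hx : x ∈ V ^ m)
    (hy : y ∈ prev V n) : x * y ∈ prev V (m + n) := by
  cases n with
  | zero =>
    have : y = 0 := by simpa [prev] using hy
    subst this; simp
  | succ n =>
    rw [← Nat.add_assoc]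
    have := Submodule.mul_mem_mul hx (show y ∈ V ^ n from hy)
    rwa [← pow_add] at this

theorem mul_mem_pow_add {V : Submodule k R} {m n : ℕ} {x y : R} (hx : x ∈ V ^ m)
    (hy : y ∈ V ^ n) : x * y ∈ V ^ (m + n) := by
  rw [pow_add]; exact Submodule.mul_mem_mul hx hy

/-- The product `Fₘ × Fₙ → Fₘ₊ₙ/Fₘ₊ₙ₋₁` induced by the product of `R`. -/
def grMulAux (V : Submodule k R) (m n : ℕ) :
    ↥(V ^ m) →ₗ[k] ↥(V ^ n) →ₗ[k] GrPiece V (m + n) :=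
  LinearMap.mk₂ k (fun x y => GrPiece.mk V (m + n) ⟨x * y, mul_mem_pow_add x.2 y.2⟩)
    (fun x x' y => by rw [← map_add]; congr 1; ext; simp [add_mul])
    (fun c x y => by rw [← map_smul]; congr 1; ext; simp)
    (fun x y y' => by rw [← map_add]; congr 1; ext; simp [mul_add])
    (fun c x y => by rw [← map_smul]; congr 1; ext; simp)

/-- The product `Fₘ/Fₘ₋₁ × Fₙ/Fₙ₋₁ → Fₘ₊ₙ/Fₘ₊ₙ₋₁` induced by the product of `R`. -/
def grMul (V : Submodule k R) (m n : ℕ) :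
    GrPiece V m →ₗ[k] GrPiece V n →ₗ[k] GrPiece V (m + n) :=
  (GrPiece.lift (GrPiece.lift (grMulAux V m n) (fun x hx => LinearMap.ext fun y =>
      GrPiece.mk_eq_zero.2 (prev_mul_mem hx y.2))).flip (fun y hy => LinearMap.ext fun a => by
    obtain ⟨x, rfl⟩ := GrPiece.exists_mk V m a
    exact GrPiece.mk_eq_zero.2 (mul_prev_mem x.2 hy))).flip

theorem grMul_mk_mk (V : Submodule k R) (m n : ℕ) (x : ↥(V ^ m)) (y : ↥(V ^ n)) :
    grMul V m n (GrPiece.mk V m x) (GrPiece.mk V n y) =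
      GrPiece.mk V (m + n) ⟨x * y, mul_mem_pow_add x.2 y.2⟩ := rfl

theorem GrPiece.mk_congr (V : Submodule k R) {m n : ℕ} (h : m = n) {x : ↥(V ^ m)} {y : ↥(V ^ n)}
    (hxy : (x : R) = y) :
    GradedMonoid.mk (A := GrPiece V) m (GrPiece.mk V m x) =
      GradedMonoid.mk n (GrPiece.mk V n y) := by
  subst h
  have : x = y := Subtype.ext hxy
  subst this
  rfl

theorem one_mem_pow_zero (V : Submodule k R) : (1 : R) ∈ V ^ 0 := by
  rw [pow_zero]; exact Submodule.one_le.1 le_rfl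

theorem algebraMap_mem_pow_zero (V : Submodule k R) (c : k) : algebraMap k R c ∈ V ^ 0 := by
  rw [pow_zero]; exact Submodule.mem_one.2 ⟨c, rfl⟩

instance grGMul (V : Submodule k R) : GradedMonoid.GMul (GrPiece V) where
  mul a b := grMul V _ _ a b

instance grGOne (V : Submodule k R) : GradedMonoid.GOne (GrPiece V) where
  one := GrPiece.mk V 0 ⟨1, one_mem_pow_zero V⟩

theorem gradedMk_mul (V : Submodule k R) (m n : ℕ) (x : ↥(V ^ m)) (y : ↥(V ^ n)) :
    GradedMonoid.mk (A := GrPiece V) m (GrPiece.mk V m x) * GradedMonoid.mk n (GrPiece.mk V n y) =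
      GradedMonoid.mk (m + n) (GrPiece.mk V (m + n) ⟨x * y, mul_mem_pow_add x.2 y.2⟩) := rfl

instance grGMonoid (V : Submodule k R) : GradedMonoid.GMonoid (GrPiece V) where
  one_mul := by
    rintro ⟨n, a⟩
    obtain ⟨x, rfl⟩ := GrPiece.exists_mk V n a
    exact (gradedMk_mul V 0 n _ _).trans (GrPiece.mk_congr V (by simp) (by simp))
  mul_one := by
    rintro ⟨n, a⟩
    obtain ⟨x, rfl⟩ := GrPiece.exists_mk V n a
    exact (gradedMk_mul V n 0 _ _).trans (GrPiece.mk_congr V (by simp) (by simp))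
  mul_assoc := by
    rintro ⟨m, a⟩ ⟨n, b⟩ ⟨p, c⟩
    obtain ⟨x, rfl⟩ := GrPiece.exists_mk V m a
    obtain ⟨y, rfl⟩ := GrPiece.exists_mk V n b
    obtain ⟨z, rfl⟩ := GrPiece.exists_mk V p c
    exact GrPiece.mk_congr V (add_assoc m n p) (mul_assoc (x : R) y z)

/-- `c ↦ c 1`, as a map into `F₀ / F₋₁`. -/
def grScalar (V : Submodule k R) : k →+ GrPiece V 0 where
  toFun c := GrPiece.mk V 0 ⟨algebraMap k R c, algebraMap_mem_pow_zero V c⟩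
  map_zero' := by
    refine GrPiece.mk_eq_zero.2 ?_
    simp
  map_add' c d := by
    rw [← map_add]; congr 1; ext; simp

instance grGRing (V : Submodule k R) : DirectSum.GRing (GrPiece V) where
  __ := grGMonoid V
  mul_zero a := map_zero (grMul V _ _ a)
  zero_mul b := LinearMap.map_zero₂ (grMul V _ _) b
  mul_add a b c := map_add (grMul V _ _ a) b c
  add_mul a b c := LinearMap.map_add₂ (grMul V _ _) a b c
  natCast n := grScalar V n
  natCast_zero := by simp
  natCast_succ n := by
    rw [Nat.cast_succ, map_add]
    congr 1
    change GrPiece.mk V 0 _ = GrPiece.mk V 0 _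
    congr 1; ext; simp
  intCast n := grScalar V n
  intCast_ofNat n := by simp
  intCast_negSucc_ofNat n := by rw [Int.cast_negSucc, map_neg]

instance grGAlgebra (V : Submodule k R) : DirectSum.GAlgebra k (GrPiece V) where
  toFun := grScalar V
  map_one := by
    change GrPiece.mk V 0 _ = GrPiece.mk V 0 _
    congr 1; ext; simp
  map_mul c d := GrPiece.mk_congr V rfl (map_mul (algebraMap k R) c d)
  commutes := by
    rintro c ⟨n, a⟩
    obtain ⟨x, rfl⟩ := GrPiece.exists_mk V n a
    exact GrPiece.mk_congr V (Nat.add_comm 0 n) (Algebra.commutes c (x : R))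
  smul_def := by
    rintro c ⟨n, a⟩
    obtain ⟨x, rfl⟩ := GrPiece.exists_mk V n a
    exact GrPiece.mk_congr V (Nat.zero_add n).symm (Algebra.smul_def c (x : R))

/-- The associated graded algebra `⨁ₙ Fₙ / Fₙ₋₁` of the filtration `Fₙ = Vⁿ`. -/
abbrev Gr (V : Submodule k R) : Type _ := ⨁ n, GrPiece V n

/-- The homogeneous component of degree `n`, as a subspace of the associated graded algebra. -/
def grGrading (V : Submodule k R) (n : ℕ) : Submodule k (Gr V) :=
  LinearMap.range (DirectSum.lof k ℕ (GrPiece V) n)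

/-- An endomorphism `f` of `R` with `f Fₙ ⊆ Fₙ` for all `n` acts on the associated graded space
by sending the class of `x` in `Fₙ / Fₙ₋₁` to the class of `f x` in `Fₙ / Fₙ₋₁`. -/
def grMap (V : Submodule k R) (f : R →ₗ[k] R) (hf : ∀ n, ∀ x ∈ V ^ n, f x ∈ V ^ n) :
    Gr V →ₗ[k] Gr V :=
  DirectSum.lmap fun n =>
    GrPiece.lift (GrPiece.mk V n ∘ₗ f.restrict (hf n)) (fun x hx => by
      refine GrPiece.mk_eq_zero.2 ?_
      change f x ∈ prev V n
      cases n with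
      | zero =>
        have : (x : R) = 0 := by simpa [prev] using hx
        rw [this, map_zero]; exact zero_mem _
      | succ n => exact hf n _ hx)

theorem grMap_of_mk (V : Submodule k R) (f : R →ₗ[k] R) (hf : ∀ n, ∀ x ∈ V ^ n, f x ∈ V ^ n)
    (n : ℕ) (x : ↥(V ^ n)) :
    grMap V f hf (DirectSum.lof k ℕ (GrPiece V) n (GrPiece.mk V n x)) =
      DirectSum.lof k ℕ (GrPiece V) n (GrPiece.mk V n ⟨f x, hf n x x.2⟩) := by
  rw [grMap, DirectSum.lmap_lof]; rfl

theorem gr_hom_ext (V : Submodule k R) {M : Type*} [AddCommGroup M] [Module k M]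
    {f g : Gr V →ₗ[k] M}
    (h : ∀ n (x : ↥(V ^ n)), f (DirectSum.lof k ℕ (GrPiece V) n (GrPiece.mk V n x)) =
      g (DirectSum.lof k ℕ (GrPiece V) n (GrPiece.mk V n x))) : f = g := by
  refine DirectSum.linearMap_ext k fun n => LinearMap.ext fun a => ?_
  obtain ⟨x, rfl⟩ := GrPiece.exists_mk V n a
  exact h n x

/-- The action of `H` on the associated graded algebra induced by a filtration-preserving
action. -/
def grAction {H : Type*} [Ring H] [HopfAlgebra k H] {ρ : H →ₐ[k] Module.End k R}
    (hρ : IsModuleAlgebra ρ) {V : Submodule k R} (hV : IsStable ρ V) :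
    H →ₐ[k] Module.End k (Gr V) :=
  AlgHom.ofLinearMap
    { toFun := fun h => grMap V (ρ h) fun n x hx => hρ.isStable_pow hV n h x hx
      map_add' := fun g h => gr_hom_ext V fun n x => by
        rw [LinearMap.add_apply, grMap_of_mk, grMap_of_mk, grMap_of_mk, ← map_add]
        rw [← map_add]; congr 2; ext; simp
      map_smul' := fun c h => gr_hom_ext V fun n x => by
        rw [RingHom.id_apply, LinearMap.smul_apply, grMap_of_mk, grMap_of_mk, ← map_smul]
        rw [← map_smul]; congr 2; ext; simp }
    (gr_hom_ext V fun n x => by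
      refine (grMap_of_mk V _ _ n x).trans ?_
      rw [Module.End.one_apply]
      congr 2; ext; simp)
    (fun g h => gr_hom_ext V fun n x => by
      refine (grMap_of_mk V _ _ n x).trans ?_
      rw [Module.End.mul_apply]
      refine Eq.trans ?_ (congrArg (grMap V (ρ g) _) (grMap_of_mk V (ρ h) _ n x).symm)
      rw [grMap_of_mk]
      congr 2; ext; simp)

end Graded

/-! ### Artin-Schelter regularity -/

section Regular

/-- The (left) global dimension of the ring `A` is `d`: the supremum of the projective dimensions
of all left `A`-modules is `d`. -/
def HasGlobalDimension (A : Type u) [Ring A] (d : ℕ) : Prop :=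
  (⨆ M : ModuleCat.{u} A, projectiveDimension M) = (d : WithBot ℕ∞)

variable {k : Type*} [Field k]

/-- The left ideal generated by the elements of positive degree. -/
def augmentationIdeal {A : Type*} [Ring A] [Algebra k A] (𝒜 : ℕ → Submodule k A) : Ideal A :=
  Ideal.span (⋃ n : ℕ, (𝒜 (n + 1) : Set A))

/-- The homological half of the regularity condition for left modules over a connected graded
algebra `A`: `gldim A = d`, `Extⁱ(k, A) = 0` for `i ≠ d` and `Extᵈ(k, A)` is one-dimensional,
where `k = A / A₊` is the trivial left module. -/
structure IsLeftASRegular (A : Type u) [Ring A] [Algebra k A] (𝒜 : ℕ → Submodule k A) (d : ℕ) :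
    Prop where
  gldim : HasGlobalDimension A d
  ext_eq_zero : ∀ i : ℕ, i ≠ d → Subsingleton (Abelian.Ext
    (ModuleCat.of A (A ⧸ augmentationIdeal 𝒜)) (ModuleCat.of A A) i)
  ext_eq_one : Module.finrank k (Abelian.Ext
    (ModuleCat.of A (A ⧸ augmentationIdeal 𝒜)) (ModuleCat.of A A) d) = 1

/-- The Gelfand-Kirillov dimension of `A` is finite: the dimensions of the spaces `(k1 + W)ⁿ`,
for `W` finite-dimensional, grow polynomially in `n`, of degree bounded independently of `W`. -/
def HasFiniteGKDim (k : Type*) [Field k] (A : Type*) [Ring A] [Algebra k A] : Prop :=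
  ∃ N : ℕ, ∀ W : Submodule k A, W.FG → ∃ C : ℕ, ∀ n : ℕ,
    Module.finrank k ↥((1 ⊔ W) ^ n) ≤ C * (n + 1) ^ N

/-- The graded algebra `A = ⨁ 𝒜ₙ` is Artin-Schelter regular of dimension `d`. Right modules over
`A` are left modules over the opposite algebra. -/
structure IsASRegular (A : Type u) [Ring A] [Algebra k A] (𝒜 : ℕ → Submodule k A) (d : ℕ) :
    Prop where
  nontrivial : Nontrivial A
  connected : 𝒜 0 = 1
  finite : ∀ n, Module.Finite k (𝒜 n)
  left : IsLeftASRegular (k := k) A 𝒜 d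
  right : IsLeftASRegular (k := k) Aᵐᵒᵖ
    (fun n => (𝒜 n).map (MulOpposite.opLinearEquiv k : A ≃ₗ[k] Aᵐᵒᵖ).toLinearMap) d
  gkdim : HasFiniteGKDim k A

/-- `R` is filtered Artin-Schelter regular of dimension `d` with respect to the finite-dimensional
generating space `U`, `1 ∉ U`, and the filtration `Fₙ = (k1 + U)ⁿ`. -/
structure IsFilteredASRegular (R : Type u) [Ring R] [Algebra k R] (U : Submodule k R) (d : ℕ) :
    Prop where
  finite : U.FG
  one_notMem : (1 : R) ∉ U
  generates : Algebra.adjoin k (U : Set R) = ⊤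
  regular : IsASRegular (k := k) (Gr (1 ⊔ U)) (grGrading (1 ⊔ U)) d

/-- The action of `H` is graded: for some admissible generating space `U` with `k1 + U` stable
under `H`, the algebra `R` is isomorphic to its associated graded algebra as a left `H`-module
algebra. -/
def IsGradedAction {H : Type*} [Ring H] [HopfAlgebra k H] {R : Type u} [Ring R] [Algebra k R]
    {ρ : H →ₐ[k] Module.End k R} (hρ : IsModuleAlgebra ρ) (d : ℕ) : Prop :=
  ∃ U : Submodule k R, IsFilteredASRegular R U d ∧
    ∃ hU : IsStable ρ (1 ⊔ U), ∃ e : R ≃ₐ[k] Gr (1 ⊔ U),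
      ∀ (h : H) (r : R), e (ρ h r) = grAction hρ hU h (e r)

end Regular

/-! ### Local cohomology and the homological determinant

For a connected graded algebra `A`, the local cohomology `Hⁱ_𝔪(A) = colimₙ Extⁱ(A / A_{≥ n}, A)` is
computed with the bar resolution of `A / A_{≥ n}`: the homogeneous `i`-cochains of degree `j` are
the `k`-multilinear maps `f(a₁, …, aᵢ, x)` with values in `A` which raise the total degree by `j`
and which, as functions of the last variable `x ∈ A`, factor through `A / A_{≥ n}` for some `n`.
-/

section LocalCohomology

variable {k : Type*} [Field k] {A : Type*} [Ring A] [Algebra k A]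

/-- The component of degree `z ∈ ℤ`, which is zero for negative `z`. -/
def intComponent (𝒜 : ℕ → Submodule k A) (z : ℤ) : Submodule k A :=
  if 0 ≤ z then 𝒜 z.toNat else ⊥

/-- Homogeneous local `i`-cochains of degree `j`. -/
def IsLocalCochain (𝒜 : ℕ → Submodule k A) (i : ℕ) (j : ℤ)
    (f : MultilinearMap k (fun _ : Fin (i + 1) => A) A) : Prop :=
  (∃ N : ℕ, ∀ s : ℕ, N ≤ s → ∀ a : Fin (i + 1) → A, a (Fin.last i) ∈ 𝒜 s → f a = 0) ∧
  ∀ (e : Fin (i + 1) → ℕ) (a : Fin (i + 1) → A), (∀ t, a t ∈ 𝒜 (e t)) →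
    f a ∈ intComponent 𝒜 ((∑ t, (e t : ℤ)) + j)

/-- The differential of the bar complex:
`(d f)(a₀, …, aᵢ, x) = a₀ f(a₁, …, x) - f(a₀ a₁, …, x) + ⋯ ± f(a₀, …, aᵢ x)`. -/
def barDifferential {i : ℕ} (f : (Fin (i + 1) → A) → A) (a : Fin (i + 2) → A) : A :=
  a 0 * f (Fin.tail a) +
    ∑ t : Fin (i + 1), (-1) ^ ((t : ℕ) + 1) * f (Fin.contractNth t.castSucc (· * ·) a)

/-- `F` is the differential of a homogeneous local cochain of degree `j`. -/
def IsLocalCoboundary (𝒜 : ℕ → Submodule k A) (j : ℤ) :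
    (i : ℕ) → ((Fin (i + 1) → A) → A) → Prop
  | 0, F => F = 0
  | i + 1, F => ∃ g : MultilinearMap k (fun _ : Fin (i + 1) => A) A,
      IsLocalCochain 𝒜 i j g ∧ F = barDifferential g

/-- The component of degree `j` of the local cohomology `Hⁱ_𝔪(A)` is zero. -/
def LocalCohomologyVanishes (𝒜 : ℕ → Submodule k A) (i : ℕ) (j : ℤ) : Prop :=
  ∀ f : MultilinearMap k (fun _ : Fin (i + 1) => A) A, IsLocalCochain 𝒜 i j f →
    barDifferential f = 0 → IsLocalCoboundary 𝒜 j i f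

variable {H : Type*} [Ring H] [HopfAlgebra k H]

/-- For `f` multilinear in `n` variables, the map
`h ↦ ∑ f(h₁ · a₁, …, hₙ · aₙ)` (and `h ↦ ε(h) f` for `n = 0`). -/
def diagonalEval (ρ : H →ₐ[k] Module.End k A) : (n : ℕ) → (Fin n → A) →
    (MultilinearMap k (fun _ : Fin n => A) A →ₗ[k] (H →ₗ[k] A))
  | 0, _ =>
    { toFun := fun f => (LinearMap.toSpanSingleton k A (f ![])) ∘ₗ Coalgebra.counit
      map_add' := fun f g => by ext h; exact smul_add _ _ _
      map_smul' := fun c f => by ext h; exact smul_comm _ _ _ }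
  | n + 1, a =>
    { toFun := fun f => TensorProduct.lift
        (diagonalEval ρ n (Fin.tail a) ∘ₗ f.curryLeft ∘ₗ orbit ρ (a 0)) ∘ₗ Coalgebra.comul
      map_add' := fun f g => by
        rw [← LinearMap.add_comp]
        congr 1
        refine TensorProduct.ext' fun x y => ?_
        rw [LinearMap.add_apply, TensorProduct.lift.tmul, TensorProduct.lift.tmul,
          TensorProduct.lift.tmul, ← LinearMap.add_apply]
        exact LinearMap.congr_fun (map_add (diagonalEval ρ n (Fin.tail a))
          (f.curryLeft (ρ x (a 0))) (g.curryLeft (ρ x (a 0)))) y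
      map_smul' := fun c f => by
        rw [RingHom.id_apply, ← LinearMap.smul_comp]
        congr 1
        refine TensorProduct.ext' fun x y => ?_
        rw [LinearMap.smul_apply, TensorProduct.lift.tmul, TensorProduct.lift.tmul,
          ← LinearMap.smul_apply]
        exact LinearMap.congr_fun (map_smul (diagonalEval ρ n (Fin.tail a)) c
          (f.curryLeft (ρ x (a 0)))) y }

/-- The function `f · h = ∑ S(h₁) · f(h₂ · a₁, …, hₙ₊₁ · aₙ)`. For left `A`-modules `M`, `N` with
compatible actions of `H`, the left action of `H` on `Ext_A(M, N)` is induced by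
`h · f = ∑ h₂ f(S⁻¹(h₁) · -)`; so `f · h` is the action of `S(h)` on `f`. -/
def antipodeTwist (ρ : H →ₐ[k] Module.End k A) {n : ℕ}
    (f : MultilinearMap k (fun _ : Fin n => A) A) (h : H) (a : Fin n → A) : A :=
  TensorProduct.lift ((ρ.toLinearMap ∘ₗ HopfAlgebra.antipode k).compl₂ (diagonalEval ρ n a f))
    (Coalgebra.comul h)

/-- `χ` is the homological determinant of the action `ρ` of `H` on the connected graded algebra
`A`, of injective dimension `d`. The lowest degree `-j` in which the graded dual `Hᵈ_𝔪(A)*` is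
nonzero corresponds to the highest degree `j` in which `Hᵈ_𝔪(A)` is nonzero. If `H` acts
on the component of degree `j` of `Hᵈ_𝔪(A)` through the character `η`, so that `𝔢 · h = η(h) 𝔢` in
the dual, then `χ = η ∘ S`; that is, the class of `f · h` is `χ(h)` times the class of `f`. -/
def IsHomologicalDeterminant (ρ : H →ₐ[k] Module.End k A) (𝒜 : ℕ → Submodule k A) (d : ℕ)
    (χ : H →ₐ[k] k) : Prop :=
  ∃ j : ℤ, ¬ LocalCohomologyVanishes 𝒜 d j ∧ (∀ j' : ℤ, j < j' → LocalCohomologyVanishes 𝒜 d j') ∧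
    ∀ f : MultilinearMap k (fun _ : Fin (d + 1) => A) A, IsLocalCochain 𝒜 d j f →
      barDifferential f = 0 → ∀ h : H,
        IsLocalCoboundary 𝒜 j d (fun a => antipodeTwist ρ f h a - χ h • f a)

end LocalCohomology

/-! ### Ore extensions and the algebra `k⟨u, v⟩ / (vu - uv - v)` -/

section Ore

/-- A copy of the ring `B`, on which `n ∈ ℕ` acts by `σⁿ`. -/
def OreBase {B : Type*} [Ring B] (_σ : B →+* B) : Type _ := B

instance {B : Type*} [Ring B] (σ : B →+* B) : Ring (OreBase σ) := inferInstanceAs (Ring B)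

instance {B : Type*} [Ring B] (σ : B →+* B) :
    MulSemiringAction (Multiplicative ℕ) (OreBase σ) where
  smul n b := σ^[n.toAdd] (b : B)
  one_smul _ := rfl
  mul_smul m n b := Function.iterate_add_apply σ m.toAdd n.toAdd (b : B)
  smul_zero n := iterate_map_zero σ n.toAdd
  smul_add n a b := iterate_map_add σ n.toAdd (a : B) (b : B)
  smul_one n := iterate_map_one σ n.toAdd
  smul_mul n a b := iterate_map_mul σ n.toAdd (a : B) (b : B)

/-- The Ore extension `B[x; σ]`, with `x b = σ(b) x`. -/
abbrev OreExtension {B : Type*} [Ring B] (σ : B →+* B) : Type _ := SkewPolynomial (OreBase σ)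

/-- The constants `B → B[x; σ]`. -/
def OreExtension.const {B : Type*} [Ring B] (σ : B →+* B) : B →+* OreExtension σ :=
  SkewPolynomial.CRingHom (R := OreBase σ)

/-- The variable of `B[x; σ]`. -/
def OreExtension.var {B : Type*} [Ring B] (σ : B →+* B) : OreExtension σ :=
  SkewPolynomial.X (R := OreBase σ)

theorem OreExtension.var_mul_const {B : Type*} [Ring B] (σ : B →+* B) (b : B) :
    OreExtension.var σ * OreExtension.const σ b =
      OreExtension.const σ (σ b) * OreExtension.var σ := by
  have h : ∀ c d : OreBase σ, d = σ (c : B) →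
      SkewPolynomial.monomial (R := OreBase σ) 1 1 * SkewPolynomial.C c =
        SkewPolynomial.C d * SkewPolynomial.monomial (R := OreBase σ) 1 1 := by
    intro c d hd
    rw [SkewPolynomial.monomial_mul_C, SkewPolynomial.C_mul_monomial, one_mul, mul_one, hd]
    rfl
  exact h b (σ b) rfl

/-- The relation `vu - uv - v = 0` in the free algebra on `u = x₀` and `v = x₁`. -/
inductive ShiftRel (k : Type*) [Field k] : FreeAlgebra k (Fin 2) → FreeAlgebra k (Fin 2) → Prop
  | rel : ShiftRel k (FreeAlgebra.ι k 1 * FreeAlgebra.ι k 0 -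
      FreeAlgebra.ι k 0 * FreeAlgebra.ι k 1 - FreeAlgebra.ι k 1) 0

/-- The algebra `k⟨u, v⟩ / (vu - uv - v)`. -/
abbrev ShiftAlgebra (k : Type*) [Field k] : Type _ := RingQuot (ShiftRel k)

/-- The generators `u` (index `0`) and `v` (index `1`) of `k⟨u, v⟩ / (vu - uv - v)`. -/
def ShiftAlgebra.gen (k : Type*) [Field k] (i : Fin 2) : ShiftAlgebra k :=
  RingQuot.mkAlgHom k (ShiftRel k) (FreeAlgebra.ι k i)

end Ore

end FilteredHopf

end

open scoped TensorProduct DirectSum Polynomial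
open CategoryTheory

noncomputable section

/-! The quadratic relation of R is a weight vector for H, and its weight is what the homological
determinant detects. Write V = k1 + U and A = gr R.

Shape of A. The conditions on Ext(k, A), read off a minimal presentation of the augmentation ideal,
give a Koszul resolution 0 → A → Aⁿ → A → k → 0 with a single quadratic relation ∑ wᵢxᵢ
(`exists_isKoszulPair`). Finite GK dimension forces n = 2, and dim Aₙ = n + 1
(`IsStandardGraded.finrank_eq`).

The character. Since H is semisimple, U may be replaced by an H-stable complement of k1 in V. The
relation of A lifts to t = ∑ rᵢ ⊗ xᵢ in U ⊗ U; up to scalars it is the only tensor whose product in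
R lies in V, so H acts on t by a character χ. The top local cohomology of A has highest degree -2,
and there a bar cocycle is determined by its value on the relation. So χ = ε would make the
homological determinant trivial (`IsKoszulPair.isHomologicalDeterminant_counit`); hence χ ≠ ε.

The relation. Let δ = ∑ rᵢxᵢ ∈ V, of weight χ. It has no scalar part because χ ≠ ε, and δ ≠ 0,
because a homogeneous relation splits the filtration and makes the action graded
(`isGradedAction_of_relation`). Semisimplicity gives U = ku ⊕ kδ, with u of some weight ψ. Only
tensors of weight χ occur in t, among u ⊗ u, δ ⊗ u, u ⊗ δ, δ ⊗ δ of weights ψψ, χψ, ψχ, χχ. As χ ≠ ε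
and the rᵢ span U, this forces ψ = ε and t = γ δ ⊗ u + β u ⊗ δ (`relation_coeff_eq`). In R this
reads γδu + βuδ = sδ with s ≠ 0. If γ + β ≠ 0, a translation of u would make the relation
homogeneous; so γ = -β, and after rescaling u the relation is vu - uv = v with v = δ
(`exists_shift_relation`). The Hilbert function shows that the uⁱvʲ form a basis
(`isShiftOre_of_regular`).

The Hopf algebra. The vector uⁱvʲ has weight χʲ, so the common kernel of the powers of χ is a Hopf
ideal acting by zero; by inner-faithfulness it vanishes. Thus the m = ord χ powers of χ are
coordinates on H, and the element on which χ takes a primitive m-th root of unity as value is a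
group-like generator (`exists_cyclicGroupAlgebra_equiv`).

The fixed ring is spanned by the uⁱvʲ with m ∣ j, so it is again an Ore extension of k[u] by a
shift, now by m. Every such extension S = k[x][y; x ↦ x + c] has global dimension 2: a two-step
Koszul resolution of an arbitrary module gives the upper bound, and S/(Sx + Sy) the lower one
(`IsShiftOre.hasGlobalDimension_two`). -/

namespace FilteredHopf

/-! ### Ext(A/I, A) in degrees 0, 1, 2 by dimension shifting. -/

section ExtTools

open Abelian

variable {A : Type u} [Ring A] (I : Ideal A)

/-- The short complex `0 → I → A → A / I → 0`. -/
abbrev quotientShortComplex : ShortComplex (ModuleCat.{u} A) :=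
  ModuleCat.shortComplexOfCompEqZero (I.subtype) (Submodule.mkQ I) (by ext; simp)

theorem shortExact_quotientShortComplex : (quotientShortComplex I).ShortExact := by
  refine ModuleCat.shortComplex_shortExact _ ?_ ?_ ?_
  · intro x
    simp
  · exact I.injective_subtype
  · exact Submodule.mkQ_surjective I

/-- The connecting map sends `f` to Ext¹(A/I, A) = 0, so `f` extends to `A`, and a left linear map
`A → A` is right multiplication by its value at `1`. -/
theorem exists_eq_mul_of_subsingleton_ext_one
    (h : Subsingleton (Ext (ModuleCat.of A (A ⧸ I)) (ModuleCat.of A A) 1)) (f : I →ₗ[A] A) :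
    ∃ c : A, ∀ x : I, f x = x * c := by
  have hS := shortExact_quotientShortComplex I
  obtain ⟨x₂, hx₂⟩ := Ext.contravariant_sequence_exact₁ hS (Y := ModuleCat.of A A)
    (Ext.mk₀ (ModuleCat.ofHom f)) (n₁ := 1) rfl (Subsingleton.elim (α := Ext _ _ 1) _ _)
  obtain ⟨g, rfl⟩ := Ext.addEquiv₀.symm.surjective x₂
  refine ⟨g.hom (1 : A), fun x => ?_⟩
  have h1 : ModuleCat.ofHom I.subtype ≫ g = ModuleCat.ofHom f := by
    apply Ext.addEquiv₀.symm.injective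
    simpa using hx₂
  have h2 := LinearMap.congr_fun (congrArg ModuleCat.Hom.hom h1) x
  change g.hom (x : A) = f x at h2
  rw [← h2, ← smul_eq_mul, ← map_smul, smul_eq_mul, mul_one]

/-- An element `c` with `I c = 0` is the same as a homomorphism `A / I → A`. -/
theorem eq_zero_of_subsingleton_ext_zero
    (h : Subsingleton (Ext (ModuleCat.of A (A ⧸ I)) (ModuleCat.of A A) 0)) (c : A)
    (hc : ∀ x ∈ I, x * c = 0) : c = 0 := by
  let f : (A ⧸ I) →ₗ[A] A := I.liftQ (LinearMap.toSpanSingleton A A c) (fun x hx => hc x hx)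
  have : (Ext.mk₀ (ModuleCat.ofHom f)) = Ext.mk₀ 0 := Subsingleton.elim (α := Ext _ _ 0) _ _
  have h1 : ModuleCat.ofHom f = 0 := by
    apply Ext.addEquiv₀.symm.injective
    simpa using this
  have h2 := LinearMap.congr_fun (congrArg ModuleCat.Hom.hom h1) (Submodule.Quotient.mk (1 : A))
  change (1 : A) • c = 0 at h2
  simpa using h2

variable {F : Type u} [AddCommGroup F] [Module A F] (p : F →ₗ[A] I)

theorem projective_ker_of_projectiveDimension_le_two [Module.Projective A F]
    (hp : Function.Surjective p) (h : HasProjectiveDimensionLT (ModuleCat.of A (A ⧸ I)) 3) :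
    Module.Projective A (LinearMap.ker p) := by
  have h1 : HasProjectiveDimensionLT (ModuleCat.of A I) 2 :=
    (shortExact_quotientShortComplex I).hasProjectiveDimensionLT_X₁ 2
      (show HasProjectiveDimensionLT (ModuleCat.of A A) 2 from inferInstance) h
  have h2 : HasProjectiveDimensionLT (ModuleCat.of A (LinearMap.ker p)) 1 :=
    (LinearMap.shortExact_shortComplexKer hp).hasProjectiveDimensionLT_X₁ 1
      (show HasProjectiveDimensionLT (ModuleCat.of A F) 1 from inferInstance) h1
  have : Projective (ModuleCat.of A (LinearMap.ker p)) := inferInstance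
  exact ModuleCat.projective_of_module_projective (R := A) (ModuleCat.of A (LinearMap.ker p))

variable {k : Type*} [Field k] [Algebra k A]

/-- The class in `Ext²(A / I, A)` of a map from the second syzygy module. -/
def syzygyClass (hp : Function.Surjective p)
    (φ : ModuleCat.of A (LinearMap.ker p) ⟶ ModuleCat.of A A) :
    Ext (ModuleCat.of A (A ⧸ I)) (ModuleCat.of A A) 2 :=
  (shortExact_quotientShortComplex I).extClass.comp
    ((LinearMap.shortExact_shortComplexKer hp).extClass.comp (Ext.mk₀ φ) (add_zero 1))
    (rfl : 1 + 1 = 2)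

theorem syzygyClass_add (hp : Function.Surjective p)
    (φ ψ : ModuleCat.of A (LinearMap.ker p) ⟶ ModuleCat.of A A) :
    syzygyClass I p hp (φ + ψ) = syzygyClass I p hp φ + syzygyClass I p hp ψ := by
  simp only [syzygyClass, Ext.mk₀_add, Ext.comp_add]

theorem syzygyClass_smul (hp : Function.Surjective p) (c : k)
    (φ : ModuleCat.of A (LinearMap.ker p) ⟶ ModuleCat.of A A) :
    syzygyClass I p hp (c • φ) = c • syzygyClass I p hp φ := by
  have h : Ext.mk₀ (c • φ) = c • Ext.mk₀ φ := by
    rw [← Ext.mk₀_smul]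
    congr 1
    ext x
    exact Algebra.smul_def c (φ.hom x : A)
  simp only [syzygyClass, h, Ext.comp_smul]

/-- As Ext¹(A, A) = 0, the connecting map from Ext¹(I, A) is injective, so the class of `φ` vanishes
there already; that class is the obstruction to extending `φ` to `F`. -/
theorem exists_extension_of_syzygyClass_eq_zero [Module.Projective A F]
    (hp : Function.Surjective p)
    (φ : ModuleCat.of A (LinearMap.ker p) ⟶ ModuleCat.of A A) (h : syzygyClass I p hp φ = 0) :
    ∃ g : F →ₗ[A] A, ∀ x : LinearMap.ker p, g x = φ.hom x := by
  obtain ⟨x₂, hx₂⟩ := Ext.contravariant_sequence_exact₁ (shortExact_quotientShortComplex I)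
    (Y := ModuleCat.of A A) _ _ h
  have h0 : x₂ = 0 := by
    have : Subsingleton (Ext (ModuleCat.of A A) (ModuleCat.of A A) (0 + 1)) :=
      Ext.subsingleton_of_projective _ _ _
    exact Subsingleton.elim (α := Ext (ModuleCat.of A A) (ModuleCat.of A A) (0 + 1)) _ _
  rw [h0, Ext.comp_zero] at hx₂
  obtain ⟨y, hy⟩ := Ext.contravariant_sequence_exact₁ (LinearMap.shortExact_shortComplexKer hp)
    (Y := ModuleCat.of A A) _ _ hx₂.symm
  obtain ⟨g, rfl⟩ := Ext.addEquiv₀.symm.surjective y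
  have h1 : ModuleCat.ofHom (LinearMap.ker p).subtype ≫ g = φ := by
    apply Ext.addEquiv₀.symm.injective
    simpa using hy
  refine ⟨g.hom, fun x => ?_⟩
  rw [← h1]; rfl

/-- Both connecting maps are onto, since Ext²(A, A) = 0 and Ext¹(F, A) = 0. -/
theorem syzygyClass_surjective [Module.Projective A F] (hp : Function.Surjective p) :
    Function.Surjective (syzygyClass I p hp) := by
  intro x
  obtain ⟨y, hy⟩ := Ext.contravariant_sequence_exact₃ (shortExact_quotientShortComplex I)
    (Y := ModuleCat.of A A) x (by
      have : Subsingleton (Ext (ModuleCat.of A A) (ModuleCat.of A A) (1 + 1)) :=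
        Ext.subsingleton_of_projective _ _ _
      exact Subsingleton.elim (α := Ext (ModuleCat.of A A) (ModuleCat.of A A) (1 + 1)) _ _)
      (n₀ := 1) rfl
  obtain ⟨z, hz⟩ := Ext.contravariant_sequence_exact₃ (LinearMap.shortExact_shortComplexKer hp)
    (Y := ModuleCat.of A A) y (by
      have : Subsingleton (Ext (ModuleCat.of A F) (ModuleCat.of A A) (0 + 1)) :=
        Ext.subsingleton_of_projective _ _ _
      exact Subsingleton.elim (α := Ext (ModuleCat.of A F) (ModuleCat.of A A) (0 + 1)) _ _)
      (n₀ := 0) rfl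
  obtain ⟨g, rfl⟩ := Ext.addEquiv₀.symm.surjective z
  refine ⟨g, ?_⟩
  rw [← hy, ← hz]; rfl

/-- Ext²(A/I, A) is the space of maps on the second syzygy module modulo restrictions from `F`; when
it is a line, two classes are proportional. This is the only form in which dim Ext² ≤ 1 is used. -/
theorem exists_extension_of_finrank_ext_two [Module.Projective A F]
    (hp : Function.Surjective p)
    (h : Module.finrank k (Ext (ModuleCat.of A (A ⧸ I)) (ModuleCat.of A A) 2) = 1)
    (f g : LinearMap.ker p →ₗ[A] A) :
    ∃ a b : k, (a ≠ 0 ∨ b ≠ 0) ∧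
      ∃ e : F →ₗ[A] A, ∀ x : LinearMap.ker p, e x = a • f x + b • g x := by
  have key : ∃ a b : k, (a ≠ 0 ∨ b ≠ 0) ∧
      a • syzygyClass I p hp (ModuleCat.ofHom f) + b • syzygyClass I p hp (ModuleCat.ofHom g) =
        0 := by
    obtain ⟨v, -, hv⟩ := finrank_eq_one_iff'.1 h
    obtain ⟨a, ha⟩ := hv (syzygyClass I p hp (ModuleCat.ofHom f))
    obtain ⟨b, hb⟩ := hv (syzygyClass I p hp (ModuleCat.ofHom g))
    by_cases h0 : a = 0
    · exact ⟨1, 0, by simp, by rw [← ha, h0]; simp⟩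
    · exact ⟨b, -a, by simp [h0], by rw [← ha, ← hb, smul_smul, smul_smul, mul_comm]; simp⟩
  obtain ⟨a, b, hab, h0⟩ := key
  refine ⟨a, b, hab, ?_⟩
  rw [← syzygyClass_smul, ← syzygyClass_smul, ← syzygyClass_add] at h0
  obtain ⟨e, he⟩ := exists_extension_of_syzygyClass_eq_zero I p hp _ h0
  refine ⟨e, fun x => (he x).trans ?_⟩
  change (a • (f x : A) + b • (g x : A) : A) = _
  rfl

theorem exists_not_extension_of_finrank_ext_two [Module.Projective A F]
    (hp : Function.Surjective p)
    (h : Module.finrank k (Ext (ModuleCat.of A (A ⧸ I)) (ModuleCat.of A A) 2) = 1) :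
    ∃ f : LinearMap.ker p →ₗ[A] A,
      ¬ ∃ e : F →ₗ[A] A, ∀ x : LinearMap.ker p, e x = f x := by
  by_contra hcon
  push Not at hcon
  have : Subsingleton (Ext (ModuleCat.of A (A ⧸ I)) (ModuleCat.of A A) 2) := by
    refine subsingleton_of_forall_eq 0 fun x => ?_
    obtain ⟨φ, rfl⟩ := syzygyClass_surjective I p hp x
    obtain ⟨e, he⟩ := hcon φ.hom
    have hφ : φ = (LinearMap.shortComplexKer p).f ≫ ModuleCat.ofHom e := by
      ext x; exact (he x).symm
    rw [hφ, syzygyClass, ← Ext.mk₀_comp_mk₀,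
      (LinearMap.shortExact_shortComplexKer hp).extClass_comp_assoc, Ext.comp_zero]
  rw [Module.finrank_zero_of_subsingleton] at h
  exact zero_ne_one h

end ExtTools

/-! ### The exact sequence 0 → N[X] → N[X] → N → 0 given by X - φ. -/

section ShiftSub

variable {k N : Type*} [CommRing k] [AddCommGroup N] [Module k N] (φ : N →ₗ[k] N)

/-- Multiplication by `X - φ` on `N[X]`. -/
def shiftSub : (ℕ →₀ N) →ₗ[k] (ℕ →₀ N) :=
  Finsupp.lmapDomain N k Nat.succ - Finsupp.mapRange.linearMap φ

/-- Evaluation of elements of `N[X]` at `φ`. -/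
def evalEnd : (ℕ →₀ N) →ₗ[k] N :=
  Finsupp.lsum k fun j => φ ^ j

@[simp] theorem shiftSub_single (j : ℕ) (n : N) :
    shiftSub φ (Finsupp.single j n) = Finsupp.single (j + 1) n - Finsupp.single j (φ n) := by
  simp [shiftSub]

@[simp] theorem evalEnd_single (j : ℕ) (n : N) :
    evalEnd φ (Finsupp.single j n) = (φ ^ j) n := by
  simp [evalEnd]

theorem shiftSub_apply_succ (p : ℕ →₀ N) (j : ℕ) :
    shiftSub φ p (j + 1) = p j - φ (p (j + 1)) := by
  simp only [shiftSub, LinearMap.sub_apply, Finsupp.lmapDomain_apply, Finsupp.sub_apply,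
    Finsupp.mapRange.linearMap_apply, Finsupp.mapRange_apply]
  congr 1
  exact Finsupp.mapDomain_apply Nat.succ_injective p j

/-- If (X - φ)p = 0, then pⱼ = φ(pⱼ₊₁) for all j, so the vanishing of the coefficients beyond the
support propagates down to all of them. -/
theorem shiftSub_injective : Function.Injective (shiftSub φ) := by
  rw [injective_iff_map_eq_zero]
  intro p hp
  have step : ∀ j, p (j + 1) = 0 → p j = 0 := by
    intro j hj
    have := shiftSub_apply_succ φ p j
    rw [hp, hj, map_zero, sub_zero] at this
    exact this.symm
  obtain ⟨B, hB⟩ : ∃ B, ∀ j, B ≤ j → p j = 0 := by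
    refine ⟨p.support.sup id + 1, fun j hj => ?_⟩
    by_contra h
    have := Finset.le_sup (f := id) (Finsupp.mem_support_iff.2 h)
    simp only [id] at this
    omega
  have all : ∀ d j, B ≤ j + d → p j = 0 := by
    intro d
    induction d with
    | zero => exact fun j hj => hB j hj
    | succ d ih => exact fun j hj => step j (ih _ (by omega))
  ext j
  exact all B j (by omega)

theorem evalEnd_surjective : Function.Surjective (evalEnd φ) := fun n =>
  ⟨Finsupp.single 0 n, by simp⟩

theorem evalEnd_shiftSub (p : ℕ →₀ N) : evalEnd φ (shiftSub φ p) = 0 := by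
  induction p using Finsupp.induction_linear with
  | zero => simp
  | add p q hp hq => simp [hp, hq]
  | single j n => simp [pow_succ]

/-- Xʲn - φʲ(n) is a multiple of X - φ by telescoping: Xʲ⁺¹n ≡ Xʲφ(n). -/
theorem sub_single_mem_range_shiftSub (p : ℕ →₀ N) :
    p - Finsupp.single 0 (evalEnd φ p) ∈ LinearMap.range (shiftSub φ) := by
  induction p using Finsupp.induction_linear with
  | zero => simp
  | add p q hp hq =>
    convert add_mem hp hq using 1
    simp only [map_add, Finsupp.single_add]; abel
  | single j n =>
    rw [evalEnd_single]
    induction j generalizing n with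
    | zero => simp
    | succ j ih =>
      convert add_mem (LinearMap.mem_range_self (shiftSub φ) (Finsupp.single j n)) (ih (φ n)) using 1
      rw [shiftSub_single, pow_succ]; simp

theorem mem_range_shiftSub {p : ℕ →₀ N} (hp : evalEnd φ p = 0) :
    p ∈ LinearMap.range (shiftSub φ) := by
  simpa [hp] using sub_single_mem_range_shiftSub φ p

end ShiftSub

/-! ### The Ore extension k[x][y; x ↦ x + c]: normal forms and the opposite ring. -/

section OreRing

open Polynomial

variable {k : Type*} [Field k] {S : Type u} [Ring S] [Algebra k S]

/-- The map `(pⱼ)ⱼ ↦ ∑ pⱼ(x) yʲ`. -/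
def oreMap (x y : S) : (ℕ →₀ k[X]) →ₗ[k] S :=
  Finsupp.lsum k fun j => LinearMap.mulRight k (y ^ j) ∘ₗ (aeval x).toLinearMap

@[simp] theorem oreMap_single (x y : S) (j : ℕ) (p : k[X]) :
    oreMap x y (Finsupp.single j p) = aeval x p * y ^ j := by
  simp [oreMap]

theorem aeval_taylor' (x : S) (c : k) (p : k[X]) :
    aeval x (taylor c p) = aeval (x + algebraMap k S c) p := by
  rw [taylor_apply, aeval_comp]; simp

theorem mul_aeval_of_mul_eq {x y : S} {c : k} (h : y * x = (x + algebraMap k S c) * y) (p : k[X]) :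
    y * aeval x p = aeval x (taylor c p) * y := by
  rw [aeval_taylor']
  induction p using Polynomial.induction_on' with
  | add p q hp hq => simp [mul_add, add_mul, hp, hq]
  | monomial n a =>
    have : ∀ n, y * x ^ n = (x + algebraMap k S c) ^ n * y := by
      intro n
      induction n with
      | zero => simp
      | succ n ih => rw [pow_succ, ← mul_assoc, ih, mul_assoc, h, ← mul_assoc, ← pow_succ]
    simp only [aeval_monomial]
    rw [← mul_assoc, ← Algebra.commutes, mul_assoc, this, mul_assoc]

theorem pow_mul_aeval_of_mul_eq {x y : S} {c : k} (h : y * x = (x + algebraMap k S c) * y) (j : ℕ)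
    (p : k[X]) : y ^ j * aeval x p = aeval x (taylor (j * c) p) * y ^ j := by
  induction j generalizing p with
  | zero => simp
  | succ j ih =>
    rw [pow_succ, mul_assoc, mul_aeval_of_mul_eq h, ← mul_assoc, ih, mul_assoc, ← pow_succ,
      taylor_taylor]
    push_cast
    ring_nf

/-- `S` is the Ore extension `k[x][y; σ]`, with `σ(x) = x + c`. -/
structure IsShiftOre (x y : S) (c : k) : Prop where
  rel : y * x = (x + algebraMap k S c) * y
  bij : Function.Bijective (oreMap (k := k) x y)

/-- The map `(pⱼ)ⱼ ↦ (pⱼ(X + j c))ⱼ`. -/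
def taylorTwist (c : k) : (ℕ →₀ k[X]) →ₗ[k] (ℕ →₀ k[X]) :=
  Finsupp.lsum k fun j : ℕ =>
    (Finsupp.lsingle j : k[X] →ₗ[k] (ℕ →₀ k[X])) ∘ₗ taylor ((j : k) * c)

@[simp] theorem taylorTwist_single (c : k) (j : ℕ) (p : k[X]) :
    taylorTwist c (Finsupp.single j p) = Finsupp.single j (taylor (j * c) p) := by
  simp [taylorTwist]

namespace IsShiftOre

variable {x y : S} {c : k}

/-- In the opposite ring the powers of y stand to the left of the polynomials in x; moving yʲ to the
right shifts the argument by jc. -/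
theorem oreMap_twist (h : IsShiftOre x y c) (q : ℕ →₀ k[X]) : oreMap (MulOpposite.op x) (MulOpposite.op y) q =
    MulOpposite.op (oreMap x y (taylorTwist c q)) := by
  induction q using Finsupp.induction_linear with
  | zero => simp
  | add p q hp hq => simp only [map_add, hp, hq, MulOpposite.op_add]
  | single j p =>
    have e : aeval (MulOpposite.op x) p = MulOpposite.op (aeval x p) := by
      induction p using Polynomial.induction_on' with
      | add p q hp hq => simp [hp, hq]
      | monomial n a =>
        simp only [aeval_monomial, MulOpposite.algebraMap_apply, ← MulOpposite.op_pow,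
          ← MulOpposite.op_mul]
        rw [Algebra.commutes]
    rw [oreMap_single, e, ← MulOpposite.op_pow, ← MulOpposite.op_mul, pow_mul_aeval_of_mul_eq h.rel]
    simp

/-- The reordering `taylorTwist c` is invertible with inverse `taylorTwist (-c)`. Because of this,
the right global dimension needs no separate argument. -/
theorem op (h : IsShiftOre x y c) : IsShiftOre (MulOpposite.op x) (MulOpposite.op y) (-c) where
  rel := by
    rw [← MulOpposite.op_mul, MulOpposite.algebraMap_apply, ← MulOpposite.op_add,
      ← MulOpposite.op_mul]
    congr 1
    rw [mul_add, h.rel, map_neg, add_mul, mul_neg, Algebra.commutes]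
    abel
  bij := by
    have hτ : ∀ (c : k) (q : ℕ →₀ k[X]), taylorTwist c (taylorTwist (-c) q) = q := by
      intro c q
      induction q using Finsupp.induction_linear with
      | zero => simp
      | add p q hp hq => simp only [map_add, hp, hq]
      | single j p => simp [taylor_taylor]
    have e : ⇑(oreMap (k := k) (MulOpposite.op x) (MulOpposite.op y)) =
        MulOpposite.op ∘ oreMap x y ∘ taylorTwist c := funext h.oreMap_twist
    rw [e]
    refine MulOpposite.op_bijective.comp (h.bij.comp ?_)
    refine ⟨Function.LeftInverse.injective (g := taylorTwist (-c)) fun q => ?_,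
      Function.RightInverse.surjective (g := taylorTwist (-c)) fun q => hτ c q⟩
    have := hτ (-c) q
    rwa [neg_neg] at this

/-- The coordinates of `S`. -/
def equiv (h : IsShiftOre x y c) : (ℕ →₀ k[X]) ≃ₗ[k] S := LinearEquiv.ofBijective _ h.bij

theorem equiv_single (h : IsShiftOre x y c) (j : ℕ) (p : k[X]) :
    h.equiv (Finsupp.single j p) = aeval x p * y ^ j := oreMap_single x y j p

theorem induction (h : IsShiftOre x y c)
    {motive : S → Prop} (add : ∀ s t, motive s → motive t → motive (s + t))
    (mon : ∀ p j, motive (aeval x (p : k[X]) * y ^ j)) (s : S) : motive s := by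
  obtain ⟨q, rfl⟩ := h.equiv.surjective s
  induction q using Finsupp.induction_linear with
  | zero => simpa using mon 0 0
  | add p q hp hq => rw [map_add]; exact add _ _ hp hq
  | single j p => rw [equiv_single]; exact mon p j

/-- The coefficient of `y⁰`. -/
def coeffZero (h : IsShiftOre x y c) : S →ₗ[k] k[X] := Finsupp.lapply 0 ∘ₗ h.equiv.symm.toLinearMap

theorem coeffZero_mon (h : IsShiftOre x y c) (p : k[X]) (j : ℕ) :
    h.coeffZero (aeval x p * y ^ j) = if j = 0 then p else 0 := by
  rw [← h.equiv_single]
  simp [coeffZero, Finsupp.single_apply]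

theorem coeffZero_one (h : IsShiftOre x y c) : h.coeffZero 1 = 1 := by
  simpa using h.coeffZero_mon 1 0

theorem coeffZero_mul_y (h : IsShiftOre x y c) (s : S) : h.coeffZero (s * y) = 0 := by
  induction s using h.induction with
  | add s t hs ht => rw [add_mul, map_add, hs, ht, add_zero]
  | mon p j => rw [mul_assoc, ← pow_succ, coeffZero_mon]; simp

theorem coeffZero_y_mul (h : IsShiftOre x y c) (s : S) : h.coeffZero (y * s) = 0 := by
  induction s using h.induction with
  | add s t hs ht => rw [mul_add, map_add, hs, ht, add_zero]
  | mon p j =>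
    rw [← mul_assoc, mul_aeval_of_mul_eq h.rel, mul_assoc, ← pow_succ', coeffZero_mon]; simp

theorem coeffZero_aeval_mul (h : IsShiftOre x y c) (f : k[X]) (s : S) :
    h.coeffZero (aeval x f * s) = f * h.coeffZero s := by
  induction s using h.induction with
  | add s t hs ht => rw [mul_add, map_add, hs, ht, map_add, mul_add]
  | mon p j =>
    rw [← mul_assoc, ← map_mul, coeffZero_mon, coeffZero_mon]; simp

theorem mon_mul_x (h : IsShiftOre x y c) (p : k[X]) (j : ℕ) :
    aeval x p * y ^ j * x = aeval x (p * (X + C (j * c))) * y ^ j := by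
  have := pow_mul_aeval_of_mul_eq h.rel j X
  rw [aeval_X] at this
  rw [mul_assoc, this, map_mul, mul_assoc, taylor_X]

/-- Right multiplication by x multiplies the coefficient of yʲ by X + jc, which is X for j = 0. -/
theorem coeffZero_mul_x (h : IsShiftOre x y c) (s : S) : h.coeffZero (s * x) = X * h.coeffZero s := by
  induction s using h.induction with
  | add s t hs ht => rw [add_mul, map_add, hs, ht, map_add, mul_add]
  | mon p j =>
    rw [h.mon_mul_x, coeffZero_mon, coeffZero_mon]
    split_ifs with hj
    · simp [hj, mul_comm]
    · simp

theorem eq_add_mul_y (h : IsShiftOre x y c) (s : S) : ∃ t, s = aeval x (h.coeffZero s) + t * y := by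
  induction s using h.induction with
  | add s t hs ht =>
    obtain ⟨a, ha⟩ := hs
    obtain ⟨b, hb⟩ := ht
    refine ⟨a + b, ?_⟩
    rw [map_add, map_add, add_mul]
    nth_rewrite 1 [ha, hb]
    abel
  | mon p j =>
    rw [coeffZero_mon]
    cases j with
    | zero => exact ⟨0, by simp⟩
    | succ j => exact ⟨aeval x p * y ^ j, by simp [pow_succ, mul_assoc]⟩

theorem eq_zero_of_mul_y_eq_zero (h : IsShiftOre x y c) {s : S} (hs : s * y = 0) : s = 0 := by
  obtain ⟨q, rfl⟩ := h.equiv.surjective s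
  have e : h.equiv q * y = h.equiv (Finsupp.mapDomain Nat.succ q) := by
    clear hs
    induction q using Finsupp.induction_linear with
    | zero => simp
    | add p q hp hq => rw [map_add, add_mul, hp, hq, Finsupp.mapDomain_add, map_add]
    | single j p => rw [Finsupp.mapDomain_single, equiv_single, equiv_single, mul_assoc, ← pow_succ]
  rw [e, LinearEquiv.map_eq_zero_iff, ← Finsupp.mapDomain_zero (f := Nat.succ)] at hs
  rw [Finsupp.mapDomain_injective Nat.succ_injective hs, map_zero]

end IsShiftOre

end OreRing

/-! ### Global dimension two of the Ore extension. -/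

section GlobalDimension

open Polynomial

namespace IsShiftOre

variable {k : Type*} [Field k] {S : Type u} [Ring S] [Algebra k S] {x y : S} {c : k}
  {M : Type u} [AddCommGroup M] [Module S M] [Module k M] [IsScalarTower k S M]

/-- The action of `s` on `M`, as a `k`-linear map. -/
def act (k : Type*) [Field k] {S : Type u} [Ring S] [Algebra k S] (M : Type u) [AddCommGroup M]
    [Module S M] [Module k M] [IsScalarTower k S M] : S →ₐ[k] Module.End k M :=
  Algebra.lsmul k k M

/-- The `S`-linear endomorphism `s ⊗ m ↦ s z ⊗ m - s ⊗ z m` of `S ⊗ M`. -/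
def koszulMap (k : Type*) [Field k] {S : Type u} [Ring S] [Algebra k S] (M : Type u)
    [AddCommGroup M] [Module S M] [Module k M] [IsScalarTower k S M] (z : S) :
    S ⊗[k] M →ₗ[S] S ⊗[k] M :=
  TensorProduct.AlgebraTensorModule.map (LinearMap.toSpanSingleton S S z) LinearMap.id -
    TensorProduct.AlgebraTensorModule.map LinearMap.id (act k M z)

@[simp] theorem koszulMap_tmul (z s : S) (m : M) :
    koszulMap k M z (s ⊗ₜ m) = (s * z) ⊗ₜ m - s ⊗ₜ (z • m) := by
  simp [koszulMap, act]

/-- The action map `S ⊗ M → M`. -/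
def actMap (k : Type*) [Field k] {S : Type u} [Ring S] [Algebra k S] (M : Type u)
    [AddCommGroup M] [Module S M] [Module k M] [IsScalarTower k S M] : S ⊗[k] M →ₗ[S] M :=
  TensorProduct.AlgebraTensorModule.lift
    { toFun := fun s => act k M s
      map_add' := fun s t => map_add _ s t
      map_smul' := fun s t => by ext m; simp [act] }

@[simp] theorem actMap_tmul (s : S) (m : M) : actMap k M (s ⊗ₜ[k] m) = s • m := rfl

/-- `S ⊗ M` as polynomials in `y` over `k[x] ⊗ M`. -/
def tensorEquiv (h : IsShiftOre x y c) (M : Type u) [AddCommGroup M] [Module k M] :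
    S ⊗[k] M ≃ₗ[k] (ℕ →₀ k[X] ⊗[k] M) :=
  (TensorProduct.congr h.equiv.symm (LinearEquiv.refl k M)) ≪≫ₗ
    TensorProduct.finsuppLeft k k k[X] M ℕ

omit [Module S M] [IsScalarTower k S M] in
theorem tensorEquiv_mon (h : IsShiftOre x y c) (p : k[X]) (j : ℕ) (m : M) :
    h.tensorEquiv M ((aeval x p * y ^ j) ⊗ₜ m) = Finsupp.single j (p ⊗ₜ m) := by
  rw [← h.equiv_single]
  simp only [tensorEquiv, LinearEquiv.trans_apply, TensorProduct.congr_tmul,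
    LinearEquiv.symm_apply_apply, LinearEquiv.refl_apply]
  rw [TensorProduct.finsuppLeft_apply_tmul, Finsupp.sum_single_index (by simp)]

/-- `k[x] ⊗ M` as polynomials in `x` over `M`. -/
def polyTensorEquiv (k : Type*) [Field k] (M : Type u) [AddCommGroup M] [Module k M] :
    k[X] ⊗[k] M ≃ₗ[k] (ℕ →₀ M) :=
  TensorProduct.congr ((Polynomial.toFinsuppIsoLinear k) ≪≫ₗ AddMonoidAlgebra.coeffLinearEquiv k)
    (LinearEquiv.refl k M) ≪≫ₗ
    TensorProduct.finsuppScalarLeft k M ℕ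

theorem polyTensorEquiv_X_pow (i : ℕ) (m : M) :
    polyTensorEquiv k M ((X ^ i) ⊗ₜ m) = Finsupp.single i m := by
  have e : (X ^ i : k[X]).toFinsupp.coeff = Finsupp.single i 1 := by
    rw [X_pow_eq_monomial, toFinsupp_monomial]; rfl
  change TensorProduct.finsuppScalarLeft k M ℕ ((X ^ i : k[X]).toFinsupp.coeff ⊗ₜ[k] m) = _
  rw [e, TensorProduct.finsuppScalarLeft_apply_tmul, Finsupp.sum_single_index (by simp), one_smul]

omit [Module S M] [IsScalarTower k S M] in
theorem tensor_ext (h : IsShiftOre x y c) {P : Type*} [AddCommMonoid P] [Module k P]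
    {f g : S ⊗[k] M →ₗ[k] P}
    (hfg : ∀ (p : k[X]) (j : ℕ) (m : M), f ((aeval x p * y ^ j) ⊗ₜ m) =
      g ((aeval x p * y ^ j) ⊗ₜ m)) : f = g := by
  refine TensorProduct.ext' fun s m => ?_
  induction s using h.induction with
  | add s t hs ht => rw [TensorProduct.add_tmul, map_add, map_add, hs, ht]
  | mon p j => exact hfg p j m

theorem polyTensor_ext {P : Type*} [AddCommMonoid P] [Module k P]
    {f g : k[X] ⊗[k] M →ₗ[k] P}
    (hfg : ∀ (i : ℕ) (m : M), f ((X ^ i) ⊗ₜ m) = g ((X ^ i) ⊗ₜ m)) : f = g := by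
  refine TensorProduct.ext' fun s m => ?_
  induction s using Polynomial.induction_on' with
  | add s t hs ht => rw [TensorProduct.add_tmul, map_add, map_add, hs, ht]
  | monomial p j =>
    rw [← C_mul_X_pow_eq_monomial, ← smul_eq_C_mul, TensorProduct.smul_tmul, hfg]

/-- The action of `y` on the second factor of `k[x] ⊗ M`. -/
abbrev yAct (k : Type*) [Field k] {S : Type u} [Ring S] [Algebra k S] (M : Type u)
    [AddCommGroup M] [Module S M] [Module k M] [IsScalarTower k S M] (y : S) :
    k[X] ⊗[k] M →ₗ[k] k[X] ⊗[k] M := TensorProduct.map LinearMap.id (act k M y)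

theorem yAct_pow_tmul (j : ℕ) (p : k[X]) (m : M) :
    ((yAct k M y) ^ j) (p ⊗ₜ m) = p ⊗ₜ (y ^ j • m) := by
  induction j generalizing m with
  | zero => simp
  | succ j ih => rw [pow_succ, Module.End.mul_apply, TensorProduct.map_tmul, LinearMap.id_apply, ih,
      pow_succ, mul_smul]; rfl

theorem tensorEquiv_koszulMap (h : IsShiftOre x y c) (t : S ⊗[k] M) :
    h.tensorEquiv M (koszulMap k M y t) = shiftSub (yAct k M y) (h.tensorEquiv M t) := by
  have e : (h.tensorEquiv M).toLinearMap ∘ₗ (koszulMap k M y).restrictScalars k =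
      shiftSub (yAct k M y) ∘ₗ (h.tensorEquiv M).toLinearMap := by
    apply h.tensor_ext
    intro p j m
    simp only [LinearMap.comp_apply, LinearMap.restrictScalars_apply, koszulMap_tmul,
      LinearEquiv.coe_coe, map_sub, tensorEquiv_mon, shiftSub_single, TensorProduct.map_tmul]
    rw [mul_assoc, ← pow_succ, tensorEquiv_mon]
    rfl
  exact LinearMap.congr_fun e t

/-- The map `S ⊗ M → k[x] ⊗ M`, `p(x) yʲ ⊗ m ↦ p(x) ⊗ yʲ m`. -/
def reduce (h : IsShiftOre x y c) (M : Type u) [AddCommGroup M] [Module S M] [Module k M]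
    [IsScalarTower k S M] : S ⊗[k] M →ₗ[k] k[X] ⊗[k] M :=
  evalEnd (yAct k M y) ∘ₗ (h.tensorEquiv M).toLinearMap

theorem reduce_mon (h : IsShiftOre x y c) (p : k[X]) (j : ℕ) (m : M) :
    h.reduce M ((aeval x p * y ^ j) ⊗ₜ m) = p ⊗ₜ (y ^ j • m) := by
  rw [reduce, LinearMap.comp_apply, LinearEquiv.coe_coe, tensorEquiv_mon, evalEnd_single,
    yAct_pow_tmul]

theorem koszulMap_y_injective (h : IsShiftOre x y c) : Function.Injective (koszulMap k M y) := by
  have : ⇑(h.tensorEquiv M) ∘ koszulMap k M y = shiftSub (yAct k M y) ∘ h.tensorEquiv M :=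
    funext h.tensorEquiv_koszulMap
  refine Function.Injective.of_comp (f := h.tensorEquiv M) ?_
  rw [this]
  exact (shiftSub_injective _).comp (h.tensorEquiv M).injective

theorem reduce_surjective (h : IsShiftOre x y c) : Function.Surjective (h.reduce M) :=
  (evalEnd_surjective _).comp (h.tensorEquiv M).surjective

theorem reduce_eq_zero_iff (h : IsShiftOre x y c) (t : S ⊗[k] M) :
    h.reduce M t = 0 ↔ t ∈ LinearMap.range (koszulMap k M y) := by
  constructor
  · intro ht
    obtain ⟨q, hq⟩ := mem_range_shiftSub _ ht
    obtain ⟨t', rfl⟩ := (h.tensorEquiv M).surjective q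
    refine ⟨t', (h.tensorEquiv M).injective ?_⟩
    rw [tensorEquiv_koszulMap, hq]; rfl
  · rintro ⟨t', rfl⟩
    rw [reduce, LinearMap.comp_apply, LinearEquiv.coe_coe, tensorEquiv_koszulMap,
      evalEnd_shiftSub]

/-- The endomorphism `p ⊗ m ↦ x p ⊗ m - p ⊗ x m` of `k[x] ⊗ M`. -/
def polyKoszulMap (k : Type*) [Field k] {S : Type u} [Ring S] [Algebra k S] (M : Type u)
    [AddCommGroup M] [Module S M] [Module k M] [IsScalarTower k S M] (x : S) :
    k[X] ⊗[k] M →ₗ[k] k[X] ⊗[k] M :=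
  TensorProduct.map (LinearMap.mulLeft k X) LinearMap.id -
    TensorProduct.map LinearMap.id (act k M x)

theorem polyTensorEquiv_polyKoszulMap (t : k[X] ⊗[k] M) :
    polyTensorEquiv k M (polyKoszulMap k M x t) = shiftSub (act k M x) (polyTensorEquiv k M t) := by
  refine LinearMap.congr_fun (f := (polyTensorEquiv k M).toLinearMap ∘ₗ
    (polyKoszulMap k M x)) (g := shiftSub (act k M x) ∘ₗ
    (polyTensorEquiv k M).toLinearMap) (polyTensor_ext fun i m => ?_) t
  simp only [LinearMap.comp_apply, LinearEquiv.coe_coe, polyTensorEquiv_X_pow, shiftSub_single,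
    polyKoszulMap, LinearMap.sub_apply, TensorProduct.map_tmul, LinearMap.mulLeft_apply,
    ← pow_succ', LinearMap.id_apply, map_sub]

/-- `reduce` identifies the cokernel of `koszulMap k M y` with k[x] ⊗ M. Moving x to the left of yʲ
produces the term jc both in S and in M, and the two cancel in the difference. -/
theorem reduce_koszulMap (h : IsShiftOre x y c) (t : S ⊗[k] M) :
    h.reduce M (koszulMap k M x t) = polyKoszulMap k M x (h.reduce M t) := by
  refine LinearMap.congr_fun (f := h.reduce M ∘ₗ (koszulMap k M x).restrictScalars k)
    (g := polyKoszulMap k M x ∘ₗ h.reduce M) (h.tensor_ext fun p j m => ?_) t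
  simp only [LinearMap.comp_apply, LinearMap.restrictScalars_apply, koszulMap_tmul, map_sub,
    h.mon_mul_x, reduce_mon, polyKoszulMap, LinearMap.sub_apply, TensorProduct.map_tmul,
    LinearMap.id_apply, LinearMap.mulLeft_apply]
  have e : y ^ j • x • m = x • y ^ j • m + (j * c) • y ^ j • m := by
    have := pow_mul_aeval_of_mul_eq h.rel j X
    rw [aeval_X, taylor_X, map_add, aeval_X, aeval_C] at this
    rw [← mul_smul, this, add_mul, add_smul, mul_smul, mul_smul, algebraMap_smul]
  rw [e, mul_add, TensorProduct.add_tmul, TensorProduct.tmul_add, mul_comm p (C _),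
    ← smul_eq_C_mul, TensorProduct.smul_tmul, mul_comm X p]
  simp only [act, Algebra.lsmul_coe]
  abel

theorem actMap_eq (h : IsShiftOre x y c) (t : S ⊗[k] M) :
    actMap k M t = evalEnd (act k M x) (polyTensorEquiv k M (h.reduce M t)) := by
  have e : ∀ (p : k[X]) (m : M), evalEnd (act k M x) (polyTensorEquiv k M (p ⊗ₜ m)) =
      aeval x p • m := by
    intro p m
    refine LinearMap.congr_fun (f := evalEnd (act k M x) ∘ₗ (polyTensorEquiv k M).toLinearMap)
      (g := TensorProduct.lift ((act k M).toLinearMap ∘ₗ (aeval x).toLinearMap))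
      (polyTensor_ext fun i m => ?_) (p ⊗ₜ m)
    simp only [LinearMap.comp_apply, LinearEquiv.coe_coe, polyTensorEquiv_X_pow, evalEnd_single,
      TensorProduct.lift.tmul, AlgHom.toLinearMap_apply, map_pow, aeval_X]
  refine LinearMap.congr_fun (f := (actMap k M).restrictScalars k) (g := evalEnd (act k M x) ∘ₗ
    (polyTensorEquiv k M).toLinearMap ∘ₗ h.reduce M) (h.tensor_ext fun p j m => ?_) t
  simp only [LinearMap.comp_apply, LinearEquiv.coe_coe, reduce_mon, e,
    LinearMap.restrictScalars_apply, actMap_tmul, mul_smul]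

theorem koszulMap_x_mem (h : IsShiftOre x y c) :
    LinearMap.range (koszulMap k M y) ≤ (LinearMap.range (koszulMap k M y)).comap
      (koszulMap k M x) := by
  intro t ht
  rw [Submodule.mem_comap, ← h.reduce_eq_zero_iff, reduce_koszulMap,
    (h.reduce_eq_zero_iff t).2 ht, map_zero]

/-- The cokernel Q of the injective map `koszulMap k M y` between free modules has projective
dimension at most one. The map induced by x on Q is injective with cokernel M. Under Q ≅ k[x] ⊗ M
both facts are the sequence of X - φ for φ the action of x on M. -/
theorem hasProjectiveDimensionLT_three (h : IsShiftOre x y c) (M : ModuleCat.{u} S) :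
    HasProjectiveDimensionLT M 3 := by
  let : Module k M := Module.restrictScalars k S M
  let : IsScalarTower k S M := IsScalarTower.restrictScalars k S M
  let Dy := koszulMap k M y
  let Q := (S ⊗[k] M) ⧸ LinearMap.range Dy
  let Dx : Q →ₗ[S] Q := Submodule.mapQ _ _ (koszulMap k M x) h.koszulMap_x_mem
  let ev : Q →ₗ[S] M := Submodule.liftQ _ (actMap k M) (by
    intro t ht
    rw [LinearMap.mem_ker, h.actMap_eq, (h.reduce_eq_zero_iff t).2 ht, map_zero, map_zero])
  have s1 : (ModuleCat.shortComplexOfCompEqZero Dy (Submodule.mkQ (LinearMap.range Dy))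
      (by ext; simp)).ShortExact := by
    refine ModuleCat.shortComplex_shortExact _ ?_ h.koszulMap_y_injective
      (Submodule.mkQ_surjective _)
    exact LinearMap.exact_iff.2 (Submodule.ker_mkQ _)
  have hev : ∀ t, ev (Dx t) = 0 := by
    intro q
    obtain ⟨t, rfl⟩ := Submodule.mkQ_surjective _ q
    change actMap k M (koszulMap k M x t) = 0
    rw [h.actMap_eq, reduce_koszulMap, polyTensorEquiv_polyKoszulMap, evalEnd_shiftSub]
  have s2 : (ModuleCat.shortComplexOfCompEqZero Dx ev (by exact LinearMap.ext hev)).ShortExact := by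
    refine ModuleCat.shortComplex_shortExact _ ?_ ?_ ?_
    · intro q
      refine ⟨fun hq => ?_, fun ⟨q', hq'⟩ => hq' ▸ hev q'⟩
      obtain ⟨t, rfl⟩ := Submodule.mkQ_surjective _ q
      change actMap k M t = 0 at hq
      rw [h.actMap_eq] at hq
      obtain ⟨n, hn⟩ := mem_range_shiftSub _ hq
      obtain ⟨n, rfl⟩ := (polyTensorEquiv k M).surjective n
      obtain ⟨t', rfl⟩ := h.reduce_surjective n
      rw [← polyTensorEquiv_polyKoszulMap, ← reduce_koszulMap] at hn
      refine ⟨Submodule.mkQ _ t', ?_⟩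
      change Submodule.Quotient.mk (koszulMap k M x t') = Submodule.Quotient.mk t
      rw [Submodule.Quotient.eq, ← h.reduce_eq_zero_iff, map_sub, sub_eq_zero]
      exact (polyTensorEquiv k M).injective hn
    · change Function.Injective Dx
      rw [injective_iff_map_eq_zero]
      intro q hq
      obtain ⟨t, rfl⟩ := Submodule.mkQ_surjective _ q
      replace hq : Submodule.Quotient.mk (p := LinearMap.range Dy) (koszulMap k M x t) = 0 := hq
      rw [Submodule.Quotient.mk_eq_zero, ← h.reduce_eq_zero_iff, reduce_koszulMap] at hq
      refine (Submodule.Quotient.mk_eq_zero _).2 ?_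
      rw [← h.reduce_eq_zero_iff]
      apply (polyTensorEquiv k M).injective
      apply shiftSub_injective (act k M x)
      rw [← polyTensorEquiv_polyKoszulMap, hq, map_zero, map_zero]
    · intro m
      exact ⟨Submodule.mkQ _ (1 ⊗ₜ m), by
        change actMap k M ((1 : S) ⊗ₜ m) = m
        rw [actMap_tmul, one_smul]⟩
  have hT : Projective (ModuleCat.of S (S ⊗[k] M)) :=
    ModuleCat.projective_of_categoryTheory_projective _
  have hQ : HasProjectiveDimensionLT (ModuleCat.of S Q) 2 :=
    s1.hasProjectiveDimensionLT_X₃ 1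
      (show HasProjectiveDimensionLT (ModuleCat.of S (S ⊗[k] M)) 1 from inferInstance)
      (show HasProjectiveDimensionLT (ModuleCat.of S (S ⊗[k] M)) 2 from inferInstance)
  exact s2.hasProjectiveDimensionLT_X₃ 2 hQ (hasProjectiveDimensionLT_of_ge _ 2 3 (by omega))

/-- The map `(a, b) ↦ a x + b y` onto the left ideal generated by `x` and `y`. -/
def idealMap (x y : S) : (Fin 2 → S) →ₗ[S] Ideal.span {x, y} :=
  LinearMap.codRestrict _ (Fintype.linearCombination S ![x, y]) (by
    intro f
    simp only [Fintype.linearCombination_apply, Fin.sum_univ_two, smul_eq_mul]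
    exact add_mem (Ideal.mul_mem_left _ _ (Ideal.subset_span (by simp)))
      (Ideal.mul_mem_left _ _ (Ideal.subset_span (by simp))))

theorem idealMap_apply (x y : S) (f : Fin 2 → S) : (idealMap x y f : S) = f 0 * x + f 1 * y := by
  simp [idealMap, Fintype.linearCombination_apply]

theorem idealMap_surjective (x y : S) : Function.Surjective (idealMap x y) := by
  rintro ⟨s, hs⟩
  obtain ⟨a, b, rfl⟩ := Ideal.mem_span_pair.1 hs
  exact ⟨![a, b], Subtype.ext (by simp [idealMap_apply])⟩

/-- In ax + by = 0 the constant coefficient of a must vanish, so a = sy; the relation yx = (x + c)y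
and cancellation of y then determine b. -/
theorem exists_of_idealMap_eq_zero (h : IsShiftOre x y c) {f : Fin 2 → S}
    (hf : idealMap x y f = 0) :
    ∃ s, f 0 = s * y ∧ f 1 = -(s * (x + algebraMap k S c)) := by
  have hf' : f 0 * x + f 1 * y = 0 := by rw [← idealMap_apply, hf]; rfl
  have h0 : h.coeffZero (f 0) = 0 := by
    have := congrArg h.coeffZero hf'
    rw [map_add, coeffZero_mul_x, coeffZero_mul_y, add_zero, map_zero] at this
    exact (mul_eq_zero.1 this).resolve_left X_ne_zero
  obtain ⟨s, hs⟩ := h.eq_add_mul_y (f 0)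
  rw [h0, map_zero, zero_add] at hs
  refine ⟨s, hs, ?_⟩
  rw [hs, mul_assoc, h.rel, ← mul_assoc, ← add_mul] at hf'
  exact eq_neg_of_add_eq_zero_right (h.eq_zero_of_mul_y_eq_zero hf')

/-- Projective dimension at most one would make Sx + Sy projective, so the syzygy module, spanned by
w = (y, -(x + c)), would be a direct summand of S². This would put 1 into the right ideal yS + (x +
c)S. -/
theorem not_projectiveDimension_lt_two (h : IsShiftOre x y c) :
    ¬ HasProjectiveDimensionLT (ModuleCat.of S (S ⧸ Ideal.span {x, y})) 2 := by
  intro hpd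
  set I : Ideal S := Ideal.span {x, y}
  have h1 : HasProjectiveDimensionLT (ModuleCat.of S I) 1 :=
    (shortExact_quotientShortComplex I).hasProjectiveDimensionLT_X₁ 1
      (show HasProjectiveDimensionLT (ModuleCat.of S S) 1 from inferInstance) hpd
  have : Projective (ModuleCat.of S I) := inferInstance
  have hI : Module.Projective S I := ModuleCat.projective_of_module_projective (ModuleCat.of S I)
  obtain ⟨σ, hσ⟩ := Module.projective_lifting_property (idealMap x y) LinearMap.id
    (idealMap_surjective x y)
  have hker : ∀ f, idealMap x y (f - σ (idealMap x y f)) = 0 := by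
    intro f
    rw [map_sub, sub_eq_zero]
    exact (LinearMap.congr_fun hσ (idealMap x y f)).symm
  obtain ⟨s₀, ha₀, -⟩ := h.exists_of_idealMap_eq_zero (hker (Pi.single 0 1))
  obtain ⟨s₁, ha₁, -⟩ := h.exists_of_idealMap_eq_zero (hker (Pi.single 1 1))
  set w : Fin 2 → S := ![y, -(x + algebraMap k S c)] with hw
  have hw0 : idealMap x y w = 0 := by
    apply Subtype.ext
    rw [idealMap_apply, hw]
    simp only [Matrix.cons_val_zero, Matrix.cons_val_one, h.rel, neg_mul, add_neg_cancel]
    rfl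
  have hwe : w = y • Pi.single 0 1 + (-(x + algebraMap k S c)) • Pi.single 1 1 := by
    ext i; fin_cases i <;> simp [hw]
  have e : w 0 = y * (s₀ * y) + (-(x + algebraMap k S c)) * (s₁ * y) := by
    have : w = y • (Pi.single 0 1 - σ (idealMap x y (Pi.single 0 1))) +
        (-(x + algebraMap k S c)) • (Pi.single 1 1 - σ (idealMap x y (Pi.single 1 1))) := by
      have h2 : σ (idealMap x y w) = 0 := by rw [hw0, map_zero]
      rw [hwe, map_add, map_add, map_smul, map_smul, map_smul, map_smul] at h2
      rw [smul_sub, smul_sub, sub_add_sub_comm, h2, sub_zero, ← hwe]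
    rw [← ha₀, ← ha₁]
    nth_rewrite 1 [this]
    rfl
  -- The projections of the two basis vectors to the syzygies are s₀w and s₁w. Projecting w itself
  -- gives w = (ys₀ - (x + c)s₁)w; this is its first component.
  have e1 : (1 - (y * s₀ + (-(x + algebraMap k S c)) * s₁)) * y = 0 := by
    rw [sub_mul, one_mul, add_mul, mul_assoc, mul_assoc, ← e, hw]; simp [sub_self]
  have e2 := h.eq_zero_of_mul_y_eq_zero e1
  have e3 := congrArg h.coeffZero e2
  have e4 : -(x + algebraMap k S c) = aeval x (-(X + C c)) := by simp
  rw [map_sub, map_add, coeffZero_one, coeffZero_y_mul, e4, coeffZero_aeval_mul, map_zero,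
    zero_add] at e3
  -- The constant coefficient of the identity has the form 1 + (X + c)q = 0, which fails at X = -c.
  have e5 := congrArg (eval (-c)) e3
  simp at e5

theorem hasGlobalDimension_two (h : IsShiftOre x y c) : HasGlobalDimension S 2 := by
  refine le_antisymm (iSup_le fun M => ?_) ?_
  · exact (projectiveDimension_le_iff M 2).2 (h.hasProjectiveDimensionLT_three M)
  · refine le_iSup_of_le (ModuleCat.of S (S ⧸ Ideal.span {x, y})) ?_
    exact (projectiveDimension_ge_iff _ 2).2 h.not_projectiveDimension_lt_two

end IsShiftOre

end GlobalDimension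

/-! ### Connected graded algebras, augmentation, generation in degree one. -/

section GradedBasics

open DirectSum GradedAlgebra

variable {k : Type*} [Field k] {A : Type u} [Ring A] [Algebra k A] (𝒜 : ℕ → Submodule k A)
  [GradedAlgebra 𝒜]

theorem proj_mem (n : ℕ) (a : A) : proj 𝒜 n a ∈ 𝒜 n := (decompose 𝒜 a n).2

variable {𝒜}

theorem proj_of_mem_same {a : A} {n : ℕ} (ha : a ∈ 𝒜 n) : proj 𝒜 n a = a :=
  decompose_of_mem_same 𝒜 ha

theorem proj_of_mem_ne {a : A} {n m : ℕ} (ha : a ∈ 𝒜 n) (h : n ≠ m) : proj 𝒜 m a = 0 :=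
  decompose_of_mem_ne 𝒜 ha h

theorem proj_mul_of_mem_right {b : A} {i : ℕ} (hb : b ∈ 𝒜 i) (n : ℕ) (a : A) :
    proj 𝒜 (n + i) (a * b) = proj 𝒜 n a * b :=
  coe_decompose_mul_add_of_right_mem 𝒜 hb

theorem proj_mul_of_mem_left {b : A} {i : ℕ} (hb : b ∈ 𝒜 i) (n : ℕ) (a : A) :
    proj 𝒜 (i + n) (b * a) = b * proj 𝒜 n a :=
  coe_decompose_mul_add_of_left_mem 𝒜 hb

theorem proj_mul_of_mem_left_lt {b : A} {i : ℕ} (hb : b ∈ 𝒜 i) {n : ℕ} (hn : n < i) (a : A) :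
    proj 𝒜 n (b * a) = 0 :=
  coe_decompose_mul_of_left_mem_of_not_le 𝒜 hb (not_le.2 hn)

theorem eq_of_forall_proj_eq {a b : A} (h : ∀ n, proj 𝒜 n a = proj 𝒜 n b) : a = b := by
  apply (decompose 𝒜).injective
  ext n
  exact h n

theorem exists_eq_sum_proj (a : A) : ∃ N, ∀ M, N ≤ M → a = ∑ n ∈ Finset.range M, proj 𝒜 n a := by
  classical
  refine ⟨(decompose 𝒜 a).support.sup id + 1, fun M hM => ?_⟩
  conv_lhs => rw [← sum_support_decompose 𝒜 a]
  refine Finset.sum_subset (fun n hn => ?_) (fun n _ hn => ?_)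
  · have := Finset.le_sup (f := id) hn
    simp only [id] at this
    exact Finset.mem_range.2 (by omega)
  · rw [DFinsupp.notMem_support_iff] at hn
    change ((decompose 𝒜 a n : 𝒜 n) : A) = 0
    rw [hn]; rfl

theorem mem_of_forall_proj_mem {V : Type*} [AddCommGroup V] [Module k V] (f : A →ₗ[k] V)
    (W : Submodule k V) {a : A} (h : ∀ n, f (proj 𝒜 n a) ∈ W) : f a ∈ W := by
  obtain ⟨N, hN⟩ := exists_eq_sum_proj (𝒜 := 𝒜) a
  rw [hN N le_rfl, map_sum]
  exact sum_mem fun n _ => h n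

/-- Linear maps which agree on homogeneous elements are equal. -/
theorem linearMap_ext_of_mem {V : Type*} [AddCommGroup V] [Module k V] {f g : A →ₗ[k] V}
    (h : ∀ n, ∀ a ∈ 𝒜 n, f a = g a) : f = g := by
  ext a
  obtain ⟨N, hN⟩ := exists_eq_sum_proj (𝒜 := 𝒜) a
  rw [hN N le_rfl, map_sum, map_sum]
  exact Finset.sum_congr rfl fun n _ => h n _ (proj_mem 𝒜 n a)

theorem proj_mul (n : ℕ) (a b : A) :
    proj 𝒜 n (a * b) = ∑ ij ∈ Finset.HasAntidiagonal.antidiagonal n, proj 𝒜 ij.1 a * proj 𝒜 ij.2 b := by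
  obtain ⟨N, hN⟩ := exists_eq_sum_proj (𝒜 := 𝒜) a
  have hN' := hN (max N (n + 1)) (le_max_left _ _)
  set M := max N (n + 1) with hM
  have hMn : n + 1 ≤ M := le_max_right _ _
  rw [Finset.Nat.sum_antidiagonal_eq_sum_range_succ (fun i j => proj 𝒜 i a * proj 𝒜 j b)]
  nth_rewrite 1 [hN']
  rw [Finset.sum_mul, map_sum, ← Finset.sum_subset (Finset.range_subset_range.2 hMn)]
  · refine Finset.sum_congr rfl fun i hi => ?_
    have hi' : i ≤ n := Nat.lt_succ_iff.1 (Finset.mem_range.1 hi)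
    have := proj_mul_of_mem_left (proj_mem 𝒜 i a) (n - i) b
    rwa [Nat.add_sub_cancel' hi'] at this
  · intro i _ hi
    exact proj_mul_of_mem_left_lt (proj_mem 𝒜 i a) (by simpa using hi) b

/-- By induction on n: in the degree n part of e·e every product has a left factor of degree less
than n, zero by induction, or is eₙe₀ = 0. -/
theorem eq_zero_of_mul_self_eq {e : A} (he : e * e = e) (h0 : proj 𝒜 0 e = 0) : e = 0 := by
  apply eq_of_forall_proj_eq (𝒜 := 𝒜)
  intro n
  rw [map_zero]
  induction n using Nat.strong_induction_on with
  | _ n ih =>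
    rw [← he, proj_mul]
    refine Finset.sum_eq_zero fun ij hij => ?_
    rw [Finset.HasAntidiagonal.mem_antidiagonal] at hij
    rcases lt_or_eq_of_le (show ij.1 ≤ n by omega) with h | h
    · rw [ih _ h, zero_mul]
    · rw [show ij.2 = 0 by omega, h0, mul_zero]

variable (𝒜)

/-- `𝒜` is connected, and generated in degree one. -/
structure IsStandardGraded : Prop where
  connected : 𝒜 0 = 1
  gen : ∀ n, 𝒜 (n + 1) = 𝒜 n * 𝒜 1

variable {𝒜}

section

variable [Nontrivial A] (h0 : 𝒜 0 = 1)

omit [Nontrivial A] in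
theorem exists_algebraMap_eq_proj_zero (h0 : 𝒜 0 = 1) (a : A) :
    ∃ c : k, algebraMap k A c = proj 𝒜 0 a := by
  have := proj_mem 𝒜 0 a
  rw [h0] at this
  exact Submodule.mem_one.1 this

/-- The augmentation of a connected graded algebra. -/
def aug (h0 : 𝒜 0 = 1) : A →ₐ[k] k :=
  have spec (a : A) := (exists_algebraMap_eq_proj_zero h0 a).choose_spec
  have inj := (algebraMap k A).injective
  { toFun := fun a => (exists_algebraMap_eq_proj_zero h0 a).choose
    map_one' := inj (by
      rw [spec]
      exact (proj_of_mem_same (SetLike.GradedOne.one_mem (A := 𝒜))).trans (map_one _).symm)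
    map_mul' := fun a b => inj (by
      rw [spec]
      refine (map_mul (GradedRing.projZeroRingHom 𝒜) a b).trans ?_
      rw [map_mul, spec, spec]; rfl)
    map_zero' := inj (by rw [spec, map_zero]; exact (map_zero _).symm)
    map_add' := fun a b => inj (by
      rw [spec, map_add]; refine .trans ?_ (map_add _ _ _).symm; rw [spec, spec])
    commutes' := fun c => inj (by
      rw [spec, Algebra.algebraMap_self, RingHom.id_apply]
      refine proj_of_mem_same ?_
      rw [h0]
      exact Submodule.mem_one.2 ⟨c, rfl⟩) }

theorem algebraMap_aug (a : A) : algebraMap k A (aug h0 a) = proj 𝒜 0 a :=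
  (exists_algebraMap_eq_proj_zero h0 a).choose_spec

theorem aug_eq_zero_iff (a : A) : aug h0 a = 0 ↔ proj 𝒜 0 a = 0 := by
  rw [← algebraMap_aug h0]
  exact (map_eq_zero_iff _ (algebraMap k A).injective).symm

theorem aug_of_mem_succ {n : ℕ} {a : A} (ha : a ∈ 𝒜 (n + 1)) : aug h0 a = 0 :=
  (aug_eq_zero_iff h0 a).2 (proj_of_mem_ne ha (by omega))

theorem aug_of_mem_pos {n : ℕ} (hn : n ≠ 0) {a : A} (ha : a ∈ 𝒜 n) : aug h0 a = 0 :=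
  (aug_eq_zero_iff h0 a).2 (proj_of_mem_ne ha hn)

theorem algebraMap_aug_of_mem {a : A} (ha : a ∈ 𝒜 0) : algebraMap k A (aug h0 a) = a := by
  rw [algebraMap_aug, proj_of_mem_same ha]

theorem mem_augmentationIdeal (a : A) : a ∈ augmentationIdeal 𝒜 ↔ aug h0 a = 0 := by
  constructor
  · intro ha
    induction ha using Submodule.span_induction with
    | mem x hx =>
      obtain ⟨n, hn⟩ := Set.mem_iUnion.1 hx
      exact aug_of_mem_succ h0 hn
    | zero => exact map_zero _
    | add x y _ _ hx hy => rw [map_add, hx, hy, add_zero]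
    | smul b x _ hx => rw [smul_eq_mul, map_mul, hx, mul_zero]
  · intro ha
    obtain ⟨N, hN⟩ := exists_eq_sum_proj (𝒜 := 𝒜) a
    rw [hN N le_rfl]
    refine sum_mem fun n _ => ?_
    cases n with
    | zero => rw [(aug_eq_zero_iff h0 a).1 ha]; exact zero_mem _
    | succ n => exact Ideal.subset_span (Set.mem_iUnion.2 ⟨n, proj_mem 𝒜 (n + 1) a⟩)

end

omit [GradedAlgebra 𝒜] in
/-- In degree `m + 1`, every element is a combination of generators of degree one. -/
theorem IsStandardGraded.exists_eq_sum_mul (h : IsStandardGraded 𝒜) {ι : Type*} [Fintype ι]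
    {x : ι → A} (hx : Submodule.span k (Set.range x) = 𝒜 1) {m : ℕ} {a : A}
    (ha : a ∈ 𝒜 (m + 1)) : ∃ c : ι → A, (∀ i, c i ∈ 𝒜 m) ∧ a = ∑ i, c i * x i := by
  rw [h.gen] at ha
  induction ha using Submodule.mul_induction_on' with
  | mem_mul_mem b hb z hz =>
    rw [← hx, Submodule.mem_span_range_iff_exists_fun] at hz
    obtain ⟨c, rfl⟩ := hz
    refine ⟨fun i => c i • b, fun i => Submodule.smul_mem _ _ hb, ?_⟩
    rw [Finset.mul_sum]
    exact Finset.sum_congr rfl fun i _ => by rw [smul_mul_assoc, mul_smul_comm]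
  | add b _ b' _ hb hb' =>
    obtain ⟨c, hc, rfl⟩ := hb
    obtain ⟨c', hc', rfl⟩ := hb'
    exact ⟨c + c', fun i => add_mem (hc i) (hc' i), by
      simp [add_mul, Finset.sum_add_distrib]⟩

theorem IsStandardGraded.exists_eq_sum_mul_of_proj_zero (h : IsStandardGraded 𝒜) {ι : Type*}
    [Fintype ι] {x : ι → A} (hx : Submodule.span k (Set.range x) = 𝒜 1) {a : A}
    (ha : proj 𝒜 0 a = 0) : ∃ c : ι → A, a = ∑ i, c i * x i := by
  have h1 : a ∈ LinearMap.range (Fintype.linearCombination A x) := by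
    refine mem_of_forall_proj_mem (𝒜 := 𝒜) LinearMap.id
      ((LinearMap.range (Fintype.linearCombination A x)).restrictScalars k) fun n => ?_
    cases n with
    | zero => rw [ha]; exact zero_mem _
    | succ n =>
      obtain ⟨c, -, hc⟩ := h.exists_eq_sum_mul hx (proj_mem 𝒜 (n + 1) a)
      exact ⟨c, hc.symm⟩
  obtain ⟨c, hc⟩ := h1
  exact ⟨c, hc.symm⟩

end GradedBasics

/-! ### The Koszul resolution of the trivial module of a regular algebra of dimension two. -/

section Koszul

open GradedAlgebra

variable {k : Type*} [Field k] {A : Type u} [Ring A] [Algebra k A] {𝒜 : ℕ → Submodule k A}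
  [GradedAlgebra 𝒜]

/-- The componentwise projection of vectors to degree `e`. -/
def vecProj (𝒜 : ℕ → Submodule k A) [GradedAlgebra 𝒜] (ι : Type*) (e : ℕ) :
    (ι → A) →ₗ[k] (ι → A) :=
  LinearMap.pi fun i => proj 𝒜 e ∘ₗ LinearMap.proj i

@[simp] theorem vecProj_apply (ι : Type*) (e : ℕ) (f : ι → A) (i : ι) :
    vecProj 𝒜 ι e f i = proj 𝒜 e (f i) := rfl

theorem vecProj_smul {ι : Type*} (e : ℕ) (a : A) (f : ι → A) :
    vecProj 𝒜 ι e (a • f) =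
      ∑ ij ∈ Finset.HasAntidiagonal.antidiagonal e, proj 𝒜 ij.1 a • vecProj 𝒜 ι ij.2 f := by
  ext i
  rw [Finset.sum_apply]
  exact proj_mul e a (f i)

theorem vecProj_mem {ι : Type*} [Finite ι] {f : ι → A} {W : Submodule A (ι → A)}
    (h : ∀ e, vecProj 𝒜 ι e f ∈ W) : f ∈ W := by
  cases nonempty_fintype ι
  choose N hN using fun i => exists_eq_sum_proj (𝒜 := 𝒜) (f i)
  have : f = ∑ e ∈ Finset.range (Finset.univ.sup N), vecProj 𝒜 ι e f := by
    ext i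
    rw [Finset.sum_apply]
    exact hN i _ (Finset.le_sup (Finset.mem_univ i))
  rw [this]
  exact sum_mem fun e _ => h e

/-- Exactness of the Koszul complex `0 → A → Aⁿ → A → k → 0` given by the rows `w` and `x`. -/
structure IsKoszulPair (𝒜 : ℕ → Submodule k A) [GradedAlgebra 𝒜] {ι : Type*} [Fintype ι] (x w : ι → A) : Prop where
  x_mem : ∀ i, x i ∈ 𝒜 1
  w_mem : ∀ i, w i ∈ 𝒜 1
  linearIndependent : LinearIndependent k x
  span_x : Submodule.span k (Set.range x) = 𝒜 1
  span_w : Submodule.span k (Set.range w) = 𝒜 1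
  rel : ∑ i, w i * x i = 0
  exact : ∀ f : ι → A, ∑ i, f i * x i = 0 → ∃ b, ∀ i, f i = b * w i
  inj : ∀ b, (∀ i, b * w i = 0) → b = 0
  gen : ∀ z, proj 𝒜 0 z = 0 → ∃ c : ι → A, z = ∑ i, w i * c i

section Syzygy

variable {ι : Type} [Fintype ι] (x : ι → A)

/-- The map `(aᵢ) ↦ ∑ aᵢ xᵢ` into the augmentation ideal. -/
def augMap (x : ι → A) (hx : ∀ i, x i ∈ 𝒜 1) : (ι → A) →ₗ[A] augmentationIdeal 𝒜 :=
  LinearMap.codRestrict _ (Fintype.linearCombination A x) fun f => by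
    rw [Fintype.linearCombination_apply]
    exact sum_mem fun i _ => Ideal.mul_mem_left _ _
      (Ideal.subset_span (Set.mem_iUnion.2 ⟨0, hx i⟩))

omit [GradedAlgebra 𝒜] in
theorem augMap_apply (hx : ∀ i, x i ∈ 𝒜 1) (f : ι → A) :
    (augMap x hx f : A) = ∑ i, f i * x i := by
  simp [augMap, Fintype.linearCombination_apply]

variable {x}

omit [GradedAlgebra 𝒜] in
theorem mem_ker_augMap (hx : ∀ i, x i ∈ 𝒜 1) {f : ι → A} :
    f ∈ LinearMap.ker (augMap x hx) ↔ ∑ i, f i * x i = 0 := by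
  rw [LinearMap.mem_ker, Subtype.ext_iff, augMap_apply]; rfl

theorem augMap_surjective [Nontrivial A] (h : IsStandardGraded 𝒜) (hx : ∀ i, x i ∈ 𝒜 1)
    (hspan : Submodule.span k (Set.range x) = 𝒜 1) : Function.Surjective (augMap x hx) := by
  rintro ⟨a, ha⟩
  rw [mem_augmentationIdeal h.connected, aug_eq_zero_iff] at ha
  obtain ⟨c, hc⟩ := h.exists_eq_sum_mul_of_proj_zero hspan ha
  exact ⟨c, Subtype.ext ((augMap_apply x hx c).trans hc.symm)⟩

theorem vecProj_mem_ker (hx : ∀ i, x i ∈ 𝒜 1) {f : ι → A} (hf : f ∈ LinearMap.ker (augMap x hx))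
    (e : ℕ) : vecProj 𝒜 ι e f ∈ LinearMap.ker (augMap x hx) := by
  rw [mem_ker_augMap] at hf ⊢
  have := congrArg (proj 𝒜 (e + 1)) hf
  rw [map_sum, map_zero] at this
  rw [← this]
  exact Finset.sum_congr rfl fun i _ => (proj_mul_of_mem_right (hx i) e (f i)).symm

/-- The presentation is minimal: the degree zero part of a syzygy is a linear dependence between the
xᵢ. -/
theorem proj_zero_of_mem_ker [Nontrivial A] (h : IsStandardGraded 𝒜) (hx : ∀ i, x i ∈ 𝒜 1)
    (hli : LinearIndependent k x) {f : ι → A} (hf : f ∈ LinearMap.ker (augMap x hx)) (i : ι) :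
    proj 𝒜 0 (f i) = 0 := by
  have h1 := vecProj_mem_ker hx hf 0
  rw [mem_ker_augMap] at h1
  rw [← aug_eq_zero_iff h.connected]
  refine Fintype.linearIndependent_iff.1 hli (fun i => aug h.connected (f i)) ?_ i
  rw [← h1]
  refine Finset.sum_congr rfl fun i _ => ?_
  rw [vecProj_apply, ← algebraMap_aug h.connected, Algebra.smul_def]

omit [Fintype ι] in
/-- Minimal generators of a projective graded syzygy module give functionals modulo `A₊`. -/
theorem exists_functional [Nontrivial A] (h : IsStandardGraded 𝒜) {K : Submodule A (ι → A)}
    (hproj : Module.Projective A K)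
    (W : Submodule A (ι → A)) (e : ℕ) (hlow : ∀ j < e, ∀ f ∈ K, vecProj 𝒜 ι j f ∈ W)
    {v : ι → A} (hv : v ∈ K) (hve : vecProj 𝒜 ι e v = v) (hvW : v ∉ W) :
    ∃ φ : K →ₗ[A] A, aug h.connected (φ ⟨v, hv⟩) = 1 ∧
      ∀ f : K, vecProj 𝒜 ι e f ∈ W → aug h.connected (φ f) = 0 := by
  -- `L` kills `W`, hence all components of degree below e. In the degree e part of a • f only the
  -- scalar part of a survives, so f ↦ L(fₑ) is A-linear with values in A/A₊ = k. Projectivity of K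
  -- lifts it to A.
  obtain ⟨L, hLv, hLW⟩ := (W.restrictScalars k).exists_le_ker_of_notMem hvW
  have key : ∀ (a : A) (f : K), L (vecProj 𝒜 ι e (a • (f : ι → A))) =
      aug h.connected a * L (vecProj 𝒜 ι e f) := by
    intro a f
    rw [vecProj_smul, map_sum, Finset.sum_eq_single (0, e)]
    · rw [← algebraMap_aug h.connected, algebraMap_smul, map_smul, smul_eq_mul]
    · rintro ⟨i, j⟩ hij hne
      rw [Finset.HasAntidiagonal.mem_antidiagonal] at hij
      have hj : j < e := by
        rcases Nat.eq_zero_or_pos i with hi | hi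
        · exact absurd (Prod.ext hi (by simp only at hij ⊢; omega)) hne
        · simp only at hij; omega
      exact hLW (W.smul_mem _ (hlow j hj f f.2))
    · intro hn
      exact absurd (Finset.HasAntidiagonal.mem_antidiagonal.2 (zero_add e)) hn
  let I := augmentationIdeal 𝒜
  let g : K →ₗ[A] (A ⧸ I) :=
    { toFun := fun f => Submodule.Quotient.mk (algebraMap k A (L (vecProj 𝒜 ι e f)))
      map_add' := fun f g => by
        rw [Submodule.coe_add, map_add, map_add, map_add]; rfl
      map_smul' := fun a f => by
        rw [Submodule.coe_smul, key, RingHom.id_apply, ← Submodule.Quotient.mk_smul,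
          Submodule.Quotient.eq, mem_augmentationIdeal h.connected, map_sub, smul_eq_mul, map_mul,
          map_mul, map_mul, AlgHom.commutes, AlgHom.commutes]
        simp }
  obtain ⟨φ, hφ⟩ := Module.projective_lifting_property (Submodule.mkQ I) g
    (Submodule.mkQ_surjective I)
  have hφ' : ∀ f : K, aug h.connected (φ f) = L (vecProj 𝒜 ι e f) := by
    intro f
    have := LinearMap.congr_fun hφ f
    change Submodule.Quotient.mk (φ f) = Submodule.Quotient.mk _ at this
    rw [Submodule.Quotient.eq, mem_augmentationIdeal h.connected, map_sub, AlgHom.commutes,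
      sub_eq_zero] at this
    exact this
  refine ⟨LinearMap.toSpanSingleton A A (algebraMap k A (L v)⁻¹) ∘ₗ φ, ?_, fun f hf => ?_⟩
  · simp only [LinearMap.comp_apply, LinearMap.toSpanSingleton_apply, smul_eq_mul, map_mul, hφ',
      hve, AlgHom.commutes]
    exact mul_inv_cancel₀ hLv
  · simp only [LinearMap.comp_apply, LinearMap.toSpanSingleton_apply, smul_eq_mul, map_mul, hφ']
    rw [show L (vecProj 𝒜 ι e f) = 0 from hLW hf, zero_mul]

/-- Let K be the module of syzygies of the xᵢ. It is projective because the global dimension is 2,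
and nonzero because Ext²(k, A) ≠ 0. Maps K → A that extend to Aⁿ take values in A₊, since K ⊆ A₊Aⁿ.
Two minimal generators of K would give two functionals independent modulo A₊, against dim Ext² = 1;
so K = Aw, and projectivity makes it free. Applying dim Ext² = 1 to the functionals w ↦ 1 and w ↦ z
shows that the wᵢ generate A₊ as a right ideal, which also places them in degree one. -/
theorem exists_isKoszulPair [Nontrivial A] (h : IsStandardGraded 𝒜)
    (hreg : IsLeftASRegular (k := k) A 𝒜 2) (hx : ∀ i, x i ∈ 𝒜 1) (hli : LinearIndependent k x)
    (hspan : Submodule.span k (Set.range x) = 𝒜 1) :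
    Nonempty ι ∧ ∃ w : ι → A, IsKoszulPair 𝒜 x w := by
  classical
  set p := augMap x hx with hp
  have hsurj : Function.Surjective p := augMap_surjective h hx hspan
  set K := LinearMap.ker p with hK
  have hproj : Module.Projective A K := by
    refine projective_ker_of_projectiveDimension_le_two _ p hsurj ?_
    refine (projectiveDimension_le_iff _ 2).1 ?_
    have := hreg.gldim
    rw [HasGlobalDimension] at this
    exact (le_iSup (fun M : ModuleCat.{u} A => projectiveDimension M) _).trans this.le
  have hKne : K ≠ ⊥ := by
    intro hbot
    obtain ⟨f, hf⟩ := exists_not_extension_of_finrank_ext_two (k := k) _ p hsurj hreg.ext_eq_one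
    refine hf ⟨0, fun y => ?_⟩
    have : y = 0 := Subtype.ext ((Submodule.mem_bot A).1 (hbot ▸ y.2))
    rw [this]; simp
  have hcomb := exists_extension_of_finrank_ext_two (k := k) _ p hsurj hreg.ext_eq_one
  have aug_ext : ∀ (e : (ι → A) →ₗ[A] A) (f : K), ∃ c : ι → A, e f = ∑ i, (f : ι → A) i * c i ∧
      aug h.connected (e f) = 0 := by
    intro e f
    have e1 : e f = ∑ i, (f : ι → A) i * e (Pi.single i 1) := by
      conv_lhs => rw [pi_eq_sum_univ' (f : ι → A), map_sum]
      refine Finset.sum_congr rfl fun i _ => ?_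
      rw [map_smul, smul_eq_mul]
    refine ⟨_, e1, ?_⟩
    rw [e1, map_sum]
    refine Finset.sum_eq_zero fun i _ => ?_
    rw [map_mul, (aug_eq_zero_iff h.connected _).2 (proj_zero_of_mem_ker h hx hli f.2 i), zero_mul]
  -- a nonzero homogeneous element of minimal degree
  have hex : ∃ d, ∃ w ∈ K, vecProj 𝒜 ι d w = w ∧ w ≠ 0 := by
    by_contra hcon
    push Not at hcon
    refine hKne ((Submodule.eq_bot_iff _).2 fun f hf => ?_)
    refine (Submodule.mem_bot A).1 (vecProj_mem (𝒜 := 𝒜) (W := ⊥) fun e => ?_)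
    refine (Submodule.mem_bot A).2 (hcon e _ (vecProj_mem_ker hx hf e) ?_)
    ext i
    exact proj_of_mem_same (proj_mem 𝒜 e (f i))
  set d := Nat.find hex with hd
  obtain ⟨w, hwK, hwd, hw0⟩ := Nat.find_spec hex
  have hlow : ∀ j < d, ∀ f ∈ K, vecProj 𝒜 ι j f = 0 := by
    intro j hj f hf
    by_contra hne
    refine Nat.find_min hex hj ⟨_, vecProj_mem_ker hx hf j, ?_, hne⟩
    ext i
    exact proj_of_mem_same (proj_mem 𝒜 j (f i))
  have hwmem : ∀ i, w i ∈ 𝒜 d := fun i => by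
    rw [← hwd]; exact proj_mem 𝒜 d (w i)
  -- it generates
  have hgen : ∀ f ∈ K, f ∈ Submodule.span A {w} := by
    by_contra hcon
    push Not at hcon
    have hex' : ∃ e, ∃ f ∈ K, vecProj 𝒜 ι e f ∉ Submodule.span A {w} := by
      by_contra hcon'
      push Not at hcon'
      obtain ⟨f, hf, hfn⟩ := hcon
      exact hfn (vecProj_mem (𝒜 := 𝒜) fun e => hcon' e f hf)
    set e := Nat.find hex' with he
    obtain ⟨f, hf, hfW⟩ := Nat.find_spec hex'
    have hidem : vecProj 𝒜 ι e (vecProj 𝒜 ι e f) = vecProj 𝒜 ι e f := by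
      ext i
      exact proj_of_mem_same (proj_mem 𝒜 e (f i))
    obtain ⟨φ₂, hφ₂, hφ₂'⟩ := exists_functional h hproj (Submodule.span A {w}) e (by
      intro j hj g hg
      by_contra hne
      exact Nat.find_min hex' hj ⟨g, hg, hne⟩) (vecProj_mem_ker hx hf e) hidem hfW
    obtain ⟨φ₁, hφ₁, -⟩ := exists_functional h hproj ⊥ d
      (fun j hj g hg => (Submodule.mem_bot A).2 (hlow j hj g hg)) hwK hwd (by simpa using hw0)
    have hφ₂w : aug h.connected (φ₂ ⟨w, hwK⟩) = 0 := by
      refine hφ₂' _ ?_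
      change vecProj 𝒜 ι e w ∈ _
      by_cases hde : d = e
      · rw [← hde, hwd]; exact Submodule.mem_span_singleton_self w
      · have : vecProj 𝒜 ι e w = 0 := by
          ext i
          exact proj_of_mem_ne (hwmem i) hde
        rw [this]; exact zero_mem _
    obtain ⟨a, b, hab, E, hE⟩ := hcomb φ₁ φ₂
    have hz : ∀ f : K, a * aug h.connected (φ₁ f) + b * aug h.connected (φ₂ f) = 0 := by
      intro f
      obtain ⟨-, -, h0⟩ := aug_ext E f
      rw [hE, map_add, map_smul, map_smul] at h0
      exact h0
    have ha : a = 0 := by simpa [hφ₁, hφ₂w] using hz ⟨w, hwK⟩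
    have hb : b = 0 := by simpa [ha, hφ₂] using hz ⟨vecProj 𝒜 ι e f, vecProj_mem_ker hx hf e⟩
    simp [ha, hb] at hab
  -- it generates freely
  have hinj : ∀ b : A, b • w = 0 → b = 0 := by
    let q : A →ₗ[A] K := LinearMap.toSpanSingleton A K ⟨w, hwK⟩
    have hq : Function.Surjective q := by
      rintro ⟨f, hf⟩
      obtain ⟨b, hb⟩ := Submodule.mem_span_singleton.1 (hgen f hf)
      exact ⟨b, Subtype.ext hb⟩
    -- A section of A → K sends w to an idempotent c with cw = w. Its degree zero part is 1, so the
    -- idempotent 1 - c has no degree zero part and vanishes; hence the section sends w to 1.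
    obtain ⟨s, hs⟩ := Module.projective_lifting_property q LinearMap.id hq
    set c := s ⟨w, hwK⟩ with hc
    have hcw : c • w = w := congrArg Subtype.val (LinearMap.congr_fun hs ⟨w, hwK⟩)
    have hcw' : c • (⟨w, hwK⟩ : K) = ⟨w, hwK⟩ := Subtype.ext hcw
    have hcc : c * c = c := by
      have := congrArg s hcw'
      rwa [map_smul] at this
    have hc0 : proj 𝒜 0 c = 1 := by
      obtain ⟨i, hi⟩ : ∃ i, w i ≠ 0 := by
        by_contra hcon
        push Not at hcon
        exact hw0 (funext hcon)
      have h1 : proj 𝒜 0 c * w i = w i := by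
        have := congrArg (proj 𝒜 (0 + d)) (congrFun hcw i)
        rwa [Pi.smul_apply, smul_eq_mul, proj_mul_of_mem_right (hwmem i), zero_add,
          proj_of_mem_same (hwmem i)] at this
      rw [← algebraMap_aug h.connected, ← Algebra.smul_def] at h1
      have h2 : (aug h.connected c - 1) • w i = 0 := by rw [sub_smul, one_smul, h1, sub_self]
      rw [← algebraMap_aug h.connected,
        sub_eq_zero.1 ((smul_eq_zero.1 h2).resolve_right hi), map_one]
    have hc1 : 1 - c = 0 := by
      refine eq_zero_of_mul_self_eq (𝒜 := 𝒜) ?_ ?_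
      · rw [mul_sub, sub_mul, sub_mul, hcc]; simp
      · rw [map_sub, hc0, proj_of_mem_same (SetLike.GradedOne.one_mem (A := 𝒜)), sub_self]
    intro b hb
    have hb' : b • (⟨w, hwK⟩ : K) = 0 := Subtype.ext hb
    have := congrArg s hb'
    rw [map_smul, map_zero, ← hc, ← sub_eq_zero.1 hc1, smul_eq_mul, mul_one] at this
    exact this
  have hrel : ∀ f ∈ K, ∃! b : A, b • w = f := by
    intro f hf
    obtain ⟨b, hb⟩ := Submodule.mem_span_singleton.1 (hgen f hf)
    refine ⟨b, hb, fun b' hb' => ?_⟩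
    exact sub_eq_zero.1 (hinj _ (by rw [sub_smul, hb', hb, sub_self]))
  let eK : A ≃ₗ[A] K := LinearEquiv.ofBijective (LinearMap.toSpanSingleton A K ⟨w, hwK⟩) (by
    constructor
    · rw [injective_iff_map_eq_zero]
      exact fun b hb => hinj b (congrArg Subtype.val hb)
    · rintro ⟨f, hf⟩
      obtain ⟨b, hb, -⟩ := hrel f hf
      exact ⟨b, Subtype.ext hb⟩)
  have heK : eK.symm ⟨w, hwK⟩ = 1 := by
    rw [LinearEquiv.symm_apply_eq]
    exact Subtype.ext (one_smul A w).symm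
  have hwI : ∀ i, proj 𝒜 0 (w i) = 0 := proj_zero_of_mem_ker h hx hli hwK
  have hright : ∀ z, proj 𝒜 0 z = 0 → ∃ c : ι → A, z = ∑ i, w i * c i := by
    intro z hz
    -- Here a + bz is the value at w of a map defined on Aⁿ, so it lies in ∑ wᵢA and has zero
    -- augmentation; thus a = 0 and b ≠ 0.
    obtain ⟨a, b, hab, E, hE⟩ := hcomb eK.symm.toLinearMap
      (LinearMap.toSpanSingleton A A z ∘ₗ eK.symm.toLinearMap)
    obtain ⟨c, hc, h0⟩ := aug_ext E ⟨w, hwK⟩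
    have e1 : E w = a • 1 + b • z := by
      have := hE ⟨w, hwK⟩
      simpa [heK] using this
    rw [show E ((⟨w, hwK⟩ : K) : ι → A) = _ from e1] at hc h0
    have ha : a = 0 := by
      rw [map_add, map_smul, map_smul, (aug_eq_zero_iff h.connected z).2 hz] at h0
      simpa using h0
    have hb : b ≠ 0 := by simpa [ha] using hab
    refine ⟨fun i => b⁻¹ • c i, ?_⟩
    rw [ha, zero_smul, zero_add] at hc
    rw [← inv_smul_smul₀ hb z, hc, Finset.smul_sum]
    exact Finset.sum_congr rfl fun i _ => (mul_smul_comm _ _ _).symm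
  have hne : Nonempty ι := by
    by_contra hcon
    rw [not_nonempty_iff] at hcon
    exact hw0 (Subsingleton.elim _ _)
  have hd0 : d ≠ 0 := by
    intro hd0
    refine hw0 (funext fun i => ?_)
    have := hwI i
    rwa [proj_of_mem_same (hd0 ▸ hwmem i)] at this
  -- An xᵢ lies in ∑ wᵢA, which has nothing in degree one if d ≥ 2.
  have hd1 : d = 1 := by
    by_contra hd1
    obtain ⟨i₀⟩ := hne
    obtain ⟨c, hc⟩ := hright (x i₀) (proj_of_mem_ne (hx i₀) one_ne_zero)
    refine hli.ne_zero i₀ ?_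
    rw [← proj_of_mem_same (hx i₀), hc, map_sum]
    exact Finset.sum_eq_zero fun i _ => proj_mul_of_mem_left_lt (hwmem i) (by omega) _
  rw [hd1] at hwmem
  refine ⟨hne, w, hx, hwmem, hli, hspan, ?_, (mem_ker_augMap hx).1 hwK, fun f hf => ?_,
    fun b hb => hinj b (funext hb), hright⟩
  · refine le_antisymm (Submodule.span_le.2 (by rintro _ ⟨i, rfl⟩; exact hwmem i)) fun z hz => ?_
    obtain ⟨c, hc⟩ := hright z (proj_of_mem_ne hz one_ne_zero)
    rw [← proj_of_mem_same hz, hc, map_sum]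
    refine sum_mem fun i _ => ?_
    have : proj 𝒜 (1 + 0) (w i * c i) = aug h.connected (c i) • w i := by
      rw [proj_mul_of_mem_left (hwmem i), ← algebraMap_aug h.connected, Algebra.smul_def,
        Algebra.commutes]
    rw [add_zero] at this
    rw [this]
    exact Submodule.smul_mem _ _ (Submodule.subset_span ⟨i, rfl⟩)
  · obtain ⟨b, hb, -⟩ := hrel f ((mem_ker_augMap hx).2 hf)
    exact ⟨b, fun i => (congrFun hb i).symm⟩

end Syzygy

end Koszul

/-! ### The Hilbert function n + 1. -/

section HilbertFunction

open GradedAlgebra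

variable {k : Type*} [Field k] {A : Type u} [Ring A] [Algebra k A] {𝒜 : ℕ → Submodule k A}
  [GradedAlgebra 𝒜]

namespace IsKoszulPair

variable {ι : Type} [Fintype ι] {x w : ι → A}

theorem exact_homogeneous (hp : IsKoszulPair 𝒜 x w) {m : ℕ} {f : ι → A}
    (hf : ∀ i, f i ∈ 𝒜 (m + 1)) (h : ∑ i, f i * x i = 0) : ∃ b ∈ 𝒜 m, ∀ i, f i = b * w i := by
  obtain ⟨b, hb⟩ := hp.exact f h
  refine ⟨proj 𝒜 m b, proj_mem 𝒜 m b, fun i => ?_⟩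
  rw [← proj_mul_of_mem_right (hp.w_mem i), ← hb, proj_of_mem_same (hf i)]

/-- This is the Euler characteristic of the Koszul complex in degree m + 2. -/
theorem finrank_add (hp : IsKoszulPair 𝒜 x w) (h : IsStandardGraded 𝒜)
    (hfin : ∀ n, Module.Finite k (𝒜 n)) (m : ℕ) :
    Module.finrank k (𝒜 (m + 2)) + Module.finrank k (𝒜 m) =
      Fintype.card ι * Module.finrank k (𝒜 (m + 1)) := by
  let q : (ι → 𝒜 (m + 1)) →ₗ[k] 𝒜 (m + 2) :=
    { toFun := fun f => ⟨∑ i, f i * x i, sum_mem fun i _ =>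
        show (f i : A) * x i ∈ 𝒜 (m + 1 + 1) from SetLike.GradedMul.mul_mem (f i).2 (hp.x_mem i)⟩
      map_add' := fun f g => Subtype.ext (by simp [add_mul, Finset.sum_add_distrib])
      map_smul' := fun c f => Subtype.ext (by simp [Finset.smul_sum]) }
  let j : 𝒜 m →ₗ[k] (ι → 𝒜 (m + 1)) :=
    { toFun := fun b i => ⟨b * w i, SetLike.GradedMul.mul_mem b.2 (hp.w_mem i)⟩
      map_add' := fun b c => by ext i; simp [add_mul]
      map_smul' := fun c b => by ext i; simp }
  have hq : LinearMap.range q = ⊤ := by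
    refine LinearMap.range_eq_top.2 fun a => ?_
    obtain ⟨c, hc, hac⟩ := h.exists_eq_sum_mul hp.span_x a.2
    exact ⟨fun i => ⟨c i, hc i⟩, Subtype.ext hac.symm⟩
  have hj : Function.Injective j := by
    rw [injective_iff_map_eq_zero]
    intro b hb
    exact Subtype.ext (hp.inj b fun i => congrArg Subtype.val (congrFun hb i))
  have hker : LinearMap.ker q = LinearMap.range j := by
    refine le_antisymm (fun f hf => ?_) ?_
    · obtain ⟨b, hb, hfb⟩ := hp.exact_homogeneous (f := fun i => f i) (fun i => (f i).2)
        (congrArg Subtype.val hf)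
      exact ⟨⟨b, hb⟩, funext fun i => Subtype.ext (hfb i).symm⟩
    · rintro _ ⟨b, rfl⟩
      refine Subtype.ext ?_
      change ∑ i, (b : A) * w i * x i = 0
      simp_rw [mul_assoc, ← Finset.mul_sum, hp.rel, mul_zero]
  have := q.finrank_range_add_finrank_ker
  rw [hq, hker, finrank_top, LinearMap.finrank_range_of_inj hj, Module.finrank_pi_fintype] at this
  simpa using this

end IsKoszulPair

theorem not_forall_two_pow_le (C N : ℕ) : ∃ m : ℕ, C * (m + 1) ^ N < 2 ^ m := by
  have h := tendsto_pow_const_div_const_pow_of_one_lt N (r := (2 : ℝ)) (by norm_num)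
  have h2 := (h.const_mul ((C : ℝ) * 2)).comp (Filter.tendsto_add_atTop_nat 1)
  rw [mul_zero] at h2
  obtain ⟨m, hm⟩ := (h2.eventually (gt_mem_nhds (show (0 : ℝ) < 1 by norm_num))).exists
  refine ⟨m, ?_⟩
  simp only [Function.comp_apply] at hm
  rw [← mul_div_assoc, div_lt_one (by positivity), pow_succ] at hm
  have : (C : ℝ) * ((m : ℝ) + 1) ^ N < 2 ^ m := by push_cast at hm; linarith
  exact_mod_cast this

omit [GradedAlgebra 𝒜] in
theorem IsStandardGraded.pow_eq (h : IsStandardGraded 𝒜) (n : ℕ) : 𝒜 n = 𝒜 1 ^ n := by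
  induction n with
  | zero => rw [h.connected, pow_zero]
  | succ n ih => rw [h.gen, ih, pow_succ]

theorem IsStandardGraded.finrank_eq [Nontrivial A] (h : IsStandardGraded 𝒜)
    (hfin : ∀ n, Module.Finite k (𝒜 n)) (hreg : IsLeftASRegular (k := k) A 𝒜 2)
    (hgk : HasFiniteGKDim k A) (n : ℕ) : Module.finrank k (𝒜 n) = n + 1 := by
  let b := Module.finBasis k (𝒜 1)
  set r := Module.finrank k (𝒜 1) with hr
  let x : Fin r → A := fun i => b i
  have hli : LinearIndependent k x := b.linearIndependent.map' _ (Submodule.ker_subtype _)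
  have hspan : Submodule.span k (Set.range x) = 𝒜 1 := by
    have : Set.range x = (𝒜 1).subtype '' Set.range b := by
      rw [← Set.range_comp]; rfl
    rw [this, Submodule.span_image, b.span_eq, Submodule.map_top, Submodule.range_subtype]
  obtain ⟨hne, w, hp⟩ := exists_isKoszulPair h hreg (fun i => (b i).2) hli hspan
  have hrec := hp.finrank_add h hfin
  rw [Fintype.card_fin] at hrec
  have h0 : Module.finrank k (𝒜 0) = 1 := by
    rw [h.connected, Submodule.one_eq_span]
    exact finrank_span_singleton one_ne_zero
  have hr1 : 1 ≤ r := by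
    obtain ⟨i⟩ := hne
    have := i.2
    omega
  -- With one generator the recursion would give dimensions 1, 1, 0, -1.
  have hr2 : r ≠ 1 := by
    intro h1
    have e0 := hrec 0
    have e1 := hrec 1
    rw [h1] at e0 e1
    simp only [Nat.reduceAdd, one_mul] at e0 e1
    omega
  -- With three or more generators the recursion at least doubles the dimension in each degree,
  -- contradicting finite GK dimension.
  have hr3 : r < 3 := by
    by_contra hr3
    have hgrow : ∀ m, 2 * Module.finrank k (𝒜 m) ≤ Module.finrank k (𝒜 (m + 1)) := by
      intro m
      induction m with
      | zero => rw [h0, zero_add, ← hr]; omega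
      | succ m ih =>
        have := hrec m
        have h3 : 3 * Module.finrank k (𝒜 (m + 1)) ≤ r * Module.finrank k (𝒜 (m + 1)) :=
          Nat.mul_le_mul_right _ (by omega)
        rw [show m + 1 + 1 = m + 2 from rfl]
        omega
    have hpow : ∀ m, 2 ^ m ≤ Module.finrank k (𝒜 m) := by
      intro m
      induction m with
      | zero => rw [h0, pow_zero]
      | succ m ih => rw [pow_succ]; have := hgrow m; omega
    obtain ⟨N, hN⟩ := hgk
    have hFG : (𝒜 1).FG := Module.Finite.iff_fg.1 (hfin 1)
    obtain ⟨C, hC⟩ := hN (𝒜 1) hFG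
    obtain ⟨m, hm⟩ := not_forall_two_pow_le C N
    have hle : 𝒜 m ≤ (1 ⊔ 𝒜 1) ^ m := by
      rw [h.pow_eq m]
      exact pow_le_pow_left' le_sup_right m
    have hfg : ((1 ⊔ 𝒜 1) ^ m).FG := by
      refine Submodule.FG.pow (Submodule.FG.sup ?_ hFG) m
      rw [Submodule.one_eq_span]
      exact Submodule.fg_span_singleton 1
    have : Module.Finite k ↥((1 ⊔ 𝒜 1) ^ m) := Module.Finite.iff_fg.2 hfg
    exact absurd ((hpow m).trans ((Submodule.finrank_mono hle).trans (hC m))) (not_le.2 hm)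
  have hr' : r = 2 := by omega
  rw [hr'] at hrec
  induction n using Nat.strong_induction_on with
  | _ n ih =>
    match n with
    | 0 => rw [h0]
    | 1 => rw [← hr, hr']
    | n + 2 =>
      have e1 := hrec n
      rw [ih n (by omega), ih (n + 1) (by omega)] at e1
      omega

end HilbertFunction

/-! ### Bar cochains of the trivial module in degrees at most two. -/

section BarComplex

open GradedAlgebra

variable {k : Type*} [Field k] {A : Type u} [Ring A] [Algebra k A]

/-- Cochain equations are solved one argument at a time; over a field the solutions can be chosen
linearly in that argument. -/
theorem exists_linear_choice {L M N : Type*} [AddCommGroup L] [Module k L] [AddCommGroup M]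
    [Module k M] [AddCommGroup N] [Module k N] (φ : M →ₗ[k] N) (P : Submodule k M)
    (ψ : L →ₗ[k] N) (h : ∀ l, ∃ m ∈ P, φ m = ψ l) :
    ∃ G : L →ₗ[k] M, ∀ l, G l ∈ P ∧ φ (G l) = ψ l := by
  let φ' : P →ₗ[k] P.map φ := φ.restrict fun m hm => Submodule.mem_map_of_mem hm
  have hφ' : Function.Surjective φ' := by
    rintro ⟨_, m, hm, rfl⟩
    exact ⟨⟨m, hm⟩, rfl⟩
  obtain ⟨G, hG⟩ := Module.projective_lifting_property φ' (ψ.codRestrict (P.map φ) h) hφ'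
  exact ⟨P.subtype ∘ₗ G, fun l => ⟨(G l).2, congrArg Subtype.val (LinearMap.congr_fun hG l)⟩⟩

section IntComponent

variable {𝒜 : ℕ → Submodule k A}

theorem intComponent_of_neg {z : ℤ} (hz : z < 0) : intComponent 𝒜 z = ⊥ :=
  if_neg (not_le.2 hz)

theorem intComponent_natCast (n : ℕ) : intComponent 𝒜 n = 𝒜 n := by
  simp [intComponent]

theorem intComponent_eq {z : ℤ} {n : ℕ} (h : z = n) : intComponent 𝒜 z = 𝒜 n := by
  rw [h, intComponent_natCast]

theorem mul_mem_intComponent [SetLike.GradedMul 𝒜] {p : ℕ} {z : ℤ} {a b : A} (ha : a ∈ 𝒜 p)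
    (hb : b ∈ intComponent 𝒜 z) : a * b ∈ intComponent 𝒜 (p + z) := by
  rcases lt_or_ge z 0 with hz | hz
  · rw [intComponent_of_neg hz, Submodule.mem_bot] at hb
    rw [hb, mul_zero]
    exact zero_mem _
  · lift z to ℕ using hz
    rw [intComponent_natCast] at hb
    rw [← Nat.cast_add, intComponent_natCast]
    exact SetLike.GradedMul.mul_mem ha hb

end IntComponent

/-- The differential from `0`-cochains to `1`-cochains in the bar complex of the trivial module. -/
def barZero (ε : A →ₐ[k] k) : A →ₗ[k] (A →ₗ[k] A) :=
  LinearMap.mk₂ k (fun p b => b * p - ε b • p) (fun p q b => by rw [mul_add, smul_add]; abel)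
    (fun c p b => by rw [mul_smul_comm, smul_sub, smul_comm]) (fun p b c => by
      rw [add_mul, map_add, add_smul]; abel)
    (fun c p b => by rw [smul_mul_assoc, map_smul, smul_eq_mul, mul_smul, smul_sub])

@[simp] theorem barZero_apply (ε : A →ₐ[k] k) (p b : A) : barZero ε p b = b * p - ε b • p := rfl

/-- The differential from `1`-cochains to `2`-cochains in the bar complex of the trivial module. -/
def barOne (ε : A →ₐ[k] k) : (A →ₗ[k] A) →ₗ[k] (A →ₗ[k] A →ₗ[k] A) where
  toFun g := LinearMap.mk₂ k (fun a b => a * g b - g (a * b) + ε b • g a)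
    (fun a a' b => by simp only [add_mul, map_add, smul_add]; abel)
    (fun c a b => by simp only [smul_mul_assoc, map_smul, smul_add, smul_sub, smul_comm c])
    (fun a b b' => by simp only [mul_add, map_add, add_smul]; abel)
    (fun c a b => by
      simp only [mul_smul_comm, map_smul, smul_add, smul_sub, smul_eq_mul, mul_smul])
  map_add' g g' := LinearMap.ext₂ fun a b => by
    simp only [LinearMap.mk₂_apply, LinearMap.add_apply, mul_add, smul_add]; abel
  map_smul' c g := LinearMap.ext₂ fun a b => by
    simp only [LinearMap.mk₂_apply, LinearMap.smul_apply, mul_smul_comm, smul_add, smul_sub,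
      RingHom.id_apply, smul_comm c]

@[simp] theorem barOne_apply (ε : A →ₐ[k] k) (g : A →ₗ[k] A) (a b : A) :
    barOne ε g a b = a * g b - g (a * b) + ε b • g a := rfl

/-- `2`-cocycles in the bar complex of the trivial module. -/
def IsBarCocycle (ε : A →ₐ[k] k) (f : A →ₗ[k] A →ₗ[k] A) : Prop :=
  ∀ a b c, a * f b c - f (a * b) c + f a (b * c) - ε c • f a b = 0

/-- `1`-cochains of degree `t`. -/
def homOne (𝒜 : ℕ → Submodule k A) (t : ℤ) : Submodule k (A →ₗ[k] A) where
  carrier := {g | ∀ p, ∀ a ∈ 𝒜 p, g a ∈ intComponent 𝒜 (p + t)}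
  zero_mem' := fun _ _ _ => zero_mem _
  add_mem' := fun hf hg p a ha => add_mem (hf p a ha) (hg p a ha)
  smul_mem' := fun c _ hf p a ha => Submodule.smul_mem _ c (hf p a ha)

/-- `2`-cochains of degree `t`. -/
def homTwo (𝒜 : ℕ → Submodule k A) (t : ℤ) : Submodule k (A →ₗ[k] A →ₗ[k] A) where
  carrier := {g | ∀ p q, ∀ a ∈ 𝒜 p, ∀ b ∈ 𝒜 q, g a b ∈ intComponent 𝒜 (p + q + t)}
  zero_mem' := fun _ _ _ _ _ _ => zero_mem _
  add_mem' := fun hf hg p q a ha b hb => add_mem (hf p q a ha b hb) (hg p q a ha b hb)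
  smul_mem' := fun c _ hf p q a ha b hb => Submodule.smul_mem _ c (hf p q a ha b hb)

variable {𝒜 : ℕ → Submodule k A} [GradedAlgebra 𝒜]

section

variable [Nontrivial A] {ι : Type} [Fintype ι] {x w : ι → A}

omit [Nontrivial A] [GradedAlgebra 𝒜] in
theorem isBarCocycle_barOne (ε : A →ₐ[k] k) (g : A →ₗ[k] A) : IsBarCocycle ε (barOne ε g) := by
  intro a b c
  simp only [barOne_apply, map_mul, mul_add, mul_sub, smul_add, smul_sub, mul_smul, mul_assoc,
    mul_smul_comm, smul_comm (ε b) (ε c)]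
  abel

namespace IsKoszulPair

/-- Over a Koszul pair, a `2`-cocycle whose evaluation on the relation vanishes in the
complement of the right multiples of the `wᵢ` is a coboundary. -/
theorem exists_barOne_eq (hp : IsKoszulPair 𝒜 x w) (h : IsStandardGraded 𝒜) {t : ℤ}
    {f : A →ₗ[k] A →ₗ[k] A} (hf : IsBarCocycle (aug h.connected) f) (hft : f ∈ homTwo 𝒜 t)
    (hlam : -2 < t ∨ ∑ i, f (w i) (x i) = 0) :
    ∃ g ∈ homOne 𝒜 t, barOne (aug h.connected) g = f := by
  set ε := aug h.connected with hε
  have hεx (i : ι) : ε (x i) = 0 := aug_of_mem_succ h.connected (hp.x_mem i)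
  -- For t > -2 the value on the relation has positive degree 2 + t, so it lies in ∑ wᵢA; otherwise
  -- it is zero by assumption and c = 0 works.
  obtain ⟨c, hc, hcl⟩ : ∃ c : ι → A, (∀ i, c i ∈ intComponent 𝒜 (1 + t)) ∧
      ∑ i, w i * c i = ∑ i, f (w i) (x i) := by
    by_cases hz : ∑ i, f (w i) (x i) = 0
    · exact ⟨0, fun i => zero_mem _, by simp [hz]⟩
    · have ht : -2 < t := hlam.resolve_right hz
      obtain ⟨n, hn⟩ : ∃ n : ℕ, 1 + t = n := ⟨(1 + t).toNat, by omega⟩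
      have hmem : ∑ i, f (w i) (x i) ∈ 𝒜 (1 + n) := by
        refine sum_mem fun i _ => ?_
        have := hft 1 1 _ (hp.w_mem i) _ (hp.x_mem i)
        rwa [intComponent_eq (n := 1 + n) (by push_cast; omega)] at this
      obtain ⟨c, hc⟩ := hp.gen _ (proj_of_mem_ne hmem (by omega))
      refine ⟨fun i => proj 𝒜 n (c i), fun i => ?_, ?_⟩
      · rw [intComponent_eq hn]; exact proj_mem 𝒜 n _
      · rw [← proj_of_mem_same hmem, hc, map_sum]
        exact Finset.sum_congr rfl fun i _ => (proj_mul_of_mem_left (hp.w_mem i) n (c i)).symm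
  -- `Q` presents A as k + ∑ Axᵢ. The equation dg = f forces g(1) = f(1, 1) and g(axᵢ) = a g(xᵢ) -
  -- f(a, xᵢ); `P` is the resulting g pulled back along `Q`, with g(xᵢ) = cᵢ.
  let Q : k × (ι → A) →ₗ[k] A :=
    (Algebra.linearMap k A).coprod (∑ i, (LinearMap.mulRight k (x i)) ∘ₗ LinearMap.proj i)
  let P : k × (ι → A) →ₗ[k] A :=
    (LinearMap.toSpanSingleton k A (f 1 1)).coprod
      (∑ i, (LinearMap.mulRight k (c i) - f.flip (x i)) ∘ₗ LinearMap.proj i)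
  have hQ (y : k × (ι → A)) : Q y = algebraMap k A y.1 + ∑ i, y.2 i * x i := by simp [Q]
  have hP (y : k × (ι → A)) : P y = y.1 • f 1 1 + ∑ i, (y.2 i * c i - f (y.2 i) (x i)) := by
    simp [P]
  have hεQ (y : k × (ι → A)) : ε (Q y) = y.1 := by
    rw [hQ, map_add, map_sum, AlgHom.commutes]
    simp [hεx]
  -- g is well defined: syzygies are multiples bw, and the cocycle condition gives f(bwᵢ, xᵢ) = b
  -- f(wᵢ, xᵢ) + f(b, wᵢxᵢ). The last terms add up to zero by the relation, and the others cancel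
  -- against b ∑ wᵢcᵢ.
  have hker (y : k × (ι → A)) (hy : Q y = 0) : P y = 0 := by
    have h1 : y.1 = 0 := by rw [← hεQ, hy, map_zero]
    rw [hQ, h1, map_zero, zero_add] at hy
    obtain ⟨b, hb⟩ := hp.exact _ hy
    have h2 (i : ι) : f (b * w i) (x i) = b * f (w i) (x i) + f b (w i * x i) := by
      have := hf b (w i) (x i)
      rw [hεx, zero_smul, sub_zero] at this
      rw [← sub_eq_zero, ← neg_eq_zero, ← this]
      abel
    rw [hP, h1, zero_smul, zero_add]
    simp_rw [hb, h2]
    rw [Finset.sum_sub_distrib, Finset.sum_add_distrib, ← map_sum (f b), hp.rel, map_zero, add_zero,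
      ← Finset.mul_sum, ← hcl, Finset.mul_sum]
    simp [mul_assoc]
  have hsurj : Function.Surjective Q := by
    intro a
    obtain ⟨d, hd⟩ := h.exists_eq_sum_mul_of_proj_zero hp.span_x
      (a := a - algebraMap k A (ε a)) (by
        rw [map_sub, hε, algebraMap_aug, proj_of_mem_same (proj_mem 𝒜 0 a), sub_self])
    exact ⟨(ε a, d), by rw [hQ, ← hd]; simp⟩
  obtain ⟨s, hs⟩ := LinearMap.exists_rightInverse_of_surjective Q (LinearMap.range_eq_top.2 hsurj)
  have hg (y : k × (ι → A)) : P (s (Q y)) = P y := by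
    rw [← sub_eq_zero, ← map_sub]
    refine hker _ ?_
    rw [map_sub, ← LinearMap.comp_apply, hs, LinearMap.id_apply, sub_self]
  have hg1 : P (s 1) = f 1 1 := by
    have := hg (1, 0)
    rw [hQ, hP (1, 0)] at this
    simpa using this
  have hgx (a : A) (i : ι) : P (s (a * x i)) = a * c i - f a (x i) := by
    classical
    have := hg (0, Pi.single i a)
    rw [hQ, hP (0, _), Finset.sum_eq_single i (by simp +contextual) (by simp),
      Finset.sum_eq_single i (by simp +contextual) (by simp)] at this
    simpa using this
  refine ⟨P ∘ₗ s, ?_, ?_⟩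
  · intro p a ha
    rw [LinearMap.comp_apply]
    cases p with
    | zero =>
      rw [← algebraMap_aug_of_mem h.connected ha, Algebra.algebraMap_eq_smul_one, map_smul,
        map_smul, hg1]
      refine Submodule.smul_mem _ _ ?_
      have h1 : (1 : A) ∈ 𝒜 0 := SetLike.GradedOne.one_mem
      have := hft 0 0 1 h1 1 h1
      rwa [Nat.cast_zero, zero_add] at this
    | succ p =>
      obtain ⟨d, hd, rfl⟩ := h.exists_eq_sum_mul hp.span_x ha
      rw [map_sum, map_sum]
      refine sum_mem fun i _ => ?_
      rw [hgx]
      refine sub_mem ?_ ?_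
      · have := mul_mem_intComponent (hd i) (hc i)
        rwa [← add_assoc] at this
      · have := hft p 1 _ (hd i) _ (hp.x_mem i)
        exact this
  · refine LinearMap.ext₂ fun a b => ?_
    obtain ⟨⟨r, d⟩, rfl⟩ := hsurj b
    have hlin : barOne ε (P ∘ₗ s) a 1 = f a 1 := by
      have e1 := hf a 1 1
      simp only [map_one, one_smul, mul_one] at e1
      simp only [barOne_apply, LinearMap.comp_apply, hg1, mul_one, map_one, one_smul]
      rw [sub_add_cancel, ← sub_eq_zero, ← e1]
      abel
    have hlin2 (b : A) (i : ι) : barOne ε (P ∘ₗ s) a (b * x i) = f a (b * x i) := by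
      have e1 := hf a b (x i)
      simp only [hεx, zero_smul, sub_zero] at e1
      rw [barOne_apply, map_mul ε, hεx, mul_zero, zero_smul, add_zero, ← mul_assoc,
        LinearMap.comp_apply, LinearMap.comp_apply, hgx, hgx, ← sub_eq_zero, ← neg_eq_zero, ← e1,
        mul_sub, mul_assoc]
      abel
    rw [hQ, map_add, map_add, map_sum, map_sum, Algebra.algebraMap_eq_smul_one, map_smul, map_smul,
      hlin]
    simp_rw [hlin2]

end IsKoszulPair

end

end BarComplex

/-! ### Local cochains: reduction to the trivial module, one degree of the last variable at a time.
-/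

section LocalBarComplex

set_option maxSynthPendingDepth 8

open GradedAlgebra

variable {k : Type*} [Field k] {A : Type u} [Ring A] [Algebra k A]

/-- The differential from local `0`-cochains `p(x)` to local `1`-cochains `g(x, b)`. -/
def localBarZero (p : A →ₗ[k] A) : A →ₗ[k] A →ₗ[k] A :=
  LinearMap.mk₂ k (fun x b => b * p x - p (b * x))
    (fun x y b => by simp only [map_add, mul_add]; abel)
    (fun c x b => by simp only [map_smul, mul_smul_comm, smul_sub])
    (fun x b c => by simp only [map_add, add_mul]; abel)
    (fun c x b => by simp only [map_smul, smul_mul_assoc, smul_sub])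

@[simp] theorem localBarZero_apply (p : A →ₗ[k] A) (x b : A) :
    localBarZero p x b = b * p x - p (b * x) := rfl

/-- The differential from local `1`-cochains `g(x, b)` to local `2`-cochains `f(x, a, b)`. -/
def localBarOne (g : A →ₗ[k] A →ₗ[k] A) : A →ₗ[k] A →ₗ[k] A →ₗ[k] A where
  toFun x := LinearMap.mk₂ k (fun a b => a * g x b - g x (a * b) + g (b * x) a)
    (fun a a' b => by simp only [add_mul, map_add]; abel)
    (fun c a b => by simp only [smul_mul_assoc, map_smul, smul_add, smul_sub])
    (fun a b b' => by simp only [mul_add, map_add, add_mul, LinearMap.add_apply]; abel)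
    (fun c a b => by
      simp only [mul_smul_comm, map_smul, smul_add, smul_sub, smul_mul_assoc,
        LinearMap.smul_apply])
  map_add' x y := LinearMap.ext₂ fun a b => by
    simp only [LinearMap.mk₂_apply, LinearMap.add_apply, mul_add, map_add]; abel
  map_smul' c x := LinearMap.ext₂ fun a b => by
    simp only [LinearMap.mk₂_apply, LinearMap.smul_apply, mul_smul_comm, map_smul, smul_add,
      smul_sub, RingHom.id_apply]

@[simp] theorem localBarOne_apply (g : A →ₗ[k] A →ₗ[k] A) (x a b : A) :
    localBarOne g x a b = a * g x b - g x (a * b) + g (b * x) a := rfl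

theorem localBarOne_add (g g' : A →ₗ[k] A →ₗ[k] A) :
    localBarOne (g + g') = localBarOne g + localBarOne g' := by
  ext x a b
  simp only [localBarOne_apply, LinearMap.add_apply, mul_add]
  abel

theorem localBarOne_sub (g g' : A →ₗ[k] A →ₗ[k] A) :
    localBarOne (g - g') = localBarOne g - localBarOne g' := by
  ext x a b
  simp only [localBarOne_apply, LinearMap.sub_apply, mul_sub]
  abel

theorem localBarOne_localBarZero (p : A →ₗ[k] A) : localBarOne (localBarZero p) = 0 := by
  ext x a b
  simp only [localBarOne_apply, localBarZero_apply, mul_sub, mul_assoc, LinearMap.zero_apply]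
  abel

/-- Local `2`-cocycles. -/
def IsLocalBarCocycle (f : A →ₗ[k] A →ₗ[k] A →ₗ[k] A) : Prop :=
  ∀ x a b c, a * f x b c - f x (a * b) c + f x a (b * c) - f (c * x) a b = 0

theorem isLocalBarCocycle_localBarOne (g : A →ₗ[k] A →ₗ[k] A) :
    IsLocalBarCocycle (localBarOne g) := by
  intro x a b c
  simp only [localBarOne_apply, mul_sub, mul_add, mul_assoc]
  abel

theorem IsLocalBarCocycle.sub {f g : A →ₗ[k] A →ₗ[k] A →ₗ[k] A} (hf : IsLocalBarCocycle f)
    (hg : IsLocalBarCocycle g) : IsLocalBarCocycle (f - g) := by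
  intro x a b c
  have h1 := hf x a b c
  have h2 := hg x a b c
  simp only [LinearMap.sub_apply, mul_sub]
  rw [← sub_eq_zero.2 (h1.trans h2.symm)]
  abel

/-- `f` vanishes in degrees at least `N`. -/
def VanishesFrom (𝒜 : ℕ → Submodule k A) {V : Type*} [AddCommGroup V] [Module k V] (N : ℕ)
    (f : A →ₗ[k] V) : Prop :=
  ∀ s, N ≤ s → ∀ x ∈ 𝒜 s, f x = 0

/-- Local `1`-cochains of degree `j`. -/
def IsLocalHomOne (𝒜 : ℕ → Submodule k A) (j : ℤ) (g : A →ₗ[k] A →ₗ[k] A) : Prop :=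
  ∀ e : ℕ, ∀ x ∈ 𝒜 e, g x ∈ homOne 𝒜 (e + j)

/-- Local `2`-cochains of degree `j`. -/
def IsLocalHomTwo (𝒜 : ℕ → Submodule k A) (j : ℤ) (f : A →ₗ[k] A →ₗ[k] A →ₗ[k] A) : Prop :=
  ∀ e : ℕ, ∀ x ∈ 𝒜 e, f x ∈ homTwo 𝒜 (e + j)

variable {𝒜 : ℕ → Submodule k A}

section

variable {V : Type*} [AddCommGroup V] [Module k V]

theorem VanishesFrom.mono {N M : ℕ} {f : A →ₗ[k] V} (hf : VanishesFrom 𝒜 N f) (h : N ≤ M) :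
    VanishesFrom 𝒜 M f := fun s hs => hf s (h.trans hs)

theorem VanishesFrom.add {N : ℕ} {f g : A →ₗ[k] V} (hf : VanishesFrom 𝒜 N f)
    (hg : VanishesFrom 𝒜 N g) : VanishesFrom 𝒜 N (f + g) := fun s hs x hx => by
  rw [LinearMap.add_apply, hf s hs x hx, hg s hs x hx, add_zero]

theorem VanishesFrom.sub {N : ℕ} {f g : A →ₗ[k] V} (hf : VanishesFrom 𝒜 N f)
    (hg : VanishesFrom 𝒜 N g) : VanishesFrom 𝒜 N (f - g) := fun s hs x hx => by
  rw [LinearMap.sub_apply, hf s hs x hx, hg s hs x hx, sub_zero]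

end

theorem IsLocalHomOne.add {j : ℤ} {f g : A →ₗ[k] A →ₗ[k] A} (hf : IsLocalHomOne 𝒜 j f)
    (hg : IsLocalHomOne 𝒜 j g) : IsLocalHomOne 𝒜 j (f + g) :=
  fun e x hx => add_mem (hf e x hx) (hg e x hx)

theorem IsLocalHomTwo.sub {j : ℤ} {f g : A →ₗ[k] A →ₗ[k] A →ₗ[k] A} (hf : IsLocalHomTwo 𝒜 j f)
    (hg : IsLocalHomTwo 𝒜 j g) : IsLocalHomTwo 𝒜 j (f - g) :=
  fun e x hx => sub_mem (hf e x hx) (hg e x hx)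

variable [GradedAlgebra 𝒜]

theorem VanishesFrom.map_mul_eq_zero {V : Type*} [AddCommGroup V] [Module k V] {N : ℕ}
    {f : A →ₗ[k] V} (hf : VanishesFrom 𝒜 N f) {s : ℕ} (hs : N ≤ s) {x : A} (hx : x ∈ 𝒜 s) (b : A) :
    f (b * x) = 0 := by
  have : f ∘ₗ LinearMap.mulRight k x = 0 := linearMap_ext_of_mem (𝒜 := 𝒜) fun n b hb =>
    hf (n + s) (by omega) _ (SetLike.GradedMul.mul_mem hb hx)
  exact LinearMap.congr_fun this b

theorem VanishesFrom.localBarOne {N : ℕ} {g : A →ₗ[k] A →ₗ[k] A} (hg : VanishesFrom 𝒜 N g) :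
    VanishesFrom 𝒜 N (localBarOne g) := by
  intro s hs x hx
  ext a b
  rw [localBarOne_apply, hg s hs x hx, hg.map_mul_eq_zero hs hx]
  simp

/-- The projection to the component of degree `n`. -/
def componentProj (𝒜 : ℕ → Submodule k A) [GradedAlgebra 𝒜] (n : ℕ) : A →ₗ[k] 𝒜 n :=
  (proj 𝒜 n).codRestrict (𝒜 n) (proj_mem 𝒜 n)

theorem componentProj_of_mem {n : ℕ} {x : A} (hx : x ∈ 𝒜 n) : componentProj 𝒜 n x = ⟨x, hx⟩ :=
  Subtype.ext (proj_of_mem_same hx)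

theorem componentProj_of_mem_ne {n m : ℕ} {x : A} (hx : x ∈ 𝒜 n) (h : n ≠ m) :
    componentProj 𝒜 m x = 0 :=
  Subtype.ext (proj_of_mem_ne hx h)

theorem vanishesFrom_comp_componentProj {V : Type*} [AddCommGroup V] [Module k V] {s : ℕ}
    (G : 𝒜 s →ₗ[k] V) : VanishesFrom 𝒜 (s + 1) (G ∘ₗ componentProj 𝒜 s) := fun t ht x hx => by
  rw [LinearMap.comp_apply, componentProj_of_mem_ne hx (by omega), map_zero]

theorem IsLocalHomOne.localBarOne {j : ℤ} {g : A →ₗ[k] A →ₗ[k] A} (hg : IsLocalHomOne 𝒜 j g) :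
    IsLocalHomTwo 𝒜 j (localBarOne g) := by
  intro e x hx p q a ha b hb
  refine add_mem (sub_mem ?_ ?_) ?_
  · have := mul_mem_intComponent ha (hg e x hx q b hb)
    rwa [← add_assoc] at this
  · have := hg e x hx (p + q) (a * b) (SetLike.GradedMul.mul_mem ha hb)
    rwa [Nat.cast_add] at this
  · have := hg (q + e) (b * x) (SetLike.GradedMul.mul_mem hb hx) p a ha
    rwa [show (p : ℤ) + (((q + e : ℕ) : ℤ) + j) = p + q + (e + j) by push_cast; ring] at this

section

variable [Nontrivial A]

/-- In the highest degree s where f may be nonzero, multiplication by A₊ leads to zero. So there the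
local differential is the bar differential of the trivial module. -/
theorem VanishesFrom.map_mul_of_mem (h0 : 𝒜 0 = 1) {V : Type*} [AddCommGroup V] [Module k V]
    {s : ℕ} {f : A →ₗ[k] V} (hf : VanishesFrom 𝒜 (s + 1) f) {x : A} (hx : x ∈ 𝒜 s) (c : A) :
    f (c * x) = aug h0 c • f x := by
  have : f ∘ₗ LinearMap.mulRight k x =
      (LinearMap.toSpanSingleton k V (f x)) ∘ₗ (aug h0).toLinearMap := by
    refine linearMap_ext_of_mem (𝒜 := 𝒜) fun n c hc => ?_
    rw [LinearMap.comp_apply, LinearMap.comp_apply, LinearMap.mulRight_apply,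
      AlgHom.toLinearMap_apply, LinearMap.toSpanSingleton_apply]
    cases n with
    | zero =>
      conv_lhs => rw [← algebraMap_aug_of_mem h0 hc]
      rw [← Algebra.smul_def, map_smul]
    | succ n =>
      rw [aug_of_mem_succ h0 hc, zero_smul]
      exact hf (n + 1 + s) (by omega) _ (SetLike.GradedMul.mul_mem hc hx)
  exact LinearMap.congr_fun this c

theorem localBarOne_apply_of_mem (h0 : 𝒜 0 = 1) {s : ℕ} {g : A →ₗ[k] A →ₗ[k] A}
    (hg : VanishesFrom 𝒜 (s + 1) g) {x : A} (hx : x ∈ 𝒜 s) :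
    localBarOne g x = barOne (aug h0) (g x) := by
  ext a b
  rw [localBarOne_apply, barOne_apply, hg.map_mul_of_mem h0 hx, LinearMap.smul_apply]

theorem IsLocalBarCocycle.isBarCocycle (h0 : 𝒜 0 = 1) {s : ℕ} {f : A →ₗ[k] A →ₗ[k] A →ₗ[k] A}
    (hf : IsLocalBarCocycle f) (hs : VanishesFrom 𝒜 (s + 1) f) {x : A} (hx : x ∈ 𝒜 s) :
    IsBarCocycle (aug h0) (f x) := by
  intro a b c
  rw [← hf x a b c, hs.map_mul_of_mem h0 hx]
  rfl

namespace IsKoszulPair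

variable {ι : Type} [Fintype ι] {x w : ι → A}

/-- For x in the top degree s, f(x, ·, ·) is a cocycle of the trivial module of degree s + j. Above
degree -2 such cocycles are coboundaries, so the top degree can be removed. -/
theorem exists_localBarOne_sub (hp : IsKoszulPair 𝒜 x w) (h : IsStandardGraded 𝒜) {j : ℤ} {s : ℕ}
    (hj : -2 < s + j) {f : A →ₗ[k] A →ₗ[k] A →ₗ[k] A} (hf : IsLocalBarCocycle f)
    (hfj : IsLocalHomTwo 𝒜 j f) (hs : VanishesFrom 𝒜 (s + 1) f) :
    ∃ g, IsLocalHomOne 𝒜 j g ∧ VanishesFrom 𝒜 (s + 1) g ∧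
      VanishesFrom 𝒜 s (f - localBarOne g) := by
  obtain ⟨G, hG⟩ := exists_linear_choice (barOne (aug h.connected)) (homOne 𝒜 (s + j))
    (f ∘ₗ (𝒜 s).subtype) fun y => hp.exists_barOne_eq h
      (hf.isBarCocycle h.connected hs y.2) (hfj s y y.2) (Or.inl hj)
  have hv := vanishesFrom_comp_componentProj G
  refine ⟨G ∘ₗ componentProj 𝒜 s, fun e y hy => ?_, hv, fun t ht y hy => ?_⟩
  · rw [LinearMap.comp_apply]
    rcases eq_or_ne e s with rfl | hne
    · exact (hG _).1
    · rw [componentProj_of_mem_ne hy hne, map_zero]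
      exact zero_mem _
  · rcases ht.eq_or_lt with rfl | ht
    · rw [LinearMap.sub_apply, localBarOne_apply_of_mem h.connected hv hy, LinearMap.comp_apply,
        (hG _).2, componentProj_of_mem hy]
      exact sub_self _
    · exact hs.sub hv.localBarOne t ht y hy

/-- Top degrees are removed as long as s + j > -2. For j > -2 this reaches s = 0 and kills the
class; for j = -2 it stops with a cocycle supported on x of degree zero. -/
theorem exists_localBarOne_sub_vanishesFrom (hp : IsKoszulPair 𝒜 x w) (h : IsStandardGraded 𝒜)
    {j : ℤ} {m : ℕ} (hj : -2 < m + j) {f : A →ₗ[k] A →ₗ[k] A →ₗ[k] A} (hf : IsLocalBarCocycle f)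
    (hfj : IsLocalHomTwo 𝒜 j f) {n : ℕ} (hs : VanishesFrom 𝒜 (m + n) f) :
    ∃ g, IsLocalHomOne 𝒜 j g ∧ VanishesFrom 𝒜 (m + n) g ∧
      VanishesFrom 𝒜 m (f - localBarOne g) := by
  induction n generalizing f with
  | zero =>
    refine ⟨0, fun _ _ _ => zero_mem _, fun _ _ _ _ => rfl, ?_⟩
    intro t ht y hy
    have : localBarOne (0 : A →ₗ[k] A →ₗ[k] A) = 0 := by ext; simp
    rw [this, sub_zero]
    exact hs t ht y hy
  | succ n ih =>
    obtain ⟨g, hgj, hgv, hfg⟩ := hp.exists_localBarOne_sub h (s := m + n) (j := j)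
      (by push_cast; omega) hf hfj hs
    obtain ⟨g', hgj', hgv', hfg'⟩ := ih (hf.sub (isLocalBarCocycle_localBarOne g))
      (hfj.sub hgj.localBarOne) hfg
    refine ⟨g + g', hgj.add hgj', hgv.add (hgv'.mono (by omega)), ?_⟩
    rwa [localBarOne_add, ← sub_sub]

theorem exists_eq_localBarOne (hp : IsKoszulPair 𝒜 x w) (h : IsStandardGraded 𝒜)
    {j : ℤ} (hj : -2 < j) {f : A →ₗ[k] A →ₗ[k] A →ₗ[k] A} (hf : IsLocalBarCocycle f)
    (hfj : IsLocalHomTwo 𝒜 j f) {n : ℕ} (hs : VanishesFrom 𝒜 n f) :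
    ∃ g, IsLocalHomOne 𝒜 j g ∧ VanishesFrom 𝒜 n g ∧ f = localBarOne g := by
  obtain ⟨g, hgj, hgv, hfg⟩ := hp.exists_localBarOne_sub_vanishesFrom h (m := 0) (j := j)
    (by simpa using hj) hf hfj (n := n) (by simpa using hs)
  refine ⟨g, hgj, by simpa using hgv, sub_eq_zero.1 ?_⟩
  exact linearMap_ext_of_mem (𝒜 := 𝒜) fun n y hy => hfg n (Nat.zero_le n) y hy

/-- A local `2`-cocycle of degree `-2` on the trivial module whose evaluation on the relation
vanishes is a coboundary. -/
theorem exists_eq_localBarOne_of_sum_eq_zero (hp : IsKoszulPair 𝒜 x w) (h : IsStandardGraded 𝒜)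
    {j : ℤ} {f : A →ₗ[k] A →ₗ[k] A →ₗ[k] A} (hf : IsLocalBarCocycle f)
    (hfj : IsLocalHomTwo 𝒜 j f) (hs : VanishesFrom 𝒜 1 f) (hlam : ∑ i, f 1 (w i) (x i) = 0) :
    ∃ g, IsLocalHomOne 𝒜 j g ∧ VanishesFrom 𝒜 1 g ∧ f = localBarOne g := by
  have h1 : (1 : A) ∈ 𝒜 0 := SetLike.GradedOne.one_mem
  obtain ⟨g, hg, hgf⟩ := hp.exists_barOne_eq h (hf.isBarCocycle h.connected hs h1)
    (hfj 0 1 h1) (Or.inr hlam)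
  have hv : VanishesFrom 𝒜 1 ((LinearMap.toSpanSingleton k _ g) ∘ₗ (aug h.connected).toLinearMap) :=
    fun s hs y hy => by
      rw [LinearMap.comp_apply, AlgHom.toLinearMap_apply, aug_of_mem_pos h.connected (by omega) hy,
        map_zero]
  refine ⟨_, fun e y hy => ?_, hv, ?_⟩
  · rw [LinearMap.comp_apply, AlgHom.toLinearMap_apply, LinearMap.toSpanSingleton_apply]
    rcases eq_or_ne e 0 with rfl | he
    · exact Submodule.smul_mem _ _ hg
    · rw [aug_of_mem_pos h.connected he hy, zero_smul]
      exact zero_mem _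
  · refine linearMap_ext_of_mem (𝒜 := 𝒜) fun n y hy => ?_
    rcases eq_or_ne n 0 with rfl | hn
    · rw [localBarOne_apply_of_mem h.connected hv hy, LinearMap.comp_apply,
        AlgHom.toLinearMap_apply, LinearMap.toSpanSingleton_apply, map_smul, hgf,
        ← hs.map_mul_of_mem h.connected h1, mul_one]
    · rw [hs n (by omega) y hy, hv.localBarOne n (by omega) y hy]

end IsKoszulPair

end

end LocalBarComplex

/-! ### A nonzero local cohomology class of degree -2. -/

section Nonvanishing

set_option maxSynthPendingDepth 8

open GradedAlgebra

variable {k : Type*} [Field k] {A : Type u} [Ring A] [Algebra k A] {𝒜 : ℕ → Submodule k A}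
  [GradedAlgebra 𝒜] [Nontrivial A] {ι : Type} [Fintype ι] {x w : ι → A}

namespace IsKoszulPair

/-- A homogeneous `k`-linear section of the presentation of the augmentation ideal. -/
theorem exists_section (hp : IsKoszulPair 𝒜 x w) (h : IsStandardGraded 𝒜) :
    ∃ σ : ι → A →ₗ[k] A, (∀ i, σ i 1 = 0) ∧ (∀ i n, ∀ a ∈ 𝒜 (n + 1), σ i a ∈ 𝒜 n) ∧
      ∀ a, ∑ i, σ i a * x i = a - algebraMap k A (aug h.connected a) := by
  have hex (n : ℕ) : ∃ G : 𝒜 (n + 1) →ₗ[k] (ι → A), ∀ a : 𝒜 (n + 1),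
      G a ∈ Submodule.pi Set.univ (fun _ => 𝒜 n) ∧
        (∑ i, (LinearMap.mulRight k (x i)) ∘ₗ LinearMap.proj i : (ι → A) →ₗ[k] A) (G a) = a := by
    refine exists_linear_choice _ _ (𝒜 (n + 1)).subtype fun a => ?_
    obtain ⟨c, hc, hac⟩ := h.exists_eq_sum_mul hp.span_x a.2
    refine ⟨c, fun i _ => hc i, ?_⟩
    rw [Submodule.subtype_apply, hac]
    simp
  choose G hG using hex
  let τ : ∀ n, 𝒜 n →ₗ[k] (ι → A) := fun n => match n with
    | 0 => 0
    | n + 1 => G n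
  let T : A →ₗ[k] (ι → A) := DirectSum.toModule k ℕ (ι → A) τ ∘ₗ
    (DirectSum.decomposeLinearEquiv 𝒜).toLinearMap
  have hT (n : ℕ) (a : A) (ha : a ∈ 𝒜 n) : T a = τ n ⟨a, ha⟩ := by
    simp only [T, LinearMap.comp_apply, LinearEquiv.coe_coe, DirectSum.decomposeLinearEquiv_apply]
    rw [DirectSum.decompose_of_mem 𝒜 ha]
    exact DirectSum.toModule_lof k n _
  refine ⟨fun i => LinearMap.proj i ∘ₗ T, fun i => ?_, fun i n a ha => ?_, fun a => ?_⟩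
  · rw [LinearMap.comp_apply, hT 0 1 SetLike.GradedOne.one_mem]
    rfl
  · rw [LinearMap.comp_apply, hT (n + 1) a ha]
    exact (hG n _).1 i trivial
  · have : (∑ i, (LinearMap.mulRight k (x i)) ∘ₗ LinearMap.proj i : (ι → A) →ₗ[k] A) ∘ₗ T =
        LinearMap.id - Algebra.linearMap k A ∘ₗ (aug h.connected).toLinearMap := by
      refine linearMap_ext_of_mem (𝒜 := 𝒜) fun n a ha => ?_
      cases n with
      | zero =>
        rw [LinearMap.comp_apply, hT 0 a ha]
        simp only [τ, LinearMap.zero_apply, map_zero, LinearMap.sub_apply, LinearMap.id_apply,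
          LinearMap.comp_apply, AlgHom.toLinearMap_apply, Algebra.linearMap_apply,
          algebraMap_aug_of_mem h.connected ha, sub_self]
      | succ n =>
        rw [LinearMap.comp_apply, hT (n + 1) a ha]
        refine (hG n ⟨a, ha⟩).2.trans ?_
        simp [aug_of_mem_succ h.connected ha]
    have := LinearMap.congr_fun this a
    simpa using this

/-- There is a `2`-cocycle of degree `-2` with value `1` on the relation. -/
theorem exists_isBarCocycle (hp : IsKoszulPair 𝒜 x w) (h : IsStandardGraded 𝒜) :
    ∃ f : A →ₗ[k] A →ₗ[k] A, IsBarCocycle (aug h.connected) f ∧ f ∈ homTwo 𝒜 (-2) ∧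
      ∑ i, f (w i) (x i) = 1 := by
  set ε := aug h.connected with hε
  obtain ⟨σ, hσ1, hσd, hσ⟩ := hp.exists_section h
  rw [← hε] at hσ
  let W : A →ₗ[k] (ι → A) := LinearMap.pi fun i => LinearMap.mulRight k (w i)
  -- The cocycle is obtained by shifting dimension twice. The differentials of the section
  -- components σᵢ form a syzygy, hence equal f(a, b) wᵢ for a unique f(a, b); the linear left
  -- inverse `L` of b ↦ bw extracts f linearly.
  obtain ⟨L, hL⟩ := LinearMap.exists_leftInverse_of_injective W (by
    rw [LinearMap.ker_eq_bot, injective_iff_map_eq_zero]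
    exact fun b hb => hp.inj b fun i => congrFun hb i)
  have hεx (i : ι) : ε (x i) = 0 := aug_of_mem_succ h.connected (hp.x_mem i)
  let D : A →ₗ[k] A →ₗ[k] (ι → A) := LinearMap.mk₂ k (fun a b i => barOne ε (σ i) a b)
    (fun a a' b => by ext i; simp only [map_add, LinearMap.add_apply, Pi.add_apply])
    (fun c a b => by ext i; simp only [map_smul, LinearMap.smul_apply, Pi.smul_apply])
    (fun a b b' => by ext i; simp only [map_add, Pi.add_apply])
    (fun c a b => by ext i; simp only [map_smul, Pi.smul_apply])
  have hDW (a b : A) : ∃ d, ∀ i, barOne ε (σ i) a b = d * w i := by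
    refine hp.exact _ ?_
    simp only [barOne_apply, add_mul, sub_mul, Finset.sum_add_distrib, Finset.sum_sub_distrib,
      mul_assoc, smul_mul_assoc, ← Finset.mul_sum, ← Finset.smul_sum, hσ]
    rw [map_mul ε, map_mul, Algebra.smul_def]
    simp only [mul_sub, ← Algebra.commutes (ε b)]
    abel
  let f : A →ₗ[k] A →ₗ[k] A := D.compr₂ L
  have hf (a b : A) (i : ι) : barOne ε (σ i) a b = f a b * w i := by
    obtain ⟨d, hd⟩ := hDW a b
    have h1 : D a b = W d := funext hd
    have h2 : f a b = d := by
      change L (D a b) = d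
      rw [h1, ← LinearMap.comp_apply, hL, LinearMap.id_apply]
    rw [hd, h2]
  have hσx (i j : ι) : σ j (x i) = algebraMap k A (ε (σ j (x i))) :=
    (algebraMap_aug_of_mem h.connected (hσd j 0 _ (hp.x_mem i))).symm
  refine ⟨f, fun a b c => hp.inj _ fun i => ?_, fun p q a ha b hb => ?_, ?_⟩
  · rw [← isBarCocycle_barOne ε (σ i) a b c]
    simp only [sub_mul, add_mul, smul_mul_assoc, mul_assoc, hf]
  · have key (n : ℕ) (hn : n + 2 ≠ p + q) : proj 𝒜 n (f a b) = 0 := by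
      refine hp.inj _ fun i => ?_
      rw [← proj_mul_of_mem_right (hp.w_mem i), ← hf, barOne_apply, map_add, map_sub]
      have e1 : proj 𝒜 (n + 1) (a * σ i b) = 0 := by
        cases q with
        | zero =>
          rw [← algebraMap_aug_of_mem h.connected hb, Algebra.algebraMap_eq_smul_one, map_smul,
            hσ1, smul_zero, mul_zero, map_zero]
        | succ q =>
          exact proj_of_mem_ne (SetLike.GradedMul.mul_mem ha (hσd i q b hb)) (by omega)
      have e2 : proj 𝒜 (n + 1) (σ i (a * b)) = 0 := by
        obtain ⟨r, hr⟩ | hpq : (∃ r, p + q = r + 1) ∨ p + q = 0 := by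
          cases hpq : p + q with
          | zero => exact Or.inr rfl
          | succ r => exact Or.inl ⟨r, rfl⟩
        · have hab : a * b ∈ 𝒜 (p + q) := SetLike.GradedMul.mul_mem ha hb
          rw [hr] at hab
          exact proj_of_mem_ne (hσd i r _ hab) (by omega)
        · have hab : a * b ∈ 𝒜 (p + q) := SetLike.GradedMul.mul_mem ha hb
          rw [hpq] at hab
          rw [← algebraMap_aug_of_mem h.connected hab, Algebra.algebraMap_eq_smul_one, map_smul,
            hσ1, smul_zero, map_zero]
      have e3 : proj 𝒜 (n + 1) (ε b • σ i a) = 0 := by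
        rcases eq_or_ne q 0 with rfl | hq
        · rw [map_smul]
          cases p with
          | zero =>
            rw [← algebraMap_aug_of_mem h.connected ha, Algebra.algebraMap_eq_smul_one, map_smul,
              hσ1, smul_zero, map_zero, smul_zero]
          | succ p => rw [proj_of_mem_ne (hσd i p a ha) (by omega), smul_zero]
        · rw [hε, aug_of_mem_pos h.connected hq hb, zero_smul, map_zero]
      rw [e1, e2, e3, sub_zero, add_zero]
    rcases lt_or_ge (p + q) 2 with hlt | hge
    · have : f a b = 0 := eq_of_forall_proj_eq (𝒜 := 𝒜) fun n => by
        rw [key n (by omega), map_zero]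
      rw [this]
      exact zero_mem _
    · rw [intComponent_eq (n := p + q - 2) (by omega)]
      have : f a b = proj 𝒜 (p + q - 2) (f a b) := eq_of_forall_proj_eq (𝒜 := 𝒜) fun n => by
        rcases eq_or_ne (p + q - 2) n with rfl | hn
        · rw [proj_of_mem_same (proj_mem 𝒜 _ _)]
        · rw [key n (by omega), proj_of_mem_ne (proj_mem 𝒜 _ _) hn]
      rw [this]
      exact proj_mem 𝒜 _ _
  · rw [← sub_eq_zero]
    refine hp.inj _ fun j => ?_
    -- σⱼ(xᵢ) is the Kronecker delta by linear independence, and σⱼ is applied to ∑ wᵢxᵢ = 0; so f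
    -- takes the value 1 on the relation.
    have hsum : ∑ i, barOne ε (σ j) (w i) (x i) = w j := by
      simp only [barOne_apply, hεx, zero_smul, add_zero, Finset.sum_sub_distrib]
      rw [← map_sum, hp.rel, map_zero, sub_zero]
      classical
      have hlin (i : ι) : ε (σ j (x i)) = if i = j then 1 else 0 := by
        have e := hσ (x i)
        rw [hεx, map_zero, sub_zero] at e
        have e' : ∑ j, (ε (σ j (x i)) - if i = j then 1 else 0) • x j = 0 := by
          simp only [sub_smul, Finset.sum_sub_distrib, ite_smul, one_smul, zero_smul,
            Finset.sum_ite_eq, Finset.mem_univ, if_true]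
          rw [sub_eq_zero]
          conv_rhs => rw [← e]
          exact Finset.sum_congr rfl fun l _ => by rw [Algebra.smul_def, ← hσx]
        have := Fintype.linearIndependent_iff.1 hp.linearIndependent _ e' j
        exact sub_eq_zero.1 this
      rw [Finset.sum_eq_single j]
      · rw [hσx, hlin, if_pos rfl, map_one, mul_one]
      · intro i _ hij
        rw [hσx, hlin, if_neg hij, map_zero, mul_zero]
      · simp
    rw [sub_mul, Finset.sum_mul, one_mul, sub_eq_zero]
    exact (Finset.sum_congr rfl fun i _ => (hf _ _ j).symm).trans hsum

end IsKoszulPair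

/-- In its top degree, g(y, ·) restricts to a left linear map on A₊. By Ext¹(k, A) = 0 this is right
multiplication by some c, which is a differential of a 0-cochain; Ext⁰(k, A) = 0 makes c homogeneous
of the right degree. -/
theorem exists_localBarZero_sub (h : IsStandardGraded 𝒜)
    (hreg : IsLeftASRegular (k := k) A 𝒜 2) {s : ℕ} {g : A →ₗ[k] A →ₗ[k] A}
    (hg : IsLocalHomOne 𝒜 (-2) g) (hs : VanishesFrom 𝒜 (s + 1) g)
    (hd : VanishesFrom 𝒜 s (localBarOne g)) :
    ∃ p : A →ₗ[k] A, IsLocalHomOne 𝒜 (-2) (localBarZero p) ∧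
      VanishesFrom 𝒜 s (g - localBarZero p) := by
  have h0 := h.connected
  have hex (y : 𝒜 s) : ∃ p ∈ intComponent 𝒜 (s - 2), barZero (aug h0) p = g y := by
    have hgy : barOne (aug h0) (g y) = 0 := by
      rw [← localBarOne_apply_of_mem h0 hs y.2, hd s le_rfl y y.2]
    have hg1 : g y 1 = 0 := by
      have := LinearMap.congr_fun₂ hgy 1 1
      simpa using this
    have hmul (a b : A) (hb : aug h0 b = 0) : g y (a * b) = a * g y b := by
      have := LinearMap.congr_fun₂ hgy a b
      rw [barOne_apply, hb, zero_smul, add_zero] at this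
      exact (sub_eq_zero.1 this).symm
    let G : augmentationIdeal 𝒜 →ₗ[A] A :=
      { toFun := fun b => g y b
        map_add' := fun b b' => by simp
        map_smul' := fun a b => hmul a b ((mem_augmentationIdeal h0 _).1 b.2) }
    obtain ⟨c, hc⟩ := exists_eq_mul_of_subsingleton_ext_one _ (hreg.ext_eq_zero 1 (by norm_num)) G
    have hc' (b : A) (hb : aug h0 b = 0) : g y b = b * c :=
      hc ⟨b, (mem_augmentationIdeal h0 b).2 hb⟩
    have key (n : ℕ) (hn : n + 2 ≠ s) : proj 𝒜 n c = 0 := by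
      refine eq_zero_of_subsingleton_ext_zero _ (hreg.ext_eq_zero 0 (by norm_num)) _ fun b hb => ?_
      induction hb using Submodule.span_induction with
      | mem b hb =>
        obtain ⟨q, hq⟩ := Set.mem_iUnion.1 hb
        rw [← proj_mul_of_mem_left hq, ← hc' b (aug_of_mem_succ h0 hq)]
        have := hg s y y.2 (q + 1) b hq
        rcases lt_or_ge (((q + 1 : ℕ) : ℤ) + (s + -2)) 0 with hlt | hge
        · rw [intComponent_of_neg hlt, Submodule.mem_bot] at this
          rw [this, map_zero]
        · lift ((q + 1 : ℕ) : ℤ) + (s + -2) to ℕ using hge with m hm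
          rw [intComponent_natCast] at this
          exact proj_of_mem_ne this (by omega)
      | zero => rw [zero_mul]
      | add b b' _ _ hb hb' => rw [add_mul, hb, hb', add_zero]
      | smul a b _ hb => rw [smul_eq_mul, mul_assoc, hb, mul_zero]
    refine ⟨c, ?_, ?_⟩
    · rcases lt_or_ge s 2 with hlt | hge
      · have : c = 0 := eq_of_forall_proj_eq (𝒜 := 𝒜) fun n => by
          rw [key n (by omega), map_zero]
        rw [this]
        exact zero_mem _
      · rw [intComponent_eq (n := s - 2) (by omega)]
        have : c = proj 𝒜 (s - 2) c := eq_of_forall_proj_eq (𝒜 := 𝒜) fun n => by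
          rcases eq_or_ne (s - 2) n with rfl | hn
          · rw [proj_of_mem_same (proj_mem 𝒜 _ _)]
          · rw [key n (by omega), proj_of_mem_ne (proj_mem 𝒜 _ _) hn]
        rw [this]
        exact proj_mem 𝒜 _ _
    · ext b
      have hb := hc' (b - algebraMap k A (aug h0 b)) (by simp)
      rw [map_sub, Algebra.algebraMap_eq_smul_one, map_smul, hg1, smul_zero, sub_zero] at hb
      rw [hb, barZero_apply, sub_mul, smul_one_mul]
  obtain ⟨P, hP⟩ := exists_linear_choice (barZero (aug h0)) (intComponent 𝒜 (s - 2))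
    (g ∘ₗ (𝒜 s).subtype) hex
  have hv := vanishesFrom_comp_componentProj P
  have hmem (e : ℕ) (y : A) (hy : y ∈ 𝒜 e) :
      (P ∘ₗ componentProj 𝒜 s) y ∈ intComponent 𝒜 (e - 2) := by
    rw [LinearMap.comp_apply]
    rcases eq_or_ne e s with rfl | hne
    · exact (hP _).1
    · rw [componentProj_of_mem_ne hy hne, map_zero]
      exact zero_mem _
  refine ⟨P ∘ₗ componentProj 𝒜 s, fun e y hy q b hb => ?_, fun t ht y hy => ?_⟩
  · rw [localBarZero_apply]
    refine sub_mem ?_ ?_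
    · exact mul_mem_intComponent hb (hmem e y hy)
    · have := hmem (q + e) (b * y) (SetLike.GradedMul.mul_mem hb hy)
      rwa [show ((q + e : ℕ) : ℤ) - 2 = q + (e + -2) by push_cast; ring] at this
  · rw [LinearMap.sub_apply, sub_eq_zero]
    ext b
    rcases ht.eq_or_lt with rfl | ht
    · rw [localBarZero_apply, hv.map_mul_of_mem h0 hy, LinearMap.comp_apply,
        componentProj_of_mem hy, ← barZero_apply, (hP _).2]
      rfl
    · rw [localBarZero_apply, hv t ht y hy, hv.map_mul_eq_zero ht hy, hs t ht y hy]
      simp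

/-- Subtracting differentials of 0-cochains does not change the differential of g, so the top
degrees of g can be removed down to degree one. -/
theorem exists_vanishesFrom_one (h : IsStandardGraded 𝒜)
    (hreg : IsLeftASRegular (k := k) A 𝒜 2) {n : ℕ} {g : A →ₗ[k] A →ₗ[k] A}
    (hg : IsLocalHomOne 𝒜 (-2) g) (hs : VanishesFrom 𝒜 (1 + n) g)
    (hd : VanishesFrom 𝒜 1 (localBarOne g)) :
    ∃ g' : A →ₗ[k] A →ₗ[k] A, IsLocalHomOne 𝒜 (-2) g' ∧ VanishesFrom 𝒜 1 g' ∧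
      localBarOne g' = localBarOne g := by
  induction n generalizing g with
  | zero => exact ⟨g, hg, hs, rfl⟩
  | succ n ih =>
    obtain ⟨p, hp, hgp⟩ := exists_localBarZero_sub h hreg (s := 1 + n) hg hs
      (hd.mono (by omega))
    have e : localBarOne (g - localBarZero p) = localBarOne g := by
      rw [localBarOne_sub, localBarOne_localBarZero, sub_zero]
    obtain ⟨g', hg', hv', hgg'⟩ := ih (g := g - localBarZero p)
      (fun e y hy => sub_mem (hg e y hy) (hp e y hy)) hgp (by rwa [e])
    exact ⟨g', hg', hv', hgg'.trans e⟩

/-- The local cohomology of degree `-2` is nonzero. -/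
theorem IsKoszulPair.exists_ne_localBarOne (hp : IsKoszulPair 𝒜 x w) (h : IsStandardGraded 𝒜)
    (hreg : IsLeftASRegular (k := k) A 𝒜 2) :
    ∃ f : A →ₗ[k] A →ₗ[k] A →ₗ[k] A, IsLocalBarCocycle f ∧ IsLocalHomTwo 𝒜 (-2) f ∧
      VanishesFrom 𝒜 1 f ∧
      ∀ g n, IsLocalHomOne 𝒜 (-2) g → VanishesFrom 𝒜 n g → f ≠ localBarOne g := by
  have h0 := h.connected
  obtain ⟨f, hf, hfd, hlam⟩ := hp.exists_isBarCocycle h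
  let F : A →ₗ[k] A →ₗ[k] A →ₗ[k] A :=
    (LinearMap.toSpanSingleton k _ f) ∘ₗ (aug h0).toLinearMap
  have hF (y : A) : F y = aug h0 y • f := rfl
  have hF1 : VanishesFrom 𝒜 1 F := fun s hs y hy => by
    rw [hF, aug_of_mem_pos h0 (by omega) hy, zero_smul]
  refine ⟨F, fun y a b c => ?_, fun e y hy => ?_, hF1, fun g n hg hn hFg => ?_⟩
  · have := hf a b c
    simp only [hF, LinearMap.smul_apply, map_mul, mul_smul, mul_smul_comm]
    rw [smul_comm (aug h0 c), ← smul_sub, ← smul_add, ← smul_sub, this, smul_zero]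
  · rw [hF]
    rcases eq_or_ne e 0 with rfl | he
    · exact Submodule.smul_mem _ _ hfd
    · rw [aug_of_mem_pos h0 he hy, zero_smul]
      exact zero_mem _
  · obtain ⟨g', hg', hv', hgg'⟩ := exists_vanishesFrom_one h hreg (n := n) hg
      (hn.mono (by omega)) (hFg ▸ hF1)
    have h1 : (1 : A) ∈ 𝒜 0 := SetLike.GradedOne.one_mem
    have e1 : f = barOne (aug h0) (g' 1) := by
      rw [← localBarOne_apply_of_mem h0 hv' h1, hgg', ← hFg, hF, map_one, one_smul]
    -- This value would have degree 1 - 2 < 0. Hence a coboundary of degree -2 vanishes on the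
    -- relation, where f has value 1.
    have e2 (i : ι) : g' 1 (x i) = 0 := by
      have := hg' 0 1 h1 1 (x i) (hp.x_mem i)
      rwa [intComponent_of_neg (by norm_num), Submodule.mem_bot] at this
    have : ∑ i, f (w i) (x i) = 0 := by
      rw [e1]
      simp only [barOne_apply, e2, mul_zero, zero_sub, aug_of_mem_succ h0 (hp.x_mem _), zero_smul,
        add_zero, Finset.sum_neg_distrib]
      rw [← map_sum, hp.rel, map_zero, neg_zero]
    rw [hlam] at this
    exact one_ne_zero this

end Nonvanishing

/-! ### Translation between curried cochains, last variable first, and multilinear maps. -/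

section Multilinear

set_option maxSynthPendingDepth 8

variable {k : Type*} [Field k] {A : Type u} [Ring A] [Algebra k A]

theorem eta_three {A : Type*} (a : Fin 3 → A) : a = ![a 0, a 1, a 2] := by
  ext i; fin_cases i <;> rfl

theorem eta_four {A : Type*} (a : Fin 4 → A) : a = ![a 0, a 1, a 2, a 3] := by
  ext i; fin_cases i <;> rfl

theorem barDifferential_two (g : (Fin 2 → A) → A) (a b x : A) :
    barDifferential (i := 1) g ![a, b, x] = a * g ![b, x] - g ![a * b, x] + g ![a, b * x] := by
  have h0 : Fin.contractNth (Fin.castSucc 0) (· * ·) ![a, b, x] = ![a * b, x] := by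
    ext i; fin_cases i <;> rfl
  have h1 : Fin.contractNth (Fin.castSucc 1) (· * ·) ![a, b, x] = ![a, b * x] := by
    ext i; fin_cases i <;> rfl
  have ht : Fin.tail ![a, b, x] = ![b, x] := rfl
  rw [barDifferential, Fin.sum_univ_two, h0, h1, ht]
  simp only [Matrix.cons_val_zero, Fin.val_zero, Fin.val_one, zero_add, pow_one, neg_mul, one_mul,
    Nat.reduceAdd, even_two, Even.neg_pow, one_pow]
  abel

theorem barDifferential_three (f : (Fin 3 → A) → A) (a b c x : A) :
    barDifferential (i := 2) f ![a, b, c, x] =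
      a * f ![b, c, x] - f ![a * b, c, x] + f ![a, b * c, x] - f ![a, b, c * x] := by
  have h0 : Fin.contractNth (Fin.castSucc 0) (· * ·) ![a, b, c, x] = ![a * b, c, x] := by
    ext i; fin_cases i <;> rfl
  have h1 : Fin.contractNth (Fin.castSucc 1) (· * ·) ![a, b, c, x] = ![a, b * c, x] := by
    ext i; fin_cases i <;> rfl
  have h2 : Fin.contractNth (Fin.castSucc 2) (· * ·) ![a, b, c, x] = ![a, b, c * x] := by
    ext i; fin_cases i <;> rfl
  have ht : Fin.tail ![a, b, c, x] = ![b, c, x] := rfl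
  rw [barDifferential, Fin.sum_univ_three, h0, h1, h2, ht]
  simp only [Matrix.cons_val_zero, Fin.val_zero, Fin.val_one, Fin.val_two, zero_add, neg_mul,
    one_mul, Nat.reduceAdd, pow_succ, pow_zero, mul_neg,
    mul_one, neg_neg]
  abel

/-- Bilinear maps `(x, b) ↦ g(x, b)` as multilinear maps in `(b, x)`. -/
def ofBilinear (g : A →ₗ[k] A →ₗ[k] A) : MultilinearMap k (fun _ : Fin 2 => A) A where
  toFun a := g (a 1) (a 0)
  -- The field quantifies over all `DecidableEq` instances on the index type; passing to the
  -- canonical one lets `Function.update` be computed.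
  map_update_add' := @fun inst a i y z => by
    rw [Subsingleton.elim inst (instDecidableEqFin 2)]
    fin_cases i <;> simp
  map_update_smul' := @fun inst a i c y => by
    rw [Subsingleton.elim inst (instDecidableEqFin 2)]
    fin_cases i <;> simp

/-- Trilinear maps `(x, a, b) ↦ f(x, a, b)` as multilinear maps in `(a, b, x)`. -/
def ofTrilinear (f : A →ₗ[k] A →ₗ[k] A →ₗ[k] A) : MultilinearMap k (fun _ : Fin 3 => A) A :=
  have h0 (a : Fin 3 → A) (y : A) : Function.update a 0 y = ![y, a 1, a 2] := by
    ext i; fin_cases i <;> rfl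
  have h1 (a : Fin 3 → A) (y : A) : Function.update a 1 y = ![a 0, y, a 2] := by
    ext i; fin_cases i <;> rfl
  have h2 (a : Fin 3 → A) (y : A) : Function.update a 2 y = ![a 0, a 1, y] := by
    ext i; fin_cases i <;> rfl
  have hi : ∀ i : Fin 3, i = 0 ∨ i = 1 ∨ i = 2 := by decide
  { toFun := fun a => f (a 2) (a 0) (a 1)
    map_update_add' := @fun inst a i y z => by
      rw [Subsingleton.elim inst (instDecidableEqFin 3)]
      obtain rfl | rfl | rfl := hi i
      · rw [h0, h0, h0]; exact LinearMap.map_add₂ _ _ _ _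
      · rw [h1, h1, h1]; exact map_add _ _ _
      · rw [h2, h2, h2]
        exact congrArg (fun F : A →ₗ[k] A →ₗ[k] A => F (a 0) (a 1)) (map_add f y z)
    map_update_smul' := @fun inst a i c y => by
      rw [Subsingleton.elim inst (instDecidableEqFin 3)]
      obtain rfl | rfl | rfl := hi i
      · rw [h0, h0]; exact LinearMap.map_smul₂ _ _ _ _
      · rw [h1, h1]; exact map_smul _ _ _
      · rw [h2, h2]
        exact congrArg (fun F : A →ₗ[k] A →ₗ[k] A => F (a 0) (a 1)) (map_smul f c y) }

theorem ofTrilinear_apply (f : A →ₗ[k] A →ₗ[k] A →ₗ[k] A) (a b c : A) :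
    ofTrilinear f ![a, b, c] = f c a b := rfl

/-- Multilinear maps in `(a, b, x)` as trilinear maps `(x, a, b) ↦ f(x, a, b)`. -/
def toTrilinear (f : MultilinearMap k (fun _ : Fin 3 => A) A) : A →ₗ[k] A →ₗ[k] A →ₗ[k] A :=
  have h0 (a b x : A) (y : A) : Function.update ![a, b, x] 0 y = ![y, b, x] := by
    ext i; fin_cases i <;> rfl
  have h1 (a b x : A) (y : A) : Function.update ![a, b, x] 1 y = ![a, y, x] := by
    ext i; fin_cases i <;> rfl
  have h2 (a b x : A) (y : A) : Function.update ![a, b, x] 2 y = ![a, b, y] := by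
    ext i; fin_cases i <;> rfl
  { toFun := fun x => LinearMap.mk₂ k (fun a b => f ![a, b, x])
      (fun a a' b => by
        have := f.map_update_add ![a, b, x] 0 a a'
        rwa [h0, h0, h0] at this)
      (fun c a b => by
        have := f.map_update_smul ![a, b, x] 0 c a
        rwa [h0, h0] at this)
      (fun a b b' => by
        have := f.map_update_add ![a, b, x] 1 b b'
        rwa [h1, h1, h1] at this)
      (fun c a b => by
        have := f.map_update_smul ![a, b, x] 1 c b
        rwa [h1, h1] at this)
    map_add' := fun x y => LinearMap.ext₂ fun a b => by
      have := f.map_update_add ![a, b, x] 2 x y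
      rwa [h2, h2, h2] at this
    map_smul' := fun c x => LinearMap.ext₂ fun a b => by
      have := f.map_update_smul ![a, b, x] 2 c x
      rwa [h2, h2] at this }

@[simp] theorem toTrilinear_apply (f : MultilinearMap k (fun _ : Fin 3 => A) A) (x a b : A) :
    toTrilinear f x a b = f ![a, b, x] := rfl

theorem toTrilinear_ofTrilinear (f : A →ₗ[k] A →ₗ[k] A →ₗ[k] A) :
    toTrilinear (ofTrilinear f) = f := by
  ext x a b; rfl

/-- Multilinear maps in `(b, x)` as bilinear maps `(x, b) ↦ g(x, b)`. -/
def toBilinear (f : MultilinearMap k (fun _ : Fin 2 => A) A) : A →ₗ[k] A →ₗ[k] A :=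
  have h0 (a b : A) (y : A) : Function.update ![a, b] 0 y = ![y, b] := by
    ext i; fin_cases i <;> rfl
  have h1 (a b : A) (y : A) : Function.update ![a, b] 1 y = ![a, y] := by
    ext i; fin_cases i <;> rfl
  LinearMap.mk₂ k (fun x a => f ![a, x])
    (fun x x' a => by
      have := f.map_update_add ![a, x] 1 x x'
      rwa [h1, h1, h1] at this)
    (fun c x a => by
      have := f.map_update_smul ![a, x] 1 c x
      rwa [h1, h1] at this)
    (fun x a a' => by
      have := f.map_update_add ![a, x] 0 a a'
      rwa [h0, h0, h0] at this)
    (fun c x a => by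
      have := f.map_update_smul ![a, x] 0 c a
      rwa [h0, h0] at this)

theorem barDifferential_ofBilinear (g : A →ₗ[k] A →ₗ[k] A) (a : Fin 3 → A) :
    barDifferential (i := 1) (ofBilinear g) a = ofTrilinear (localBarOne g) a := by
  rw [eta_three a, barDifferential_two]
  rfl

theorem toTrilinear_barDifferential {f : MultilinearMap k (fun _ : Fin 3 => A) A}
    {g : MultilinearMap k (fun _ : Fin 2 => A) A} (h : (f : (Fin 3 → A) → A) = barDifferential g) :
    toTrilinear f = localBarOne (toBilinear g) := by
  ext x a b
  rw [toTrilinear_apply, h, barDifferential_two]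
  rfl

theorem isLocalBarCocycle_toTrilinear {f : MultilinearMap k (fun _ : Fin 3 => A) A}
    (hf : barDifferential f = 0) : IsLocalBarCocycle (toTrilinear f) := by
  intro x a b c
  have := congrFun hf ![a, b, c, x]
  rw [barDifferential_three] at this
  exact this

theorem barDifferential_ofTrilinear {f : A →ₗ[k] A →ₗ[k] A →ₗ[k] A} (hf : IsLocalBarCocycle f) :
    barDifferential (ofTrilinear f) = 0 := by
  ext a
  rw [eta_four a, barDifferential_three]
  exact hf _ _ _ _

variable {𝒜 : ℕ → Submodule k A}

theorem isLocalCochain_ofBilinear {j : ℤ} {N : ℕ} {g : A →ₗ[k] A →ₗ[k] A}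
    (hg : IsLocalHomOne 𝒜 j g) (hN : VanishesFrom 𝒜 N g) : IsLocalCochain 𝒜 1 j (ofBilinear g) := by
  refine ⟨⟨N, fun s hs a ha => ?_⟩, fun e a ha => ?_⟩
  · exact LinearMap.congr_fun (hN s hs (a 1) ha) (a 0)
  · have := hg (e 1) (a 1) (ha 1) (e 0) (a 0) (ha 0)
    rwa [← add_assoc, ← Fin.sum_univ_two (fun t => (e t : ℤ))] at this

theorem isLocalCochain_ofTrilinear {j : ℤ} {N : ℕ} {f : A →ₗ[k] A →ₗ[k] A →ₗ[k] A}
    (hf : IsLocalHomTwo 𝒜 j f) (hN : VanishesFrom 𝒜 N f) :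
    IsLocalCochain 𝒜 2 j (ofTrilinear f) := by
  refine ⟨⟨N, fun s hs a ha => ?_⟩, fun e a ha => ?_⟩
  · exact LinearMap.congr_fun₂ (hN s hs (a 2) ha) (a 0) (a 1)
  · have := hf (e 2) (a 2) (ha 2) (e 0) (e 1) (a 0) (ha 0) (a 1) (ha 1)
    rwa [← add_assoc, ← Fin.sum_univ_three (fun t => (e t : ℤ))] at this

theorem IsLocalCochain.toTrilinear {j : ℤ} {f : MultilinearMap k (fun _ : Fin 3 => A) A}
    (hf : IsLocalCochain 𝒜 2 j f) :
    IsLocalHomTwo 𝒜 j (toTrilinear f) ∧ ∃ N, VanishesFrom 𝒜 N (toTrilinear f) := by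
  obtain ⟨⟨N, hN⟩, hd⟩ := hf
  refine ⟨fun e x hx p q a ha b hb => ?_, N, fun s hs x hx => ?_⟩
  · have := hd ![p, q, e] ![a, b, x] (by intro t; fin_cases t <;> assumption)
    rw [Fin.sum_univ_three] at this
    rwa [← add_assoc]
  · ext a b
    exact hN s hs ![a, b, x] hx

theorem IsLocalCochain.toBilinear {j : ℤ} {g : MultilinearMap k (fun _ : Fin 2 => A) A}
    (hg : IsLocalCochain 𝒜 1 j g) :
    IsLocalHomOne 𝒜 j (toBilinear g) ∧ ∃ N, VanishesFrom 𝒜 N (toBilinear g) := by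
  obtain ⟨⟨N, hN⟩, hd⟩ := hg
  refine ⟨fun e x hx p a ha => ?_, N, fun s hs x hx => ?_⟩
  · have := hd ![p, e] ![a, x] (by intro t; fin_cases t <;> assumption)
    rw [Fin.sum_univ_two] at this
    rwa [← add_assoc]
  · ext a
    exact hN s hs ![a, x] hx

theorem isLocalCoboundary_of_toTrilinear_eq {j : ℤ} {N : ℕ}
    {f : MultilinearMap k (fun _ : Fin 3 => A) A} {g : A →ₗ[k] A →ₗ[k] A}
    (hg : IsLocalHomOne 𝒜 j g) (hN : VanishesFrom 𝒜 N g) (h : toTrilinear f = localBarOne g) :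
    IsLocalCoboundary 𝒜 j 2 f := by
  refine ⟨ofBilinear g, isLocalCochain_ofBilinear hg hN, ?_⟩
  ext a
  rw [barDifferential_ofBilinear, ← h, eta_three a]
  rfl

variable [GradedAlgebra 𝒜] [Nontrivial A] {ι : Type} [Fintype ι] {x w : ι → A}

namespace IsKoszulPair

theorem localCohomologyVanishes (hp : IsKoszulPair 𝒜 x w) (h : IsStandardGraded 𝒜) {j : ℤ}
    (hj : -2 < j) : LocalCohomologyVanishes 𝒜 2 j := by
  intro f hf hd
  obtain ⟨hfj, N, hN⟩ := hf.toTrilinear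
  obtain ⟨g, hg, hv, hfg⟩ := hp.exists_eq_localBarOne h hj (isLocalBarCocycle_toTrilinear hd) hfj hN
  exact isLocalCoboundary_of_toTrilinear_eq hg hv hfg

theorem not_localCohomologyVanishes (hp : IsKoszulPair 𝒜 x w) (h : IsStandardGraded 𝒜)
    (hreg : IsLeftASRegular (k := k) A 𝒜 2) : ¬ LocalCohomologyVanishes 𝒜 2 (-2) := by
  intro hvan
  obtain ⟨f, hf, hfd, hN, hne⟩ := hp.exists_ne_localBarOne h hreg
  obtain ⟨g, hg, hfg⟩ := hvan (ofTrilinear f) (isLocalCochain_ofTrilinear hfd hN)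
    (barDifferential_ofTrilinear hf)
  obtain ⟨hg', N, hN'⟩ := hg.toBilinear
  refine hne _ N hg' hN' ?_
  rw [← toTrilinear_barDifferential hfg, toTrilinear_ofTrilinear]

theorem isLocalCoboundary_of_sum_eq_zero (hp : IsKoszulPair 𝒜 x w) (h : IsStandardGraded 𝒜)
    {j : ℤ} {f : MultilinearMap k (fun _ : Fin 3 => A) A} (hf : IsLocalCochain 𝒜 2 j f)
    (hd : barDifferential f = 0) (h1 : VanishesFrom 𝒜 1 (toTrilinear f))
    (hlam : ∑ i, f ![w i, x i, 1] = 0) : IsLocalCoboundary 𝒜 j 2 f := by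
  obtain ⟨g, hg, hv, hfg⟩ := hp.exists_eq_localBarOne_of_sum_eq_zero h
    (isLocalBarCocycle_toTrilinear hd) hf.toTrilinear.1 h1 hlam
  exact isLocalCoboundary_of_toTrilinear_eq hg hv hfg

/-- Every class of degree `-2` is represented by a cocycle on the trivial module. -/
theorem exists_sub_barDifferential (hp : IsKoszulPair 𝒜 x w) (h : IsStandardGraded 𝒜)
    {f : MultilinearMap k (fun _ : Fin 3 => A) A} (hf : IsLocalCochain 𝒜 2 (-2) f)
    (hd : barDifferential f = 0) :
    ∃ (f₁ : MultilinearMap k (fun _ : Fin 3 => A) A) (g : MultilinearMap k (fun _ : Fin 2 => A) A),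
      IsLocalCochain 𝒜 2 (-2) f₁ ∧ barDifferential f₁ = 0 ∧ VanishesFrom 𝒜 1 (toTrilinear f₁) ∧
      IsLocalCochain 𝒜 1 (-2) g ∧ ∀ a, f a = f₁ a + barDifferential g a := by
  obtain ⟨hfj, N, hN⟩ := hf.toTrilinear
  have hc := isLocalBarCocycle_toTrilinear hd
  -- m = 1 is the least degree with -2 < m - 2.
  obtain ⟨g, hg, hv, hfg⟩ := hp.exists_localBarOne_sub_vanishesFrom h (m := 1) (n := N)
    (j := -2) (by norm_num) hc hfj (hN.mono (by omega))
  refine ⟨ofTrilinear (toTrilinear f - localBarOne g), ofBilinear g,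
    isLocalCochain_ofTrilinear (hfj.sub hg.localBarOne) hfg,
    barDifferential_ofTrilinear (hc.sub (isLocalBarCocycle_localBarOne g)), ?_,
    isLocalCochain_ofBilinear hg hv, fun a => ?_⟩
  · rwa [toTrilinear_ofTrilinear]
  · rw [barDifferential_ofBilinear, eta_three a, ofTrilinear_apply, ofTrilinear_apply]
    simp

end IsKoszulPair

end Multilinear

/-! ### Convolution with the action and with the antipode. -/

section Convolution

open Coalgebra

variable {k H A : Type*} [Field k] [Ring H] [HopfAlgebra k H] [Ring A] [Algebra k A]

/-- The map `h ↦ ∑ α(h₁) φ(h₂)`. -/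
def convAct (α : H →ₗ[k] Module.End k A) (φ : H →ₗ[k] A) : H →ₗ[k] A :=
  TensorProduct.lift (LinearMap.compl₂ α φ) ∘ₗ comul

/-- The map `h ↦ ∑ α(h₁) β(h₂)`. -/
def convEnd (α β : H →ₗ[k] Module.End k A) : H →ₗ[k] Module.End k A :=
  LinearMap.mul' k (Module.End k A) ∘ₗ TensorProduct.map α β ∘ₗ comul

theorem convAct_convEnd (α β : H →ₗ[k] Module.End k A) (φ : H →ₗ[k] A) :
    convAct (convEnd α β) φ = convAct α (convAct β φ) := by
  let Θ : H ⊗[k] (H ⊗[k] H) →ₗ[k] A :=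
    TensorProduct.lift (LinearMap.compl₂ α (TensorProduct.lift (LinearMap.compl₂ β φ)))
  have h1 (z : H ⊗[k] H) : TensorProduct.lift (LinearMap.compl₂ (convEnd α β) φ) z =
      Θ (TensorProduct.assoc k H H H (comul.rTensor H z)) := by
    induction z with
    | zero => simp
    | add y z hy hz => simp only [map_add, hy, hz]
    | tmul p y =>
      rw [LinearMap.rTensor_tmul, TensorProduct.lift.tmul, LinearMap.compl₂_apply]
      change LinearMap.mul' k (Module.End k A) (TensorProduct.map α β (comul p)) (φ y) = _
      induction comul (R := k) p with
      | zero => simp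
      | add x z hx hz => simp only [map_add, TensorProduct.add_tmul, LinearMap.add_apply, hx, hz]
      | tmul p q => simp [Θ]
  have h2 (z : H ⊗[k] H) : TensorProduct.lift (LinearMap.compl₂ α (convAct β φ)) z =
      Θ (comul.lTensor H z) := by
    induction z with
    | zero => simp
    | add y z hy hz => simp only [map_add, hy, hz]
    | tmul p y => rfl
  ext h
  exact (h1 _).trans ((congrArg Θ (coassoc_apply h)).trans (h2 _).symm)

/-- The unit for the convolution. -/
def convOne : H →ₗ[k] Module.End k A := Algebra.linearMap k (Module.End k A) ∘ₗ counit

theorem lift_comul_of_counit_smul {T : Type*} [AddCommGroup T] [Module k T]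
    {B : H →ₗ[k] H →ₗ[k] T} {φ : H →ₗ[k] T} (h : ∀ x y, B x y = counit (R := k) x • φ y) (z : H) :
    TensorProduct.lift B (comul z) = φ z := by
  have : TensorProduct.lift B = φ ∘ₗ (TensorProduct.lid k H).toLinearMap ∘ₗ counit.rTensor H := by
    ext x y
    simp [h]
  rw [this]
  simp

theorem lift_comul_of_smul_counit {T : Type*} [AddCommGroup T] [Module k T]
    {B : H →ₗ[k] H →ₗ[k] T} {φ : H →ₗ[k] T} (h : ∀ x y, B x y = counit (R := k) y • φ x) (z : H) :
    TensorProduct.lift B (comul z) = φ z := by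
  have : TensorProduct.lift B = φ ∘ₗ (TensorProduct.rid k H).toLinearMap ∘ₗ counit.lTensor H := by
    ext x y
    simp [h]
  rw [this]
  simp

theorem convAct_convOne (φ : H →ₗ[k] A) : convAct convOne φ = φ := by
  ext h
  exact lift_comul_of_counit_smul (fun x y => by
    rw [LinearMap.compl₂_apply, convOne, LinearMap.comp_apply, Algebra.linearMap_apply,
      Module.algebraMap_end_apply]) h

variable (ρ : H →ₐ[k] Module.End k A)

theorem convEnd_antipode_left :
    convEnd (ρ.toLinearMap ∘ₗ HopfAlgebra.antipode k) ρ.toLinearMap = convOne := by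
  ext1 h
  have h1 (z : H ⊗[k] H) : LinearMap.mul' k (Module.End k A)
      (TensorProduct.map (ρ.toLinearMap ∘ₗ HopfAlgebra.antipode k) ρ.toLinearMap z) =
      ρ (LinearMap.mul' k H ((HopfAlgebra.antipode k).rTensor H z)) := by
    induction z with
    | zero => simp
    | add y z hy hz => simp only [map_add, hy, hz]
    | tmul p y => simp
  refine (h1 _).trans ?_
  rw [HopfAlgebra.mul_antipode_rTensor_comul_apply, AlgHom.commutes]
  rfl

theorem convEnd_antipode_right :
    convEnd ρ.toLinearMap (ρ.toLinearMap ∘ₗ HopfAlgebra.antipode k) = convOne := by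
  ext1 h
  have h1 (z : H ⊗[k] H) : LinearMap.mul' k (Module.End k A)
      (TensorProduct.map ρ.toLinearMap (ρ.toLinearMap ∘ₗ HopfAlgebra.antipode k) z) =
      ρ (LinearMap.mul' k H ((HopfAlgebra.antipode k).lTensor H z)) := by
    induction z with
    | zero => simp
    | add y z hy hz => simp only [map_add, hy, hz]
    | tmul p y => simp
  refine (h1 _).trans ?_
  rw [HopfAlgebra.mul_antipode_lTensor_comul_apply, AlgHom.commutes]
  rfl

/-- The map `h ↦ ∑ S(h₁) · φ(h₂)`. -/
def convAntipode (φ : H →ₗ[k] A) : H →ₗ[k] A :=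
  convAct (ρ.toLinearMap ∘ₗ HopfAlgebra.antipode k) φ

/-- The map `h ↦ ∑ (h₁ · a) φ(h₂)`. -/
def convOrbit (a : A) (φ : H →ₗ[k] A) : H →ₗ[k] A :=
  convAct (LinearMap.mul k A ∘ₗ orbit ρ a) φ

/-- In Sweedler notation, ∑ S(h₁)·((h₂·a) φ(h₃)) = a ∑ S(h₁)·φ(h₂). Convolution with ρ inverts
convolution with ρ ∘ S, and after convolving with ρ the identity is the product rule for h·(ab). -/
theorem convAntipode_convOrbit {ρ : H →ₐ[k] Module.End k A} (hρ : IsModuleAlgebra ρ) (a : A) (φ : H →ₗ[k] A) :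
    convAntipode ρ (convOrbit ρ a φ) = LinearMap.mulLeft k a ∘ₗ convAntipode ρ φ := by
  have h1 : convAct ρ.toLinearMap (LinearMap.mulLeft k a ∘ₗ convAntipode ρ φ) =
      convOrbit ρ a (convAct ρ.toLinearMap (convAntipode ρ φ)) := by
    rw [convOrbit, ← convAct_convEnd]
    unfold convAct
    congr 2
    ext x y
    rw [LinearMap.compl₂_apply, LinearMap.compl₂_apply, LinearMap.comp_apply,
      LinearMap.mulLeft_apply]
    refine (hρ.act_mul x a _).trans ?_
    change _ = LinearMap.mul' k (Module.End k A) (TensorProduct.map _ _ (comul x)) _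
    induction comul (R := k) x with
    | zero => simp
    | add x z hx hz => simp only [map_add, LinearMap.add_apply, hx, hz]
    | tmul p q => simp
  have h2 (ψ : H →ₗ[k] A) : convAct ρ.toLinearMap (convAntipode ρ ψ) = ψ := by
    rw [convAntipode, ← convAct_convEnd, convEnd_antipode_right, convAct_convOne]
  have h3 (ψ : H →ₗ[k] A) : convAntipode ρ (convAct ρ.toLinearMap ψ) = ψ := by
    rw [convAntipode, ← convAct_convEnd, convEnd_antipode_left, convAct_convOne]
  rw [← h3 (LinearMap.mulLeft k a ∘ₗ convAntipode ρ φ), h1, h2]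

end Convolution

/-! ### The action of H on bar cochains commutes with the differential. -/

section DiagonalEval

open Coalgebra

variable {k H A : Type*} [Field k] [Ring H] [HopfAlgebra k H] [Ring A] [Algebra k A]
  (ρ : H →ₐ[k] Module.End k A)

theorem antipodeTwist_eq {n : ℕ} (f : MultilinearMap k (fun _ : Fin n => A) A) (h : H)
    (a : Fin n → A) : antipodeTwist ρ f h a = convAntipode ρ (diagonalEval ρ n a f) h := rfl

theorem diagonalEval_succ {n : ℕ} (f : MultilinearMap k (fun _ : Fin (n + 1) => A) A)
    (a : Fin (n + 1) → A) : diagonalEval ρ (n + 1) a f = TensorProduct.lift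
      (diagonalEval ρ n (Fin.tail a) ∘ₗ f.curryLeft ∘ₗ orbit ρ (a 0)) ∘ₗ comul := rfl

theorem diagonalEval_compMultilinearMap {n : ℕ} (f : MultilinearMap k (fun _ : Fin n => A) A)
    (a : Fin n → A) (T : A →ₗ[k] A) :
    diagonalEval ρ n a (T.compMultilinearMap f) = T ∘ₗ diagonalEval ρ n a f := by
  induction n with
  | zero =>
    ext h
    exact (map_smul T _ _).symm
  | succ n ih =>
    have h1 : TensorProduct.lift (diagonalEval ρ n (Fin.tail a) ∘ₗ
        (T.compMultilinearMap f).curryLeft ∘ₗ orbit ρ (a 0)) = T ∘ₗ TensorProduct.lift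
          (diagonalEval ρ n (Fin.tail a) ∘ₗ f.curryLeft ∘ₗ orbit ρ (a 0)) :=
      TensorProduct.ext' fun x y =>
        LinearMap.congr_fun (ih (f.curryLeft (ρ x (a 0))) (Fin.tail a)) y
    rw [diagonalEval_succ, h1]
    rfl

theorem exists_diagonalEval_eq (n : ℕ) (h : H) : ∃ (m : ℕ) (c : Fin m → k) (q : Fin m → Fin n → H),
    ∀ (f : MultilinearMap k (fun _ : Fin n => A) A) (a : Fin n → A),
      diagonalEval ρ n a f h = ∑ i, c i • f (fun t => ρ (q i t) (a t)) := by
  induction n generalizing h with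
  | zero =>
    refine ⟨1, fun _ => counit h, fun _ t => t.elim0, fun f a => ?_⟩
    rw [Fin.sum_univ_one]
    change counit (R := k) h • f ![] = _
    congr 2
    exact Subsingleton.elim _ _
  | succ n ih =>
    choose m c q hq using ih
    let r := Repr.arbitrary k h
    let I := Σ j : r.index, Fin (m (r.right j))
    let e : Fin (Fintype.card I) ≃ I := (Fintype.equivFin I).symm
    refine ⟨Fintype.card I, fun i => c _ (e i).2,
      fun i => Fin.cons (r.left (e i).1) (q _ (e i).2), fun f a => ?_⟩
    rw [Equiv.sum_comp e (fun i : I => c _ i.2 • f (fun t => ρ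
      ((Fin.cons (r.left i.1) (q _ i.2) : Fin (n + 1) → H) t) (a t))), Fintype.sum_sigma,
      Finset.sum_coe_sort r.index (fun j => ∑ i : Fin (m (r.right j)), c _ i • f (fun t => ρ
      ((Fin.cons (r.left j) (q _ i) : Fin (n + 1) → H) t) (a t))), diagonalEval_succ,
      LinearMap.comp_apply, ← r.eq, map_sum]
    refine Finset.sum_congr rfl fun j _ => ?_
    rw [TensorProduct.lift.tmul]
    refine (hq _ _ _).trans (Finset.sum_congr rfl fun i _ => ?_)
    rw [LinearMap.comp_apply, MultilinearMap.curryLeft_apply]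
    congr 2
    ext t
    refine Fin.cases ?_ (fun t => ?_) t <;> rfl

/-- A Sweedler expansion whose coefficients and elements do not depend on f or a. Linearity,
multilinearity and degree statements about f·h are read off from it. -/
theorem exists_antipodeTwist_eq (n : ℕ) (h : H) :
    ∃ (m : ℕ) (c : Fin m → k) (p : Fin m → H) (q : Fin m → Fin n → H),
      ∀ (f : MultilinearMap k (fun _ : Fin n => A) A) (a : Fin n → A),
        antipodeTwist ρ f h a = ∑ i, c i • ρ (p i) (f (fun t => ρ (q i t) (a t))) := by
  choose m c q hq using fun h => exists_diagonalEval_eq ρ n h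
  let r := Repr.arbitrary k h
  let I := Σ j : r.index, Fin (m (r.right j))
  let e : Fin (Fintype.card I) ≃ I := (Fintype.equivFin I).symm
  refine ⟨Fintype.card I, fun i => c _ (e i).2,
    fun i => HopfAlgebra.antipode k (r.left (e i).1), fun i => q _ (e i).2, fun f a => ?_⟩
  rw [Equiv.sum_comp e (fun i : I => c _ i.2 • ρ (HopfAlgebra.antipode k (r.left i.1))
      (f (fun t => ρ (q _ i.2 t) (a t)))), Fintype.sum_sigma,
    Finset.sum_coe_sort r.index (fun j => ∑ i : Fin (m (r.right j)), c _ i •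
      ρ (HopfAlgebra.antipode k (r.left j)) (f (fun t => ρ (q _ i t) (a t)))), antipodeTwist,
    ← r.eq, map_sum]
  refine Finset.sum_congr rfl fun j _ => ?_
  rw [TensorProduct.lift.tmul, LinearMap.compl₂_apply, hq, map_sum]
  exact Finset.sum_congr rfl fun i _ => map_smul _ _ _

/-- `f · h`, as a multilinear map. -/
def twist {n : ℕ} (h : H) (f : MultilinearMap k (fun _ : Fin n => A) A) :
    MultilinearMap k (fun _ : Fin n => A) A where
  toFun a := antipodeTwist ρ f h a
  map_update_add' := @fun inst a i y z => by
    obtain ⟨m, c, p, q, hf⟩ := exists_antipodeTwist_eq (A := A) ρ n h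
    let F : MultilinearMap k (fun _ : Fin n => A) A := ∑ i, c i •
      (ρ (p i)).compMultilinearMap (f.compLinearMap fun t => ρ (q i t))
    have hF (a : Fin n → A) : antipodeTwist ρ f h a = F a := by
      rw [hf]; simp [F]
    rw [hF, hF, hF, F.map_update_add]
  map_update_smul' := @fun inst a i r y => by
    obtain ⟨m, c, p, q, hf⟩ := exists_antipodeTwist_eq (A := A) ρ n h
    let F : MultilinearMap k (fun _ : Fin n => A) A := ∑ i, c i •
      (ρ (p i)).compMultilinearMap (f.compLinearMap fun t => ρ (q i t))
    have hF (a : Fin n → A) : antipodeTwist ρ f h a = F a := by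
      rw [hf]; simp [F]
    rw [hF, hF, F.map_update_smul]

theorem twist_apply {n : ℕ} (h : H) (f : MultilinearMap k (fun _ : Fin n => A) A)
    (a : Fin n → A) : twist ρ h f a = antipodeTwist ρ f h a := rfl

theorem antipodeTwist_add {n : ℕ} (f g : MultilinearMap k (fun _ : Fin n => A) A) (h : H)
    (a : Fin n → A) : antipodeTwist ρ (f + g) h a =
      antipodeTwist ρ f h a + antipodeTwist ρ g h a := by
  obtain ⟨m, c, p, q, hf⟩ := exists_antipodeTwist_eq (A := A) ρ n h
  simp [hf, Finset.sum_add_distrib]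

theorem antipodeTwist_smul {n : ℕ} (r : k) (f : MultilinearMap k (fun _ : Fin n => A) A) (h : H)
    (a : Fin n → A) : antipodeTwist ρ (r • f) h a = r • antipodeTwist ρ f h a := by
  obtain ⟨m, c, p, q, hf⟩ := exists_antipodeTwist_eq (A := A) ρ n h
  simp [hf, Finset.smul_sum, smul_comm r]

theorem IsLocalCochain.twist {𝒜 : ℕ → Submodule k A} (hgr : ∀ n h, ∀ a ∈ 𝒜 n, ρ h a ∈ 𝒜 n) {i : ℕ}
    {j : ℤ} {f : MultilinearMap k (fun _ : Fin (i + 1) => A) A} (hf : IsLocalCochain 𝒜 i j f)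
    (h : H) : IsLocalCochain 𝒜 i j (twist ρ h f) := by
  obtain ⟨m, c, p, q, hq⟩ := exists_antipodeTwist_eq (A := A) ρ (i + 1) h
  obtain ⟨⟨N, hN⟩, hd⟩ := hf
  have hint (z : ℤ) (x : H) (a : A) (ha : a ∈ intComponent 𝒜 z) : ρ x a ∈ intComponent 𝒜 z := by
    rcases lt_or_ge z 0 with hz | hz
    · rw [intComponent_of_neg hz, Submodule.mem_bot] at ha ⊢
      rw [ha, map_zero]
    · lift z to ℕ using hz
      rw [intComponent_natCast] at ha ⊢
      exact hgr _ _ _ ha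
  refine ⟨⟨N, fun s hs a ha => ?_⟩, fun e a ha => ?_⟩
  · rw [twist_apply, hq]
    refine Finset.sum_eq_zero fun l _ => ?_
    rw [hN s hs _ (hgr _ _ _ ha), map_zero, smul_zero]
  · rw [twist_apply, hq]
    exact sum_mem fun l _ => Submodule.smul_mem _ _ (hint _ _ _ (hd e _ fun t => hgr _ _ _ (ha t)))

/-- The multilinear map `a ↦ f(a₀, …, aₜ aₜ₊₁, …)`. -/
def contract : (n : ℕ) → Fin n → (MultilinearMap k (fun _ : Fin n => A) A →ₗ[k]
    MultilinearMap k (fun _ : Fin (n + 1) => A) A)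
  | 0, t => t.elim0
  | n + 1, t => Fin.cases
      { toFun := fun f => LinearMap.uncurryLeft
          { toFun := fun a => LinearMap.uncurryLeft (f.curryLeft ∘ₗ LinearMap.mulLeft k a)
            map_add' := fun a b => by ext; simp [add_mul]
            map_smul' := fun c a => by ext; simp }
        map_add' := fun f g => by ext; simp
        map_smul' := fun c f => by ext; simp }
      (fun t =>
        { toFun := fun f => LinearMap.uncurryLeft (contract n t ∘ₗ f.curryLeft)
          map_add' := fun f g => by
            ext a
            exact DFunLike.congr_fun (map_add (contract n t) (f.curryLeft (a 0))
              (g.curryLeft (a 0))) (Fin.tail a)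
          map_smul' := fun c f => by
            ext a
            exact DFunLike.congr_fun (map_smul (contract n t) c (f.curryLeft (a 0)))
              (Fin.tail a) }) t

theorem contractNth_castSucc_zero {n : ℕ} (a : Fin (n + 2) → A) :
    Fin.contractNth (Fin.castSucc 0) (· * ·) a =
      (Fin.cons (a 0 * a 1) (Fin.tail (Fin.tail a)) : Fin (n + 1) → A) := by
  ext t
  refine Fin.cases ?_ (fun t => ?_) t
  · simp [Fin.contractNth]
  · simp [Fin.contractNth, Fin.tail]

theorem contractNth_castSucc_succ {n : ℕ} (a : Fin (n + 2) → A) (t : Fin n) :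
    Fin.contractNth (Fin.castSucc t.succ) (· * ·) a =
      (Fin.cons (a 0) (Fin.contractNth t.castSucc (· * ·) (Fin.tail a)) : Fin (n + 1) → A) := by
  ext s
  refine Fin.cases ?_ (fun s => ?_) s
  · simp [Fin.contractNth]
  · simp [Fin.contractNth, Fin.tail]

theorem contract_apply {n : ℕ} (t : Fin n) (f : MultilinearMap k (fun _ : Fin n => A) A)
    (a : Fin (n + 1) → A) : contract n t f a = f (Fin.contractNth t.castSucc (· * ·) a) := by
  induction n with
  | zero => exact t.elim0
  | succ n ih =>
    refine Fin.cases ?_ (fun t => ?_) t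
    · rw [contractNth_castSucc_zero]
      rfl
    · rw [contractNth_castSucc_succ]
      exact ih t (f.curryLeft (a 0)) (Fin.tail a)

/-- Contracting the first two arguments is the product rule for h·(ab) together with
coassociativity; the other contractions follow by currying. -/
theorem diagonalEval_contract {ρ : H →ₐ[k] Module.End k A} (hρ : IsModuleAlgebra ρ) {n : ℕ} (t : Fin n)
    (f : MultilinearMap k (fun _ : Fin n => A) A) (a : Fin (n + 1) → A) :
    diagonalEval ρ (n + 1) a (contract n t f) =
      diagonalEval ρ n (Fin.contractNth t.castSucc (· * ·) a) f := by
  induction n with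
  | zero => exact t.elim0
  | succ n ih =>
    refine Fin.cases ?_ (fun t => ?_) t
    · rw [contractNth_castSucc_zero, diagonalEval_succ, diagonalEval_succ]
      let L := diagonalEval ρ n (Fin.tail (Fin.tail a)) ∘ₗ f.curryLeft
      let Θ : H ⊗[k] (H ⊗[k] H) →ₗ[k] A :=
        (TensorProduct.lift (L ∘ₗ LinearMap.mul' k A ∘ₗ
          TensorProduct.map (orbit ρ (a 0)) (orbit ρ (a 1)))) ∘ₗ
          (TensorProduct.assoc k H H H).symm.toLinearMap
      have h1 (z : H ⊗[k] H) : TensorProduct.lift (diagonalEval ρ (n + 1) (Fin.tail a) ∘ₗ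
          (contract (n + 1) 0 f).curryLeft ∘ₗ orbit ρ (a 0)) z = Θ (comul.lTensor H z) := by
        induction z with
        | zero => simp
        | add y z hy hz => simp only [map_add, hy, hz]
        | tmul p y =>
          rw [LinearMap.lTensor_tmul, TensorProduct.lift.tmul, LinearMap.comp_apply,
            diagonalEval_succ, LinearMap.comp_apply]
          induction comul (R := k) y with
          | zero => simp
          | add x z hx hz => simp only [map_add, TensorProduct.tmul_add, hx, hz]
          | tmul q s =>
            simp only [TensorProduct.lift.tmul, Θ, L, LinearMap.comp_apply, LinearEquiv.coe_coe,
              TensorProduct.assoc_symm_tmul, TensorProduct.map_tmul, LinearMap.mul'_apply]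
            rfl
      have h2 (z : H ⊗[k] H) : TensorProduct.lift (L ∘ₗ orbit ρ (a 0 * a 1)) z =
          Θ (TensorProduct.assoc k H H H (comul.rTensor H z)) := by
        simp only [Θ, LinearMap.comp_apply, LinearEquiv.coe_coe, LinearEquiv.symm_apply_apply]
        induction z with
        | zero => simp
        | add y z hy hz => simp only [map_add, hy, hz]
        | tmul p y =>
          rw [LinearMap.rTensor_tmul, TensorProduct.lift.tmul, TensorProduct.lift.tmul,
            LinearMap.comp_apply, orbit_apply, hρ.act_mul]
          rfl
      ext h
      refine (h1 _).trans ((congrArg Θ (coassoc_apply h).symm).trans (h2 _).symm)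
    · rw [contractNth_castSucc_succ, diagonalEval_succ, diagonalEval_succ]
      congr 1
      ext x y
      exact LinearMap.congr_fun (ih t (f.curryLeft (ρ x (a 0))) (Fin.tail a)) y

/-- The multilinear map `a ↦ a₀ f(a₁, …)`. -/
def leftMul {n : ℕ} (f : MultilinearMap k (fun _ : Fin n => A) A) :
    MultilinearMap k (fun _ : Fin (n + 1) => A) A :=
  LinearMap.uncurryLeft
    { toFun := fun a => (LinearMap.mulLeft k a).compMultilinearMap f
      map_add' := fun a b => by ext; simp [add_mul]
      map_smul' := fun c a => by ext; simp }

theorem diagonalEval_leftMul {n : ℕ} (f : MultilinearMap k (fun _ : Fin n => A) A)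
    (a : Fin (n + 1) → A) : diagonalEval ρ (n + 1) a (leftMul f) =
      convOrbit ρ (a 0) (diagonalEval ρ n (Fin.tail a) f) := by
  rw [diagonalEval_succ]
  unfold convOrbit convAct
  congr 2
  ext x y
  exact LinearMap.congr_fun (diagonalEval_compMultilinearMap ρ f (Fin.tail a)
    (LinearMap.mulLeft k (ρ x (a 0)))) y

/-- The differential of the bar complex, as a multilinear map. -/
def barMultilinear {i : ℕ} (f : MultilinearMap k (fun _ : Fin (i + 1) => A) A) :
    MultilinearMap k (fun _ : Fin (i + 2) => A) A :=
  leftMul f + ∑ t : Fin (i + 1), (-1 : k) ^ ((t : ℕ) + 1) • contract (i + 1) t f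

theorem barMultilinear_apply {i : ℕ} (f : MultilinearMap k (fun _ : Fin (i + 1) => A) A)
    (a : Fin (i + 2) → A) : barMultilinear f a = barDifferential f a := by
  rw [barMultilinear, add_apply, sum_apply]
  refine congrArg₂ _ rfl (Finset.sum_congr rfl fun t _ => ?_)
  rw [smul_apply, contract_apply, Algebra.smul_def, map_pow, map_neg, map_one]

theorem antipodeTwist_sum {n : ℕ} {ι : Type*} (s : Finset ι)
    (f : ι → MultilinearMap k (fun _ : Fin n => A) A) (h : H) (a : Fin n → A) :
    antipodeTwist ρ (∑ i ∈ s, f i) h a = ∑ i ∈ s, antipodeTwist ρ (f i) h a := by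
  obtain ⟨m, c, p, q, hf⟩ := exists_antipodeTwist_eq (A := A) ρ n h
  simp only [hf, sum_apply, map_sum, Finset.smul_sum]
  exact Finset.sum_comm

/-- Each face is compatible separately: left multiplication by the antipode cancellation, the
contractions by the product rule. -/
theorem barMultilinear_twist {ρ : H →ₐ[k] Module.End k A} (hρ : IsModuleAlgebra ρ) {i : ℕ}
    (f : MultilinearMap k (fun _ : Fin (i + 1) => A) A) (h : H) :
    barMultilinear (twist ρ h f) = twist ρ h (barMultilinear f) := by
  ext a
  have h1 : leftMul (twist ρ h f) a = antipodeTwist ρ (leftMul f) h a := by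
    rw [antipodeTwist_eq, diagonalEval_leftMul, convAntipode_convOrbit hρ]
    rfl
  have h2 (t : Fin (i + 1)) : contract (i + 1) t (twist ρ h f) a =
      antipodeTwist ρ (contract (i + 1) t f) h a := by
    rw [contract_apply, twist_apply, antipodeTwist_eq, antipodeTwist_eq, diagonalEval_contract hρ]
  rw [twist_apply, barMultilinear, barMultilinear, antipodeTwist_add, antipodeTwist_sum, add_apply,
    sum_apply, h1]
  refine congrArg₂ _ rfl (Finset.sum_congr rfl fun t _ => ?_)
  rw [smul_apply, h2, antipodeTwist_smul]

end DiagonalEval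

/-! ### An invariant relation has trivial homological determinant. -/

section HomologicalDeterminant

set_option maxSynthPendingDepth 8

open Coalgebra

variable {k : Type*} [Field k] {H : Type*} [Ring H] [HopfAlgebra k H] {A : Type u} [Ring A]
  [Algebra k A]

theorem diagonalEval_one_of_one {ρ : H →ₐ[k] Module.End k A} (hρ : IsModuleAlgebra ρ)
    (f : MultilinearMap k (fun _ : Fin 1 => A) A) (h : H) :
    diagonalEval ρ 1 ![1] f h = counit (R := k) h • f ![1] := by
  refine lift_comul_of_smul_counit
    (φ := LinearMap.toSpanSingleton k A (f ![1]) ∘ₗ counit) (fun x y => ?_) h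
  change counit (R := k) y • f.curryLeft (ρ x 1) ![] = counit (R := k) y • counit (R := k) x • f ![1]
  rw [hρ.act_one, Algebra.algebraMap_eq_smul_one, map_smul]
  rfl

theorem diagonalEval_two_of_one {ρ : H →ₐ[k] Module.End k A} (hρ : IsModuleAlgebra ρ)
    (f : MultilinearMap k (fun _ : Fin 2 => A) A) (b : A) (h : H) :
    diagonalEval ρ 2 ![b, 1] f h = f ![ρ h b, 1] := by
  have := lift_comul_of_smul_counit (B := diagonalEval ρ 1 ![1] ∘ₗ f.curryLeft ∘ₗ orbit ρ b)
    (φ := toBilinear f 1 ∘ₗ orbit ρ b) (fun x y => ?_) h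
  · exact this
  · exact diagonalEval_one_of_one hρ _ _

theorem diagonalEval_three_of_one {ρ : H →ₐ[k] Module.End k A} (hρ : IsModuleAlgebra ρ)
    (f : MultilinearMap k (fun _ : Fin 3 => A) A) (a b : A) (h : H) :
    diagonalEval ρ 3 ![a, b, 1] f h = TensorProduct.lift (toTrilinear f 1)
      (TensorProduct.map (orbit ρ a) (orbit ρ b) (comul h)) := by
  have : diagonalEval ρ 2 ![b, 1] ∘ₗ f.curryLeft ∘ₗ orbit ρ a =
      (toTrilinear f 1).compl₁₂ (orbit ρ a) (orbit ρ b) := by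
    ext x y
    exact diagonalEval_two_of_one hρ _ _ _
  change TensorProduct.lift (diagonalEval ρ 2 ![b, 1] ∘ₗ f.curryLeft ∘ₗ orbit ρ a) (comul h) = _
  rw [this]
  induction comul (R := k) h with
  | zero => simp
  | add x y hx hy => simp only [map_add, hx, hy]
  | tmul x y => simp

/-- If the diagonal evaluations add up to ε(h)c, the second tensor factor collapses and only S(h)
acting on c remains. -/
theorem antipodeTwist_sum_args {n : ℕ} {ι : Type*} [Fintype ι] {ρ : H →ₐ[k] Module.End k A}
    {f : MultilinearMap k (fun _ : Fin n => A) A} {a : ι → Fin n → A} {c : A}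
    (hc : ∀ h, ∑ i, diagonalEval ρ n (a i) f h = counit (R := k) h • c) (h : H) :
    ∑ i, antipodeTwist ρ f h (a i) = ρ (HopfAlgebra.antipode k h) c := by
  have h1 : ∑ i, antipodeTwist ρ f h (a i) =
      TensorProduct.lift ((ρ.toLinearMap ∘ₗ HopfAlgebra.antipode k).compl₂
        (∑ i, diagonalEval ρ n (a i) f)) (comul h) := by
    simp only [antipodeTwist]
    induction comul (R := k) h with
    | zero => simp
    | add x y hx hy => simp only [map_add, Finset.sum_add_distrib, hx, hy]
    | tmul x y => simp
  rw [h1]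
  refine lift_comul_of_smul_counit (φ := orbit ρ c ∘ₗ HopfAlgebra.antipode k) (fun x y => ?_) h
  rw [LinearMap.compl₂_apply, LinearMap.sum_apply, hc, map_smul]
  rfl

theorem barMultilinear_add {i : ℕ} (f g : MultilinearMap k (fun _ : Fin (i + 1) => A) A) :
    barMultilinear (f + g) = barMultilinear f + barMultilinear g := by
  ext a
  rw [add_apply, barMultilinear_apply, barMultilinear_apply, barMultilinear_apply]
  simp only [barDifferential, add_apply, mul_add, Finset.sum_add_distrib]
  abel

theorem barMultilinear_smul {i : ℕ} (c : k) (f : MultilinearMap k (fun _ : Fin (i + 1) => A) A) :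
    barMultilinear (c • f) = c • barMultilinear f := by
  ext a
  rw [smul_apply, barMultilinear_apply, barMultilinear_apply]
  simp only [barDifferential, smul_apply, mul_smul_comm, smul_add, Finset.smul_sum]

variable {𝒜 : ℕ → Submodule k A}

theorem IsLocalCochain.add {i : ℕ} {j : ℤ} {f g : MultilinearMap k (fun _ : Fin (i + 1) => A) A}
    (hf : IsLocalCochain 𝒜 i j f) (hg : IsLocalCochain 𝒜 i j g) : IsLocalCochain 𝒜 i j (f + g) := by
  obtain ⟨⟨N, hN⟩, hNd⟩ := hf
  obtain ⟨⟨M, hM⟩, hMd⟩ := hg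
  refine ⟨⟨max N M, fun s hs a ha => ?_⟩, fun p a ha => add_mem (hNd p a ha) (hMd p a ha)⟩
  rw [add_apply, hN s (le_of_max_le_left hs) a ha, hM s (le_of_max_le_right hs) a ha, add_zero]

theorem IsLocalCochain.smul {i : ℕ} {j : ℤ} {f : MultilinearMap k (fun _ : Fin (i + 1) => A) A}
    (hf : IsLocalCochain 𝒜 i j f) (c : k) : IsLocalCochain 𝒜 i j (c • f) := by
  obtain ⟨⟨N, hN⟩, hNd⟩ := hf
  refine ⟨⟨N, fun s hs a ha => ?_⟩, fun p a ha => Submodule.smul_mem _ _ (hNd p a ha)⟩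
  rw [smul_apply, hN s hs a ha, smul_zero]

variable [GradedAlgebra 𝒜] [Nontrivial A] {ι : Type} [Fintype ι]
  {x w : ι → A}

/-- The homological determinant is trivial if the quadratic relation is invariant. -/
theorem IsKoszulPair.isHomologicalDeterminant_counit (hp : IsKoszulPair 𝒜 x w)
    (h𝒜 : IsStandardGraded 𝒜) (hreg : IsLeftASRegular (k := k) A 𝒜 2)
    {ρ : H →ₐ[k] Module.End k A} (hρ : IsModuleAlgebra ρ)
    (hgr : ∀ n h, ∀ a ∈ 𝒜 n, ρ h a ∈ 𝒜 n)
    (hrel : ∀ h, ∑ i, TensorProduct.map (orbit ρ (w i)) (orbit ρ (x i)) (comul h) =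
      counit (R := k) h • ∑ i, w i ⊗ₜ[k] x i) :
    IsHomologicalDeterminant ρ 𝒜 2 (Bialgebra.counitAlgHom k H) := by
  refine ⟨-2, hp.not_localCohomologyVanishes h𝒜 hreg,
    fun j' hj' => hp.localCohomologyVanishes h𝒜 hj', fun f hf hd h => ?_⟩
  obtain ⟨f₁, g, hf₁, hd₁, hv, hg, hfg⟩ := hp.exists_sub_barDifferential h𝒜 hf hd
  set e : k := counit h with he
  have hbar₁ : barMultilinear f₁ = 0 := by
    ext a
    rw [barMultilinear_apply, hd₁]
    rfl
  have hf' : f = f₁ + barMultilinear g := by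
    ext a
    rw [hfg, add_apply, barMultilinear_apply]
  -- The representative f₁ lives on the trivial module, so F = f₁·h - ε(h)f₁ is a coboundary as soon
  -- as its value on the relation is zero.
  let F := twist ρ h f₁ + (-e) • f₁
  have hF : IsLocalCochain 𝒜 2 (-2) F := (hf₁.twist ρ hgr h).add (hf₁.smul _)
  have hdF : barDifferential F = 0 := by
    have : barMultilinear F = 0 := by
      have h0 : twist ρ h (0 : MultilinearMap k (fun _ : Fin 4 => A) A) = 0 := by
        ext a
        have := antipodeTwist_smul ρ (0 : k) (0 : MultilinearMap k (fun _ : Fin 4 => A) A) h a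
        rw [zero_smul, zero_smul] at this
        exact this
      rw [barMultilinear_add, barMultilinear_smul, barMultilinear_twist hρ, hbar₁, h0, smul_zero,
        add_zero]
    ext a
    rw [← barMultilinear_apply, this]
    rfl
  have hvF : VanishesFrom 𝒜 1 (toTrilinear F) := fun s hs y hy => by
    obtain ⟨m, c, p, q, hq⟩ := exists_antipodeTwist_eq (A := A) ρ 3 h
    have hv' (z a b : A) (hz : z ∈ 𝒜 s) : f₁ ![a, b, z] = 0 :=
      LinearMap.congr_fun₂ (hv s hs z hz) a b
    refine LinearMap.ext₂ fun a b => ?_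
    change antipodeTwist ρ f₁ h ![a, b, y] + (-e) • f₁ ![a, b, y] = 0
    rw [hq, hv' y a b hy, smul_zero, add_zero]
    refine Finset.sum_eq_zero fun i _ => ?_
    rw [eta_three (fun t => ρ (q i t) (![a, b, y] t)),
      hv' (ρ (q i 2) (![a, b, y] 2)) _ _ (hgr s (q i 2) y hy), map_zero, smul_zero]
  set c : A := ∑ i, f₁ ![w i, x i, 1] with hc
  have hsum (y : H) : ∑ i, diagonalEval ρ 3 ![w i, x i, 1] f₁ y = counit (R := k) y • c := by
    simp_rw [diagonalEval_three_of_one hρ]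
    rw [← map_sum, hrel, map_smul, map_sum]
    rfl
  have hc0 : c ∈ 𝒜 0 := by
    refine sum_mem fun i _ => ?_
    have := hf₁.2 ![1, 1, 0] ![w i, x i, 1] (by
      intro t
      fin_cases t
      · exact hp.w_mem i
      · exact hp.x_mem i
      · exact SetLike.GradedOne.one_mem)
    rw [Fin.sum_univ_three] at this
    exact this
  -- The value c of f₁ on the relation has degree 2 - 2 = 0, so it is a scalar. By invariance of the
  -- relation, f₁·h has value S(h)·c = ε(h)c there.
  have hlam : ∑ i, F ![w i, x i, 1] = 0 := by
    have h1 : ∑ i, F ![w i, x i, 1] = ∑ i, antipodeTwist ρ f₁ h ![w i, x i, 1] + (-e) • c := by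
      rw [hc, Finset.smul_sum, ← Finset.sum_add_distrib]
      rfl
    rw [h1, antipodeTwist_sum_args hsum, ← algebraMap_aug_of_mem h𝒜.connected hc0,
      Algebra.algebraMap_eq_smul_one, map_smul, hρ.act_one, HopfAlgebra.counit_antipode, ← he,
      Algebra.algebraMap_eq_smul_one, smul_comm, ← add_smul, add_neg_cancel, zero_smul]
  obtain ⟨g', hg', hFg'⟩ := hp.isLocalCoboundary_of_sum_eq_zero h𝒜 hF hdF hvF hlam
  refine ⟨g' + (twist ρ h g + (-e) • g), hg'.add ((hg.twist ρ hgr h).add (hg.smul _)), ?_⟩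
  ext a
  have h1 : F a = barMultilinear g' a := by rw [hFg', barMultilinear_apply]
  have h2 : antipodeTwist ρ f₁ h a + (-e) • f₁ a = barMultilinear g' a := h1
  rw [← barMultilinear_apply, barMultilinear_add, barMultilinear_add, barMultilinear_smul,
    barMultilinear_twist hρ, add_apply, add_apply, ← h2, hf', antipodeTwist_add, twist_apply,
    Bialgebra.counitAlgHom_apply, ← he, add_apply, smul_apply, smul_add, neg_smul, neg_smul]
  abel

end HomologicalDeterminant

/-! ### The associated graded algebra as a standard graded algebra. -/

section AssociatedGraded

open DirectSum

variable {k : Type*} [Field k] {R : Type u} [Ring R] [Algebra k R] (V : Submodule k R)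

/-- The class of an element of `Vⁿ` in the associated graded algebra. -/
def symbol (n : ℕ) : ↥(V ^ n) →ₗ[k] Gr V := DirectSum.lof k ℕ (GrPiece V) n ∘ₗ GrPiece.mk V n

variable {V}

theorem symbol_mem {n : ℕ} (x : ↥(V ^ n)) : symbol V n x ∈ grGrading V n := ⟨_, rfl⟩

theorem exists_symbol_eq {n : ℕ} {a : Gr V} (ha : a ∈ grGrading V n) : ∃ x, symbol V n x = a := by
  obtain ⟨b, rfl⟩ := ha
  obtain ⟨x, rfl⟩ := GrPiece.exists_mk V n b
  exact ⟨x, rfl⟩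

theorem lof_injective (n : ℕ) : Function.Injective (DirectSum.lof k ℕ (GrPiece V) n) :=
  DirectSum.of_injective n

theorem symbol_eq_zero {n : ℕ} {x : ↥(V ^ n)} : symbol V n x = 0 ↔ (x : R) ∈ prev V n := by
  rw [← GrPiece.mk_eq_zero]
  exact map_eq_zero_iff _ (lof_injective n)

theorem symbol_mul {m n : ℕ} (x : ↥(V ^ m)) (y : ↥(V ^ n)) :
    symbol V m x * symbol V n y = symbol V (m + n) ⟨x * y, mul_mem_pow_add x.2 y.2⟩ :=
  DirectSum.of_mul_of _ _

theorem symbol_zero_one : symbol V 0 ⟨1, one_mem_pow_zero V⟩ = 1 := rfl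

theorem symbol_congr {m n : ℕ} (h : m = n) {x : ↥(V ^ m)} {y : ↥(V ^ n)} (hxy : (x : R) = y) :
    symbol V m x = symbol V n y := by
  subst h
  rw [Subtype.ext hxy]

instance grGrading.gradedMonoid : SetLike.GradedMonoid (grGrading V) where
  one_mem := ⟨_, symbol_zero_one⟩
  mul_mem := by
    rintro m n _ _ ⟨a, rfl⟩ ⟨b, rfl⟩
    exact ⟨_, (DirectSum.of_mul_of a b).symm⟩

/-- The decomposition of an element of the associated graded algebra. -/
def grDecompose (V : Submodule k R) : Gr V →ₗ[k] ⨁ n, grGrading V n :=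
  DirectSum.lmap fun n => (DirectSum.lof k ℕ (GrPiece V) n).rangeRestrict

theorem grDecompose_lof (n : ℕ) (a : GrPiece V n) :
    grDecompose V (DirectSum.lof k ℕ (GrPiece V) n a) =
      DirectSum.lof k ℕ (fun n => grGrading V n) n ⟨DirectSum.lof k ℕ (GrPiece V) n a, a, rfl⟩ :=
  DirectSum.lmap_lof _ _ _

instance grGrading.gradedAlgebra : GradedAlgebra (grGrading V) where
  toDecomposition := DirectSum.Decomposition.ofLinearMap (grGrading V) (grDecompose V)
    (by
      refine DirectSum.linearMap_ext k fun n => LinearMap.ext fun a => ?_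
      rw [LinearMap.comp_apply, LinearMap.comp_apply, grDecompose_lof, DirectSum.coeLinearMap_lof]
      rfl)
    (by
      refine DirectSum.linearMap_ext k fun n => LinearMap.ext fun a => ?_
      obtain ⟨_, b, rfl⟩ := a
      rw [LinearMap.comp_apply, LinearMap.comp_apply, DirectSum.coeLinearMap_lof, grDecompose_lof]
      rfl)

theorem isStandardGraded_grGrading (h0 : grGrading V 0 = 1) :
    IsStandardGraded (grGrading V) where
  connected := h0
  gen n := by
    refine le_antisymm (fun a ha => ?_) ?_
    · obtain ⟨⟨x, hx⟩, rfl⟩ := exists_symbol_eq ha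
      have hx' := hx
      rw [pow_succ] at hx'
      induction hx' using Submodule.mul_induction_on' with
      | mem_mul_mem y hy z hz =>
        have hz' : z ∈ V ^ 1 := by rwa [pow_one]
        have := symbol_mul (V := V) ⟨y, hy⟩ ⟨z, hz'⟩
        rw [← this]
        exact Submodule.mul_mem_mul (symbol_mem _) (symbol_mem _)
      | add y hy z hz h1 h2 =>
        rw [← pow_succ] at hy hz
        have : (⟨y + z, hx⟩ : ↥(V ^ (n + 1))) = ⟨y, hy⟩ + ⟨z, hz⟩ := rfl
        rw [this, map_add]
        exact add_mem (h1 hy (symbol_mem _)) (h2 hz (symbol_mem _))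
    · rw [Submodule.mul_le]
      exact fun a ha b hb => SetLike.GradedMul.mul_mem ha hb

end AssociatedGraded

/-! ### A homogeneous relation makes the action graded. -/

section GradedAction

open DirectSum

variable {k : Type*} [Field k] {R : Type u} [Ring R] [Algebra k R] {V U : Submodule k R}

/-- The class of an element of `V` in the associated graded algebra. -/
def symbolOne (V : Submodule k R) : V →ₗ[k] Gr V :=
  symbol V 1 ∘ₗ (LinearEquiv.ofEq V (V ^ 1) (pow_one V).symm).toLinearMap

theorem symbolOne_eq (x : V) :
    symbolOne V x = symbol V 1 ⟨x, by rw [pow_one]; exact x.2⟩ := rfl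

theorem symbolOne_mem (x : V) : symbolOne V x ∈ grGrading V 1 := symbol_mem _

theorem symbolOne_eq_zero {x : V} : symbolOne V x = 0 ↔ (x : R) ∈ (1 : Submodule k R) := by
  rw [symbolOne_eq, symbol_eq_zero]
  change (x : R) ∈ V ^ 0 ↔ _
  rw [pow_zero]

theorem symbol_mul_symbolOne {n : ℕ} (a : ↥(V ^ n)) (x : V) :
    symbol V n a * symbolOne V x = symbol V (n + 1)
      ⟨a * x, by rw [pow_succ]; exact Submodule.mul_mem_mul a.2 x.2⟩ := by
  rw [symbolOne_eq, symbol_mul]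

theorem exists_symbolOne_eq {a : Gr V} (ha : a ∈ grGrading V 1) : ∃ x, symbolOne V x = a := by
  obtain ⟨⟨x, hx⟩, rfl⟩ := exists_symbol_eq ha
  exact ⟨⟨x, by rwa [pow_one] at hx⟩, rfl⟩

/-- In a product of n factors from k1 + U, every term containing a scalar factor already lies in the
previous filtration step. -/
theorem pow_le_prev_sup (hV : V = 1 ⊔ U) (n : ℕ) : V ^ n ≤ prev V n ⊔ U ^ n := by
  induction n with
  | zero => rw [pow_zero, pow_zero]; exact le_sup_right
  | succ n ih =>
    have h1 : V ^ n * U ≤ prev V (n + 1) ⊔ U ^ (n + 1) := by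
      refine (mul_le_mul' ih le_rfl).trans ?_
      rw [Submodule.sup_mul, ← pow_succ]
      refine sup_le_sup_right ?_ _
      rw [Submodule.mul_le]
      intro a ha b hb
      have hb' : b ∈ V ^ 1 := by
        rw [pow_one, hV]
        exact Submodule.mem_sup_right hb
      exact prev_mul_mem ha hb'
    rw [pow_succ]
    nth_rw 2 [hV]
    rw [Submodule.mul_sup, mul_one]
    exact sup_le le_sup_left h1

theorem le_of_eq_one_sup (hV : V = 1 ⊔ U) : U ≤ V := hV ▸ le_sup_right

theorem one_le_of_eq_one_sup (hV : V = 1 ⊔ U) : (1 : Submodule k R) ≤ V := hV ▸ le_sup_left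

theorem pow_mono_of_eq_one_sup (hV : V = 1 ⊔ U) {m n : ℕ} (h : m ≤ n) : V ^ m ≤ V ^ n :=
  pow_le_pow_right₀ (one_le_of_eq_one_sup hV) h

theorem exists_pow_symbol_eq (hV : V = 1 ⊔ U) {n : ℕ} {a : Gr V} (ha : a ∈ grGrading V n) :
    ∃ (b : R) (hb : b ∈ V ^ n), b ∈ U ^ n ∧ symbol V n ⟨b, hb⟩ = a := by
  obtain ⟨⟨x, hx⟩, rfl⟩ := exists_symbol_eq ha
  obtain ⟨p, hp, b, hb, rfl⟩ := Submodule.mem_sup.1 (pow_le_prev_sup hV n hx)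
  have hb' : b ∈ V ^ n := pow_le_pow_left' (le_of_eq_one_sup hV) n hb
  refine ⟨b, hb', hb, ?_⟩
  rw [← sub_eq_zero, ← map_sub, symbol_eq_zero]
  have : b - (p + b) = -p := by abel
  change b - (p + b) ∈ _
  rw [this]
  exact neg_mem hp

variable {ι : Type} [Fintype ι]

theorem exists_eq_sum_mul_of_mem_pow {x : ι → R} (hx : Submodule.span k (Set.range x) = U) {n : ℕ}
    {z : R} (hz : z ∈ U ^ (n + 1)) :
    ∃ a : ι → R, (∀ i, a i ∈ U ^ n) ∧ z = ∑ i, a i * x i := by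
  rw [pow_succ] at hz
  induction hz using Submodule.mul_induction_on' with
  | mem_mul_mem b hb z hz =>
    rw [← hx, Submodule.mem_span_range_iff_exists_fun] at hz
    obtain ⟨c, rfl⟩ := hz
    refine ⟨fun i => c i • b, fun i => Submodule.smul_mem _ _ hb, ?_⟩
    rw [Finset.mul_sum]
    exact Finset.sum_congr rfl fun i _ => by rw [smul_mul_assoc, mul_smul_comm]
  | add b _ b' _ hb hb' =>
    obtain ⟨c, hc, rfl⟩ := hb
    obtain ⟨c', hc', rfl⟩ := hb'
    exact ⟨c + c', fun i => add_mem (hc i) (hc' i), by simp [add_mul, Finset.sum_add_distrib]⟩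

/-- A homogeneous quadratic relation splits the filtration. -/
theorem eq_zero_of_mem_pow_of_mem_prev (hV : V = 1 ⊔ U) (h1 : (1 : R) ∉ U) {x r : ι → V}
    (hx : Submodule.span k (Set.range fun i => (x i : R)) = U) (hr : ∀ i, (r i : R) ∈ U)
    (hp : IsKoszulPair (grGrading V) (fun i => symbolOne V (x i)) (fun i => symbolOne V (r i)))
    (hrel : ∑ i, (r i : R) * x i = 0) (n : ℕ) {z : R} (hz : z ∈ U ^ n) (hz' : z ∈ prev V n) :
    z = 0 := by
  induction n generalizing z with
  | zero => simpa [prev] using hz'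
  | succ n ih =>
    cases n with
    | zero =>
      change z ∈ V ^ 0 at hz'
      rw [pow_zero] at hz'
      rw [zero_add, pow_one] at hz
      obtain ⟨c, rfl⟩ := Submodule.mem_one.1 hz'
      rcases eq_or_ne c 0 with rfl | hc
      · exact map_zero _
      · refine absurd ?_ h1
        have := Submodule.smul_mem U c⁻¹ hz
        rwa [Algebra.algebraMap_eq_smul_one, smul_smul, inv_mul_cancel₀ hc, one_smul] at this
    | succ n =>
      have hUV := le_of_eq_one_sup hV
      obtain ⟨a, ha, rfl⟩ := exists_eq_sum_mul_of_mem_pow hx hz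
      have ha' (i : ι) : a i ∈ V ^ (n + 1) := pow_le_pow_left' hUV _ (ha i)
      have hsum : ∑ i, symbol V (n + 1) ⟨a i, ha' i⟩ * symbolOne V (x i) = 0 := by
        simp_rw [symbol_mul_symbolOne]
        rw [← map_sum, symbol_eq_zero]
        convert hz'
        simp
      -- The symbols of the aᵢ are a syzygy, hence equal to [b][rᵢ] with b ∈ Uⁿ. Then aᵢ - brᵢ lies
      -- in Uⁿ⁺¹ and in Vⁿ, so it vanishes by induction, and z = b ∑ rᵢxᵢ = 0.
      obtain ⟨b', hb', hab⟩ := hp.exact_homogeneous (m := n) (fun i => symbol_mem _) hsum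
      obtain ⟨b, hb, hbU, rfl⟩ := exists_pow_symbol_eq hV hb'
      have key (i : ι) : a i = b * r i := by
        rw [← sub_eq_zero]
        refine ih ?_ ?_
        · refine sub_mem (ha i) ?_
          rw [pow_succ]
          exact Submodule.mul_mem_mul hbU (hr i)
        · have := hab i
          rw [symbol_mul_symbolOne, ← sub_eq_zero, ← map_sub, symbol_eq_zero] at this
          exact this
      simp_rw [key, mul_assoc]
      rw [← Finset.mul_sum, hrel, mul_zero]

/-- The splitting of the filtration, on the homogeneous components. -/
theorem exists_pieceEquiv (hV : V = 1 ⊔ U)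
    (hsplit : ∀ n, ∀ z ∈ U ^ n, z ∈ prev V n → z = 0) (n : ℕ) :
    ∃ e : GrPiece V n ≃ₗ[k] ↥(U ^ n), ∀ (z : R) (hz : z ∈ U ^ n) (hz' : z ∈ V ^ n),
      e (GrPiece.mk V n ⟨z, hz'⟩) = ⟨z, hz⟩ := by
  have hle : U ^ n ≤ V ^ n := pow_le_pow_left' (le_of_eq_one_sup hV) n
  let t : ↥(U ^ n) →ₗ[k] GrPiece V n := GrPiece.mk V n ∘ₗ Submodule.inclusion hle
  have hinj : Function.Injective t := by
    rw [injective_iff_map_eq_zero]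
    exact fun z hz => Subtype.ext (hsplit n z z.2 (GrPiece.mk_eq_zero.1 hz))
  have hsurj : Function.Surjective t := by
    intro a
    obtain ⟨b, hb, hbU, hba⟩ := exists_pow_symbol_eq hV
      (show DirectSum.lof k ℕ (GrPiece V) n a ∈ grGrading V n from ⟨a, rfl⟩)
    exact ⟨⟨b, hbU⟩, lof_injective n hba⟩
  let e := LinearEquiv.ofBijective t ⟨hinj, hsurj⟩
  exact ⟨e.symm, fun z hz hz' => e.symm_apply_eq.2 rfl⟩

variable {H : Type*} [Ring H] [HopfAlgebra k H]

/-- The splitting identifies Fₙ/Fₙ₋₁ with Uⁿ, compatibly with products and with H, and the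
inclusions Uⁿ ⊆ R assemble to the isomorphism. It is injective because the top component of a kernel
element would lie in the previous filtration step. -/
theorem isGradedAction_of_split {d : ℕ} (hR : IsFilteredASRegular R U d)
    (hsplit : ∀ n, ∀ z ∈ U ^ n, z ∈ prev (1 ⊔ U) n → z = 0)
    {ρ : H →ₐ[k] Module.End k R} (hρ : IsModuleAlgebra ρ) (hst : IsStable ρ U) :
    IsGradedAction hρ d := by
  set V := 1 ⊔ U with hV
  have hstV : IsStable ρ V := by
    intro h x hx
    obtain ⟨a, ha, b, hb, rfl⟩ := Submodule.mem_sup.1 hx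
    rw [map_add]
    refine add_mem (Submodule.mem_sup_left ?_) (Submodule.mem_sup_right (hst h b hb))
    have := hρ.isStable_pow hst 0 h a
    rw [pow_zero] at this
    exact this ha
  choose e he using exists_pieceEquiv hV hsplit
  have hex (n : ℕ) (a : GrPiece V n) : ∃ (z : R) (hz : z ∈ U ^ n) (hz' : z ∈ V ^ n),
      GrPiece.mk V n ⟨z, hz'⟩ = a ∧ e n a = ⟨z, hz⟩ := by
    obtain ⟨⟨z, hz⟩, hza⟩ := (e n).symm.surjective a
    have hz' : z ∈ V ^ n := pow_le_pow_left' (le_of_eq_one_sup hV) n hz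
    have h1 : GrPiece.mk V n ⟨z, hz'⟩ = a := by
      rw [← hza, LinearEquiv.eq_symm_apply, he n z hz hz']
    exact ⟨z, hz, hz', h1, by rw [← h1, he n z hz hz']⟩
  let f : Gr V →ₐ[k] R := DirectSum.toAlgebra k (GrPiece V)
    (fun n => (U ^ n).subtype ∘ₗ (e n).toLinearMap)
    (congrArg Subtype.val (he 0 1 (one_mem_pow_zero U) (one_mem_pow_zero V)))
    (by
      intro i j a b
      obtain ⟨y, hy, hy', rfl, hya⟩ := hex i a
      obtain ⟨z, hz, hz', rfl, hzb⟩ := hex j b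
      simp only [LinearMap.comp_apply, LinearEquiv.coe_coe, hya, hzb]
      exact congrArg Subtype.val (he (i + j) (y * z) (mul_mem_pow_add hy hz)
        (mul_mem_pow_add hy' hz')))
  have hf (n : ℕ) (a : GrPiece V n) : f (DirectSum.lof k ℕ (GrPiece V) n a) = e n a :=
    DirectSum.toModule_lof (φ := fun n => (U ^ n).subtype ∘ₗ (e n).toLinearMap) k n a
  have hinj : Function.Injective f := by
    rw [injective_iff_map_eq_zero]
    intro a ha
    by_contra hne
    classical
    have hsup : (DFinsupp.support a).Nonempty := by
      rwa [Finset.nonempty_iff_ne_empty, Ne, DFinsupp.support_eq_empty]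
    set N := (DFinsupp.support a).max' hsup with hN
    have hNmem : N ∈ DFinsupp.support a := Finset.max'_mem _ _
    have hsum : f a = ∑ n ∈ DFinsupp.support a, (e n (a n) : R) := by
      conv_lhs => rw [← DirectSum.sum_support_of a]
      rw [map_sum]
      exact Finset.sum_congr rfl fun n _ => hf n (a n)
    rw [ha, ← Finset.add_sum_erase _ _ hNmem] at hsum
    have h0 : (e N (a N) : R) = 0 := by
      refine hsplit N _ (e N (a N)).2 ?_
      rw [← neg_eq_iff_add_eq_zero.2 ((add_comm _ _).trans hsum.symm)]
      refine neg_mem (sum_mem fun n hn => ?_)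
      have hlt : n < N := lt_of_le_of_ne (Finset.le_max' _ _ (Finset.mem_of_mem_erase hn))
        (Finset.ne_of_mem_erase hn)
      obtain ⟨M, hM⟩ : ∃ M, N = M + 1 := ⟨N - 1, by omega⟩
      rw [hM]
      exact pow_mono_of_eq_one_sup hV (show n ≤ M by omega)
        (pow_le_pow_left' (le_of_eq_one_sup hV) n (e n (a n)).2)
    refine (DFinsupp.mem_support_iff.1 hNmem) ?_
    exact (e N).map_eq_zero_iff.1 (Subtype.ext h0)
  have hsurj : Function.Surjective f := by
    rw [← AlgHom.range_eq_top, eq_top_iff, ← hR.generates, Algebra.adjoin_le_iff]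
    intro z hz
    have hz1 : z ∈ U ^ 1 := by rwa [pow_one]
    have hz2 : z ∈ V ^ 1 := by
      rw [pow_one]; exact Submodule.mem_sup_right hz
    exact ⟨symbol V 1 ⟨z, hz2⟩, (hf 1 _).trans (congrArg Subtype.val (he 1 z hz1 hz2))⟩
  let E := AlgEquiv.ofBijective f ⟨hinj, hsurj⟩
  have heq (h : H) : f.toLinearMap ∘ₗ grAction hρ hstV h = ρ h ∘ₗ f.toLinearMap := by
    refine DirectSum.linearMap_ext k fun n => LinearMap.ext fun a => ?_
    obtain ⟨z, hz, hz', rfl, hza⟩ := hex n a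
    have h1 := hρ.isStable_pow hst n h z hz
    have h2 := hρ.isStable_pow hstV n h z hz'
    have h3 : grAction hρ hstV h (DirectSum.lof k ℕ (GrPiece V) n (GrPiece.mk V n ⟨z, hz'⟩)) =
        DirectSum.lof k ℕ (GrPiece V) n (GrPiece.mk V n ⟨ρ h z, h2⟩) := grMap_of_mk V _ _ n _
    simp only [LinearMap.comp_apply, AlgHom.toLinearMap_apply, h3, hf, hza, he n _ h1 h2]
  refine ⟨U, hR, hstV, E.symm, fun h r => ?_⟩
  rw [AlgEquiv.symm_apply_eq]
  have := LinearMap.congr_fun (heq h) (E.symm r)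
  refine Eq.trans ?_ this.symm
  exact congrArg (ρ h) (E.apply_symm_apply r).symm

theorem isGradedAction_of_relation (hR : IsFilteredASRegular R U 2) {x r : ι → V}
    (hV : V = 1 ⊔ U)
    (hx : Submodule.span k (Set.range fun i => (x i : R)) = U) (hr : ∀ i, (r i : R) ∈ U)
    (hp : IsKoszulPair (grGrading V) (fun i => symbolOne V (x i)) (fun i => symbolOne V (r i)))
    (hrel : ∑ i, (r i : R) * x i = 0)
    {ρ : H →ₐ[k] Module.End k R} (hρ : IsModuleAlgebra ρ) (hst : IsStable ρ U) :
    IsGradedAction hρ 2 :=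
  isGradedAction_of_split hR (fun n _ hz hz' =>
    eq_zero_of_mem_pow_of_mem_prev hV hR.one_notMem hx hr hp hrel n hz (hV ▸ hz')) hρ hst

end GradedAction

/-! ### Normal forms in k⟨u, v⟩/(vu - uv - v). -/

section ShiftAlgebra

open Polynomial

variable {k : Type*} [Field k] {S : Type*} [Ring S] [Algebra k S] {x y : S} {c : k}

/-- The span of the ordered monomials contains 1 and is stable under left multiplication by both
generators. -/
theorem oreMap_surjective (h : y * x = (x + algebraMap k S c) * y)
    (hgen : Algebra.adjoin k {x, y} = ⊤) : Function.Surjective (oreMap (k := k) x y) := by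
  have hmul (s : S) (q : ℕ →₀ k[X]) : s * oreMap x y q ∈ LinearMap.range (oreMap (k := k) x y) := by
    have hs : s ∈ Algebra.adjoin k {x, y} := hgen ▸ Algebra.mem_top
    induction hs using Algebra.adjoin_induction generalizing q with
    | mem s hs =>
      induction q using Finsupp.induction_linear with
      | zero => rw [map_zero, mul_zero]; exact zero_mem _
      | add p q hp hq => rw [map_add, mul_add]; exact add_mem hp hq
      | single j p =>
        rw [oreMap_single]
        rcases hs with rfl | rfl
        · exact ⟨Finsupp.single j (X * p), by rw [oreMap_single, map_mul, aeval_X, mul_assoc]⟩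
        · exact ⟨Finsupp.single (j + 1) (taylor c p), by
            rw [oreMap_single, ← mul_assoc, mul_aeval_of_mul_eq h, mul_assoc, pow_succ']⟩
    | algebraMap r =>
      rw [← Algebra.smul_def, ← map_smul]
      exact ⟨_, rfl⟩
    | add s t _ _ hs ht => rw [add_mul]; exact add_mem (hs q) (ht q)
    | mul s t _ _ hs ht =>
      obtain ⟨q', hq'⟩ := ht q
      rw [mul_assoc, ← hq']
      exact hs q'
  intro s
  have := hmul s (Finsupp.single 0 1)
  rwa [oreMap_single, pow_zero, map_one, mul_one, mul_one] at this

theorem map_oreMap {T : Type*} [Ring T] [Algebra k T] (φ : S →ₐ[k] T) (q : ℕ →₀ k[X]) :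
    φ (oreMap x y q) = oreMap (φ x) (φ y) q := by
  induction q using Finsupp.induction_linear with
  | zero => simp
  | add p q hp hq => simp only [map_add, hp, hq]
  | single j p => rw [oreMap_single, oreMap_single, map_mul, map_pow, aeval_algHom_apply]

theorem ShiftAlgebra.rel : ShiftAlgebra.gen k 1 * ShiftAlgebra.gen k 0 =
    (ShiftAlgebra.gen k 0 + algebraMap k _ 1) * ShiftAlgebra.gen k 1 := by
  have := RingQuot.mkAlgHom_rel k (ShiftRel.rel (k := k))
  rw [map_sub, map_sub, map_mul, map_mul, map_zero] at this
  rw [map_one, add_mul, one_mul]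
  exact eq_add_of_sub_eq' (sub_eq_zero.1 this)

theorem ShiftAlgebra.adjoin_gen :
    Algebra.adjoin k {ShiftAlgebra.gen k 0, ShiftAlgebra.gen k 1} = ⊤ := by
  have h1 : Algebra.adjoin k (Set.range (FreeAlgebra.ι k : Fin 2 → _)) = ⊤ :=
    FreeAlgebra.adjoin_range_ι k (Fin 2)
  have h2 := congrArg (Subalgebra.map (RingQuot.mkAlgHom k (ShiftRel k))) h1
  rw [AlgHom.map_adjoin, Algebra.map_top,
    (AlgHom.range_eq_top _).2 (RingQuot.mkAlgHom_surjective k (ShiftRel k))] at h2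
  rw [← h2]
  congr 1
  ext z
  constructor
  · rintro (rfl | rfl)
    · exact ⟨_, ⟨0, rfl⟩, rfl⟩
    · exact ⟨_, ⟨1, rfl⟩, rfl⟩
  · rintro ⟨_, ⟨i, rfl⟩, rfl⟩
    fin_cases i
    · exact Or.inl rfl
    · exact Or.inr rfl

theorem IsShiftOre.exists_shiftAlgebra_equiv (h : IsShiftOre x y (1 : k)) :
    ∃ φ : ShiftAlgebra k ≃ₐ[k] S, φ (ShiftAlgebra.gen k 0) = x ∧ φ (ShiftAlgebra.gen k 1) = y := by
  let f : ShiftAlgebra k →ₐ[k] S := RingQuot.liftAlgHom k ⟨FreeAlgebra.lift k ![x, y], by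
    rintro _ _ ⟨⟩
    simp [h.rel, add_mul]⟩
  have hf (i : Fin 2) : f (ShiftAlgebra.gen k i) = ![x, y] i := by
    simp [f, ShiftAlgebra.gen]
  have hore (q : ℕ →₀ k[X]) :
      f (oreMap (ShiftAlgebra.gen k 0) (ShiftAlgebra.gen k 1) q) = oreMap x y q := by
    rw [map_oreMap, hf, hf]
    rfl
  have hinj : Function.Injective f := by
    rw [injective_iff_map_eq_zero]
    intro s hs
    obtain ⟨q, rfl⟩ := oreMap_surjective ShiftAlgebra.rel ShiftAlgebra.adjoin_gen s
    rw [hore] at hs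
    rw [(map_eq_zero_iff _ h.bij.1).1 hs, map_zero]
  have hsurj : Function.Surjective f := by
    intro s
    obtain ⟨q, rfl⟩ := h.bij.2 s
    exact ⟨_, hore q⟩
  exact ⟨AlgEquiv.ofBijective f ⟨hinj, hsurj⟩, hf 0, hf 1⟩

end ShiftAlgebra

/-! ### The basis uⁱvʲ of R. -/

section ShiftBasis

open Polynomial

variable {k : Type*} [Field k] {R : Type u} [Ring R] [Algebra k R] {V U : Submodule k R}

theorem symbolOne_pow_mul_pow (u v : V) (i j : ℕ) :
    ∃ h : (u : R) ^ i * (v : R) ^ j ∈ V ^ (i + j), symbolOne V u ^ i * symbolOne V v ^ j =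
      symbol V (i + j) ⟨(u : R) ^ i * (v : R) ^ j, h⟩ := by
  have hpow (w : V) (n : ℕ) : ∃ h : (w : R) ^ n ∈ V ^ n, symbolOne V w ^ n =
      symbol V n ⟨(w : R) ^ n, h⟩ := by
    induction n with
    | zero => exact ⟨by simpa using one_mem_pow_zero V, by
        rw [pow_zero, ← symbol_zero_one]; exact symbol_congr rfl (by simp)⟩
    | succ n ih =>
      obtain ⟨h, hn⟩ := ih
      refine ⟨Submodule.pow_mem_pow V w.2 (n + 1), ?_⟩
      rw [pow_succ, hn, symbol_mul_symbolOne]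
      exact symbol_congr rfl (pow_succ _ _).symm
  obtain ⟨h1, e1⟩ := hpow u i
  obtain ⟨h2, e2⟩ := hpow v j
  exact ⟨mul_mem_pow_add h1 h2, by rw [e1, e2, symbol_mul]⟩

theorem pow_mul_mem_span_of_commute {A : Type*} [Ring A] [Algebra k A] {a b : A}
    (hab : Commute a b) (n : ℕ) :
    Submodule.span k {a, b} ^ n ≤
      Submodule.span k (Set.range fun j : Fin (n + 1) => a ^ (n - j : ℕ) * b ^ (j : ℕ)) := by
  have hmem {n i j : ℕ} (h : i + j = n) : a ^ i * b ^ j ∈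
      Submodule.span k (Set.range fun j : Fin (n + 1) => a ^ (n - j : ℕ) * b ^ (j : ℕ)) := by
    refine Submodule.subset_span ⟨⟨j, by omega⟩, ?_⟩
    simp only
    congr 2
    omega
  induction n with
  | zero =>
    rw [pow_zero, Submodule.one_le]
    simp
  | succ n ih =>
    rw [pow_succ]
    refine (mul_le_mul' ih le_rfl).trans ?_
    rw [Submodule.span_mul_span, Submodule.span_le]
    rintro _ ⟨_, ⟨j, rfl⟩, z, hz, rfl⟩
    have hj := j.2
    rcases hz with rfl | rfl
    · have : z ^ (n - j : ℕ) * b ^ (j : ℕ) * z = z ^ (n - j + 1 : ℕ) * b ^ (j : ℕ) := by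
        rw [mul_assoc, ← (hab.pow_right (j : ℕ)).eq, ← mul_assoc, ← pow_succ]
      simp only [this]
      exact hmem (by omega)
    · simp only [mul_assoc, ← pow_succ]
      exact hmem (by omega)

/-- If `1, u, v` span `V` and `vu = uv + v`, then `R` has the basis `uⁱ vʲ`. -/
theorem isShiftOre_of_regular (hV : IsASRegular (k := k) (Gr V) (grGrading V) 2) {u v : V}
    (h1 : (1 : Submodule k R) ≤ V) (hspan : V = Submodule.span k {1, (u : R), (v : R)})
    (hgen : Algebra.adjoin k (V : Set R) = ⊤) (hrel : (v : R) * u = u * v + v) :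
    IsShiftOre (u : R) (v : R) (1 : k) := by
  have hrel' : (v : R) * u = (u + algebraMap k R 1) * v := by
    rw [hrel, map_one, add_mul, one_mul]
  have hadj : Algebra.adjoin k {(u : R), (v : R)} = ⊤ := by
    rw [eq_top_iff, ← hgen, Algebra.adjoin_le_iff]
    have : V ≤ Subalgebra.toSubmodule (Algebra.adjoin k {(u : R), (v : R)}) := by
      refine hspan.le.trans (Submodule.span_le.2 ?_)
      rintro z (rfl | rfl | rfl)
      · exact one_mem (Algebra.adjoin k {(u : R), (v : R)})
      · exact Algebra.subset_adjoin (Or.inl rfl)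
      · exact Algebra.subset_adjoin (Or.inr rfl)
    exact this
  have := hV.nontrivial
  have hstd := isStandardGraded_grGrading hV.connected
  have hmono {m n : ℕ} (h : m ≤ n) : V ^ m ≤ V ^ n := pow_le_pow_right₀ h1 h
  set a := symbolOne V u with ha
  set b := symbolOne V v with hb
  -- The commutator vu - uv = v has filtration degree one, so it vanishes in degree two of the
  -- associated graded algebra.
  have hcomm : Commute a b := by
    rw [commute_iff_eq, ha, hb, symbolOne_eq, symbolOne_eq, symbol_mul, symbol_mul,
      ← sub_eq_zero, ← map_sub, symbol_eq_zero]
    change (u : R) * v - v * u ∈ V ^ 1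
    rw [hrel, pow_one, sub_add_cancel_left]
    exact neg_mem v.2
  have h𝒜1 : grGrading V 1 = Submodule.span k {a, b} := by
    refine le_antisymm (fun z hz => ?_) ?_
    · obtain ⟨w, rfl⟩ := exists_symbolOne_eq hz
      obtain ⟨c, z, hz, hw⟩ := Submodule.mem_span_insert.1 (hspan.le w.2)
      obtain ⟨d, e, rfl⟩ := Submodule.mem_span_pair.1 hz
      have : symbolOne V w = d • a + e • b := by
        rw [ha, hb, ← map_smul, ← map_smul, ← map_add, ← sub_eq_zero, ← map_sub, symbolOne_eq_zero]
        refine Submodule.mem_one.2 ⟨c, ?_⟩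
        rw [Algebra.algebraMap_eq_smul_one]
        change _ = (w : R) - (d • (u : R) + e • (v : R))
        rw [hw]
        abel
      rw [this]
      exact Submodule.mem_span_pair.2 ⟨d, e, rfl⟩
    · rw [Submodule.span_le]
      rintro z (rfl | rfl)
      · exact symbolOne_mem u
      · exact symbolOne_mem v
  -- The d + 1 ordered monomials of degree d span a component of dimension d + 1.
  have hli (d : ℕ) : LinearIndependent k
      (fun j : Fin (d + 1) => a ^ (d - j : ℕ) * b ^ (j : ℕ)) := by
    have hmem (j : Fin (d + 1)) : a ^ (d - j : ℕ) * b ^ (j : ℕ) ∈ grGrading V d := by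
      obtain ⟨h, e⟩ := symbolOne_pow_mul_pow u v (d - j : ℕ) (j : ℕ)
      have h2 := symbol_mem (V := V) ⟨_, h⟩
      rw [← e, show d - (j : ℕ) + (j : ℕ) = d by have := j.2; omega] at h2
      exact h2
    let F : Fin (d + 1) → grGrading V d := fun j => ⟨_, hmem j⟩
    have hF : LinearIndependent k F := by
      have := hV.finite d
      refine linearIndependent_of_top_le_span_of_card_eq_finrank ?_ ?_
      · rintro ⟨z, hz⟩ -
        have hz' := hz
        rw [hstd.pow_eq, h𝒜1] at hz'
        have h3 := pow_mul_mem_span_of_commute hcomm d hz'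
        rw [Submodule.mem_span_range_iff_exists_fun] at h3 ⊢
        obtain ⟨c, hc⟩ := h3
        exact ⟨c, Subtype.ext (by simpa [F] using hc)⟩
      · rw [hstd.finrank_eq hV.finite hV.left hV.gkdim, Fintype.card_fin]
    exact hF.map' (grGrading V d).subtype (Submodule.ker_subtype _)
  refine ⟨hrel', ?_, oreMap_surjective hrel' hadj⟩
  rw [injective_iff_map_eq_zero]
  intro q hq
  by_contra hne
  have hsupp : q.support.Nonempty := Finsupp.support_nonempty_iff.2 hne
  -- In a vanishing combination, take the part of largest total degree d. Modulo lower terms it is a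
  -- relation between the degree d monomials in the symbols, and the coefficient at j₀ is a leading
  -- coefficient, hence nonzero.
  obtain ⟨j₀, hj₀, hd⟩ := Finset.exists_mem_eq_sup q.support hsupp (fun j => (q j).natDegree + j)
  set d := q.support.sup (fun j => (q j).natDegree + j) with hdd
  have hle (j : ℕ) (hj : j ∈ q.support) : (q j).natDegree + j ≤ d := Finset.le_sup (f := fun j =>
    (q j).natDegree + j) hj
  have hmonmem (i j : ℕ) : (u : R) ^ i * (v : R) ^ j ∈ V ^ (i + j) :=
    (symbolOne_pow_mul_pow u v i j).1
  have hterm (j : ℕ) (hj : j ∈ q.support) : aeval (u : R) (q j) * (v : R) ^ j -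
      (q j).coeff (d - j) • ((u : R) ^ (d - j) * (v : R) ^ j) ∈ prev V d := by
    have hjd := hle j hj
    rw [aeval_eq_sum_range' (n := d - j + 1) (by omega), Finset.sum_range_succ, add_mul,
      smul_mul_assoc, add_sub_cancel_right, Finset.sum_mul]
    refine sum_mem fun i hi => ?_
    rw [smul_mul_assoc]
    refine Submodule.smul_mem _ _ ?_
    have hi' := Finset.mem_range.1 hi
    obtain ⟨e, he⟩ : ∃ e, d = e + 1 := ⟨d - 1, by omega⟩
    rw [he]
    exact hmono (show i + j ≤ e by omega) (hmonmem i j)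
  have hsum : ∑ j : Fin (d + 1), (q j).coeff (d - j) • ((u : R) ^ (d - j : ℕ) * (v : R) ^ (j : ℕ)) ∈
      prev V d := by
    have e1 : ∑ j : Fin (d + 1), (q j).coeff (d - j) • ((u : R) ^ (d - j : ℕ) * (v : R) ^ (j : ℕ)) =
        ∑ j ∈ q.support, (q j).coeff (d - j) • ((u : R) ^ (d - j : ℕ) * (v : R) ^ (j : ℕ)) := by
      rw [Fin.sum_univ_eq_sum_range
        (fun j => (q j).coeff (d - j) • ((u : R) ^ (d - j : ℕ) * (v : R) ^ (j : ℕ)))]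
      refine (Finset.sum_subset (fun j hj => ?_) fun j _ hj => ?_).symm
      · have := hle j hj
        exact Finset.mem_range.2 (by omega)
      · rw [Finsupp.notMem_support_iff.1 hj, coeff_zero, zero_smul]
    have e2 : oreMap (u : R) (v : R) q = ∑ j ∈ q.support, aeval (u : R) (q j) * (v : R) ^ j := by
      simp [oreMap, Finsupp.sum]
    rw [e1, ← neg_mem_iff, ← zero_sub, ← hq, e2, ← Finset.sum_sub_distrib]
    exact sum_mem hterm
  have hzero : ∑ j : Fin (d + 1), (q j).coeff (d - j) • (a ^ (d - j : ℕ) * b ^ (j : ℕ)) = 0 := by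
    have hm (j : Fin (d + 1)) : (u : R) ^ (d - j : ℕ) * (v : R) ^ (j : ℕ) ∈ V ^ d := by
      have := hmonmem (d - j : ℕ) (j : ℕ)
      rwa [show d - (j : ℕ) + (j : ℕ) = d by have := j.2; omega] at this
    have e (j : Fin (d + 1)) : a ^ (d - j : ℕ) * b ^ (j : ℕ) = symbol V d ⟨_, hm j⟩ := by
      obtain ⟨h, e⟩ := symbolOne_pow_mul_pow u v (d - j : ℕ) (j : ℕ)
      rw [ha, hb, e]
      exact symbol_congr (by have := j.2; omega) rfl
    simp_rw [e, ← map_smul]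
    rw [← map_sum, symbol_eq_zero]
    convert hsum
    simp
  have hcoef := Fintype.linearIndependent_iff.1 (hli d) _ hzero ⟨j₀, by have := hle j₀ hj₀; omega⟩
  simp only [hd, Nat.add_sub_cancel] at hcoef
  rw [coeff_natDegree, leadingCoeff_eq_zero] at hcoef
  exact Finsupp.mem_support_iff.1 hj₀ hcoef

end ShiftBasis

/-! ### Stable complements, weights and the diagonal action on R ⊗ R. -/

section Diagonal

variable {k H R : Type*} [Field k] [Ring H] [HopfAlgebra k H] [Ring R] [Algebra k R]
  {ρ : H →ₐ[k] Module.End k R}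

/-- R is itself a semisimple H-module through ρ; a complement of W in R, intersected with V, is a
complement in V by the modular law. -/
theorem IsStable.exists_compl [IsSemisimpleRing H] {V W : Submodule k R} (hV : IsStable ρ V)
    (hW : IsStable ρ W) (hle : W ≤ V) : ∃ W', IsStable ρ W' ∧ W ⊔ W' = V ∧ Disjoint W W' := by
  let : Module H R := Module.compHom R ρ.toRingHom
  have hsmul (h : H) (x : R) : h • x = ρ h x := rfl
  let W₁ : Submodule H R := { W.toAddSubmonoid with smul_mem' := fun h x hx => hW h x hx }
  obtain ⟨C, hC⟩ := exists_isCompl W₁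
  let C₁ : Submodule k R :=
    { C.toAddSubmonoid with
      smul_mem' := fun c x hx => by
        have h1 : algebraMap k H c • x ∈ C := C.smul_mem _ hx
        rw [hsmul, AlgHom.commutes] at h1
        exact h1 }
  refine ⟨V ⊓ C₁, fun h x hx => ⟨hV h x hx.1, C.smul_mem h hx.2⟩, ?_, ?_⟩
  · refine le_antisymm (sup_le hle inf_le_left) fun x hx => ?_
    have : x ∈ W₁ ⊔ C := by rw [hC.sup_eq_top]; trivial
    obtain ⟨w, hw, c, hc, rfl⟩ := Submodule.mem_sup.1 this
    refine Submodule.add_mem_sup hw ⟨?_, hc⟩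
    have := sub_mem hx (hle (show w ∈ W from hw))
    rwa [add_sub_cancel_left] at this
  · rw [Submodule.disjoint_def]
    intro x hx hx'
    exact (Submodule.disjoint_def.1 hC.disjoint) x hx hx'.2

theorem exists_character {M : Type*} [AddCommGroup M] [Module k M] {τ : H →ₐ[k] Module.End k M}
    {p : M} (hp : p ≠ 0) (h : ∀ h, ∃ c : k, τ h p = c • p) :
    ∃ χ : H →ₐ[k] k, ∀ h, τ h p = χ h • p := by
  choose c hc using h
  have hinj {a b : k} (h : a • p = b • p) : a = b := smul_left_injective k hp h
  refine ⟨AlgHom.ofLinearMap ⟨⟨c, fun g h => hinj ?_⟩, fun r h => hinj ?_⟩ (hinj ?_)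
    fun g h => hinj ?_, hc⟩
  · rw [← hc, map_add, LinearMap.add_apply, hc, hc, add_smul]
  · rw [← hc, map_smul, LinearMap.smul_apply, hc, smul_assoc, RingHom.id_apply]
  · change c 1 • p = _
    rw [← hc, map_one, one_smul]; rfl
  · change c (g * h) • p = (c g * c h) • p
    rw [← hc, map_mul, Module.End.mul_apply, hc, map_smul, hc, smul_smul, mul_comm]

variable (ρ) in
/-- The diagonal action on `R ⊗ R`. -/
def diagonalAction : H →ₐ[k] Module.End k (R ⊗[k] R) :=
  Module.endTensorEndAlgHom.comp
    ((Algebra.TensorProduct.map ρ ρ).comp (Bialgebra.comulAlgHom k H))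

theorem diagonalAction_tmul (h : H) (a b : R) : diagonalAction ρ h (a ⊗ₜ b) =
    TensorProduct.map (orbit ρ a) (orbit ρ b) (Coalgebra.comul h) := by
  change Module.endTensorEndAlgHom (Algebra.TensorProduct.map ρ ρ (Coalgebra.comul h)) _ = _
  induction (Coalgebra.comul h : H ⊗[k] H) with
  | zero => simp
  | tmul x y => simp [Module.endTensorEndAlgHom_apply]
  | add x y hx hy => rw [map_add, map_add, LinearMap.add_apply, hx, hy, map_add]

theorem IsModuleAlgebra.mul_diagonalAction (hρ : IsModuleAlgebra ρ) (h : H) (p : R ⊗[k] R) :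
    LinearMap.mul' k R (diagonalAction ρ h p) = ρ h (LinearMap.mul' k R p) := by
  induction p with
  | zero => simp
  | tmul a b => rw [diagonalAction_tmul, LinearMap.mul'_apply, hρ.act_mul]
  | add x y hx hy => simp only [map_add, hx, hy]

theorem diagonalAction_tmul_of_weight {a b : R} {ψ χ : H →ₐ[k] k} (ha : ∀ h, ρ h a = ψ h • a)
    (hb : ∀ h, ρ h b = χ h • b) (h : H) : diagonalAction ρ h (a ⊗ₜ b) =
      (WithConv.toConv ψ * WithConv.toConv χ).ofConv h • a ⊗ₜ[k] b := by
  rw [diagonalAction_tmul]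
  change _ = (LinearMap.mul' k k (TensorProduct.map ψ.toLinearMap χ.toLinearMap
    (Coalgebra.comul h))) • _
  induction (Coalgebra.comul h : H ⊗[k] H) with
  | zero => simp
  | tmul x y => simp [ha, hb, TensorProduct.smul_tmul', TensorProduct.tmul_smul, smul_smul, mul_comm]
  | add x y hx hy => simp only [map_add, hx, hy, add_smul]

theorem IsModuleAlgebra.act_mul_of_weight (hρ : IsModuleAlgebra ρ) {a b : R} {ψ χ : H →ₐ[k] k}
    (ha : ∀ h, ρ h a = ψ h • a) (hb : ∀ h, ρ h b = χ h • b) (h : H) : ρ h (a * b) =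
      (WithConv.toConv ψ * WithConv.toConv χ).ofConv h • (a * b) := by
  rw [← LinearMap.mul'_apply (R := k), ← hρ.mul_diagonalAction,
    diagonalAction_tmul_of_weight ha hb, map_smul]

/-- Linear combinations `∑ fᵢ ⊗ xᵢ` with coefficients `fᵢ` in a stable subspace that contains the
`xᵢ` are stable under the diagonal action. -/
theorem IsStable.exists_diagonalAction_eq {ι : Type*} [Fintype ι] {U : Submodule k R}
    (hU : IsStable ρ U) {x : ι → R} (hx : Submodule.span k (Set.range x) = U) {r : ι → R}
    (hr : ∀ i, r i ∈ U) (h : H) : ∃ f : ι → R, (∀ i, f i ∈ U) ∧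
      diagonalAction ρ h (∑ i, r i ⊗ₜ x i) = ∑ i, f i ⊗ₜ x i := by
  let T : Submodule k (R ⊗[k] R) :=
    { carrier := {t | ∃ f : ι → R, (∀ i, f i ∈ U) ∧ t = ∑ i, f i ⊗ₜ x i}
      add_mem' := by
        rintro _ _ ⟨f, hf, rfl⟩ ⟨g, hg, rfl⟩
        exact ⟨f + g, fun i => add_mem (hf i) (hg i), by
          simp [TensorProduct.add_tmul, Finset.sum_add_distrib]⟩
      zero_mem' := ⟨0, fun i => zero_mem _, by simp⟩
      smul_mem' := by
        rintro c _ ⟨f, hf, rfl⟩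
        exact ⟨c • f, fun i => U.smul_mem _ (hf i), by
          simp [TensorProduct.smul_tmul', Finset.smul_sum]⟩ }
  have htmul {a b : R} (ha : a ∈ U) (hb : b ∈ U) : a ⊗ₜ b ∈ T := by
    rw [← hx, Submodule.mem_span_range_iff_exists_fun] at hb
    obtain ⟨c, rfl⟩ := hb
    exact ⟨fun i => c i • a, fun i => U.smul_mem _ ha, by
      simp [TensorProduct.tmul_sum, TensorProduct.smul_tmul]⟩
  change diagonalAction ρ h (∑ i, r i ⊗ₜ x i) ∈ T
  rw [map_sum]
  refine sum_mem fun i _ => ?_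
  rw [diagonalAction_tmul]
  have hxi : x i ∈ U := hx ▸ Submodule.subset_span ⟨i, rfl⟩
  induction (Coalgebra.comul h : H ⊗[k] H) with
  | zero => simp
  | tmul y z => simpa using htmul (hU y _ (hr i)) (hU z _ hxi)
  | add y z hy hz => rw [map_add]; exact add_mem hy hz

end Diagonal

/-! ### The relation of the associated graded algebra lifted to U ⊗ U. -/

section FilteredRelation

variable {k : Type*} [Field k] {R : Type u} [Ring R] [Algebra k R] {V U : Submodule k R}

theorem exists_mem_symbolOne_eq (hV : V = 1 ⊔ U) {a : Gr V} (ha : a ∈ grGrading V 1) :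
    ∃ x : V, (x : R) ∈ U ∧ symbolOne V x = a := by
  obtain ⟨x, hx, hxU, rfl⟩ := exists_pow_symbol_eq hV ha
  exact ⟨⟨x, by rwa [pow_one] at hx⟩, by simpa using hxU, rfl⟩

theorem eq_of_symbolOne_eq (h1 : (1 : R) ∉ U) {x y : V} (hx : (x : R) ∈ U) (hy : (y : R) ∈ U)
    (h : symbolOne V x = symbolOne V y) : x = y := by
  rw [← sub_eq_zero, ← map_sub, symbolOne_eq_zero, Submodule.mem_one] at h
  obtain ⟨c, hc⟩ := h
  have hmem : algebraMap k R c ∈ U := hc ▸ sub_mem hx hy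
  rcases eq_or_ne c 0 with rfl | hne
  · rw [map_zero] at hc
    exact Subtype.ext (sub_eq_zero.1 hc.symm)
  · refine absurd ?_ h1
    have := Submodule.smul_mem U c⁻¹ hmem
    rwa [Algebra.algebraMap_eq_smul_one, smul_smul, inv_mul_cancel₀ hne, one_smul] at this

/-- Taking symbols is injective on U because 1 ∉ U, so the Koszul data lift uniquely to U. Products
in R that drop to filtration degree one are syzygies of the symbols, and exactness with multiplier
of degree zero gives uniqueness up to scalars. -/
theorem exists_relation (hV : V = 1 ⊔ U) (h1 : (1 : R) ∉ U)
    (hreg : IsASRegular (k := k) (Gr V) (grGrading V) 2) {ι : Type} [Fintype ι] {x : ι → V}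
    (hli : LinearIndependent k fun i => (x i : R))
    (hx : Submodule.span k (Set.range fun i => (x i : R)) = U) :
    ∃ r : ι → V, (∀ i, (r i : R) ∈ U) ∧
      IsKoszulPair (grGrading V) (fun i => symbolOne V (x i)) (fun i => symbolOne V (r i)) ∧
      Submodule.span k (Set.range fun i => (r i : R)) = U ∧ ∑ i, (r i : R) * x i ∈ V ∧
      ∀ f : ι → R, (∀ i, f i ∈ U) → ∑ i, f i * x i ∈ V → ∃ c : k, ∀ i, f i = c • (r i : R) := by
  have := hreg.nontrivial
  have hxU (i : ι) : (x i : R) ∈ U := hx ▸ Submodule.subset_span ⟨i, rfl⟩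
  have hli' : LinearIndependent k fun i => symbolOne V (x i) := by
    rw [Fintype.linearIndependent_iff]
    intro g hg
    have hU : ((∑ i, g i • x i : V) : R) ∈ U := by
      rw [AddSubmonoidClass.coe_finsetSum]
      exact sum_mem fun i _ => U.smul_mem _ (hxU i)
    have h0 : ∑ i, g i • x i = (0 : V) := by
      refine eq_of_symbolOne_eq h1 hU U.zero_mem ?_
      rw [map_sum, map_zero, ← hg]
      simp
    refine Fintype.linearIndependent_iff.1 hli g ?_
    simpa using congrArg Subtype.val h0
  have hspan : Submodule.span k (Set.range fun i => symbolOne V (x i)) = grGrading V 1 := by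
    refine le_antisymm (Submodule.span_le.2 ?_) fun a ha => ?_
    · rintro _ ⟨i, rfl⟩
      exact symbolOne_mem _
    · obtain ⟨z, hz, rfl⟩ := exists_mem_symbolOne_eq hV ha
      rw [← hx, Submodule.mem_span_range_iff_exists_fun] at hz
      obtain ⟨c, hc⟩ := hz
      have : z = ∑ i, c i • x i := Subtype.ext (by simpa using hc.symm)
      rw [this, map_sum]
      exact sum_mem fun i _ => by
        rw [map_smul]; exact Submodule.smul_mem _ _ (Submodule.subset_span ⟨i, rfl⟩)
  obtain ⟨-, w, hw⟩ := exists_isKoszulPair (isStandardGraded_grGrading hreg.connected) hreg.left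
    (fun i => symbolOne_mem (x i)) hli' hspan
  choose r hrU hr using fun i => exists_mem_symbolOne_eq hV (hw.w_mem i)
  obtain rfl : w = fun i => symbolOne V (r i) := funext fun i => (hr i).symm
  have hmul (f : ι → V) : ∑ i, symbolOne V (f i) * symbolOne V (x i) = 0 ↔
      ∑ i, (f i : R) * x i ∈ V := by
    simp_rw [symbolOne_eq (f _), symbol_mul_symbolOne]
    rw [← map_sum, symbol_eq_zero]
    change _ ∈ V ^ 1 ↔ _
    simp
  have hspan_r : Submodule.span k (Set.range fun i => (r i : R)) = U := by
    refine le_antisymm (Submodule.span_le.2 ?_) fun z hz => ?_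
    · rintro _ ⟨i, rfl⟩
      exact hrU i
    · have hz' := symbolOne_mem (⟨z, le_of_eq_one_sup hV hz⟩ : V)
      rw [← hw.span_w, Submodule.mem_span_range_iff_exists_fun] at hz'
      obtain ⟨c, hc⟩ := hz'
      have hsum : ((∑ i, c i • r i : V) : R) = ∑ i, c i • (r i : R) := by simp
      have : ∑ i, c i • r i = (⟨z, le_of_eq_one_sup hV hz⟩ : V) := by
        refine eq_of_symbolOne_eq h1 ?_ hz ?_
        · rw [hsum]
          exact sum_mem fun i _ => U.smul_mem _ (hrU i)
        · rw [← hc]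
          simp
      rw [Submodule.mem_span_range_iff_exists_fun]
      exact ⟨c, hsum.symm.trans (congrArg Subtype.val this)⟩
  refine ⟨r, hrU, hw, hspan_r, (hmul r).1 hw.rel, fun f hf hfx => ?_⟩
  let g : ι → V := fun i => ⟨f i, le_of_eq_one_sup hV (hf i)⟩
  obtain ⟨b, hb, hgb⟩ := hw.exact_homogeneous (m := 0) (fun i => symbolOne_mem (g i))
    ((hmul g).2 hfx)
  rw [hreg.connected, Submodule.mem_one] at hb
  obtain ⟨c, rfl⟩ := hb
  refine ⟨c, fun i => ?_⟩
  have : g i = c • r i := by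
    refine eq_of_symbolOne_eq h1 (hf i) (U.smul_mem _ (hrU i)) ?_
    rw [hgb i, map_smul, Algebra.smul_def]
  exact congrArg Subtype.val this

variable {H : Type*} [Ring H] [HopfAlgebra k H] {ρ : H →ₐ[k] Module.End k R}

theorem orbit_zero {M : Type*} [AddCommGroup M] [Module k M] (τ : H →ₐ[k] Module.End k M) :
    orbit τ 0 = 0 :=
  LinearMap.ext fun h => map_zero (τ h)

theorem orbit_add {M : Type*} [AddCommGroup M] [Module k M] (τ : H →ₐ[k] Module.End k M)
    (a b : M) : orbit τ (a + b) = orbit τ a + orbit τ b :=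
  LinearMap.ext fun h => map_add (τ h) a b

theorem grAction_symbol (hρ : IsModuleAlgebra ρ) (hst : IsStable ρ V) (h : H) {n : ℕ}
    (x : ↥(V ^ n)) : grAction hρ hst h (symbol V n x) =
      symbol V n ⟨ρ h x, hρ.isStable_pow hst n h x x.2⟩ := grMap_of_mk V _ _ n x

theorem grAction_mem (hρ : IsModuleAlgebra ρ) (hst : IsStable ρ V) (n : ℕ) (h : H) (a : Gr V)
    (ha : a ∈ grGrading V n) : grAction hρ hst h a ∈ grGrading V n := by
  obtain ⟨x, rfl⟩ := exists_symbol_eq ha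
  rw [grAction_symbol]
  exact symbol_mem _

theorem isModuleAlgebra_grAction (hρ : IsModuleAlgebra ρ) (hst : IsStable ρ V) :
    IsModuleAlgebra (grAction hρ hst) where
  act_one h := by
    rw [← symbol_zero_one, grAction_symbol, Algebra.algebraMap_eq_smul_one, ← symbol_zero_one,
      ← map_smul]
    refine symbol_congr rfl ?_
    exact (hρ.act_one h).trans (Algebra.algebraMap_eq_smul_one _)
  act_mul h a b := by
    induction a using DirectSum.induction_on with
    | zero =>
      rw [zero_mul, map_zero, orbit_zero, TensorProduct.map_zero_left, LinearMap.zero_apply, map_zero]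
    | add a a' ha ha' =>
      rw [add_mul, map_add, ha, ha', orbit_add, TensorProduct.map_add_left,
        LinearMap.add_apply, map_add]
    | of m a =>
    induction b using DirectSum.induction_on with
    | zero =>
      rw [mul_zero, map_zero, orbit_zero, TensorProduct.map_zero_right, LinearMap.zero_apply, map_zero]
    | add b b' hb hb' =>
      rw [mul_add, map_add, hb, hb', orbit_add, TensorProduct.map_add_right,
        LinearMap.add_apply, map_add]
    | of n b =>
    obtain ⟨x, rfl⟩ := GrPiece.exists_mk V m a
    obtain ⟨y, rfl⟩ := GrPiece.exists_mk V n b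
    change grAction hρ hst h (symbol V m x * symbol V n y) = LinearMap.mul' k _
      (TensorProduct.map (orbit _ (symbol V m x)) (orbit _ (symbol V n y)) _)
    have key (t : H ⊗[k] H) : ∃ hmem, LinearMap.mul' k _
        (TensorProduct.map (orbit (grAction hρ hst) (symbol V m x))
          (orbit (grAction hρ hst) (symbol V n y)) t) =
        symbol V (m + n) ⟨LinearMap.mul' k _ (TensorProduct.map (orbit ρ (x : R))
          (orbit ρ (y : R)) t), hmem⟩ := by
      induction t with
      | zero => 
        have h0 : LinearMap.mul' k R (TensorProduct.map (orbit ρ (x : R)) (orbit ρ (y : R)) 0) = 0 := by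
          simp
        refine ⟨h0 ▸ zero_mem _, ?_⟩
        rw [map_zero, map_zero, ← map_zero (symbol V (m + n))]
        exact symbol_congr rfl h0.symm
      | tmul g h =>
        refine ⟨mul_mem_pow_add (hρ.isStable_pow hst m g x x.2) (hρ.isStable_pow hst n h y y.2), ?_⟩
        rw [TensorProduct.map_tmul, LinearMap.mul'_apply, orbit_apply, orbit_apply,
          grAction_symbol, grAction_symbol, symbol_mul]
        rfl
      | add s t hs ht =>
        obtain ⟨hs, es⟩ := hs
        obtain ⟨ht, et⟩ := ht
        have hadd := map_add (LinearMap.mul' k R ∘ₗ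
          TensorProduct.map (orbit ρ (x : R)) (orbit ρ (y : R))) s t
        simp only [LinearMap.comp_apply] at hadd
        refine ⟨hadd ▸ add_mem hs ht, ?_⟩
        rw [map_add, map_add, es, et, ← map_add]
        exact symbol_congr rfl hadd.symm
    obtain ⟨hm, e⟩ := key (Coalgebra.comul h)
    rw [e, symbol_mul, grAction_symbol]
    exact symbol_congr rfl (hρ.act_mul h x y)

theorem isHomologicalDeterminant_grAction_counit (hρ : IsModuleAlgebra ρ) (hst : IsStable ρ V)
    (hreg : IsASRegular (k := k) (Gr V) (grGrading V) 2) {ι : Type} [Fintype ι] {x r : ι → V}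
    (hp : IsKoszulPair (grGrading V) (fun i => symbolOne V (x i)) (fun i => symbolOne V (r i)))
    (hrel : ∀ h, diagonalAction ρ h (∑ i, (r i : R) ⊗ₜ (x i : R)) =
      Coalgebra.counit (R := k) h • ∑ i, (r i : R) ⊗ₜ[k] (x i : R)) :
    IsHomologicalDeterminant (grAction hρ hst) (grGrading V) 2 (Bialgebra.counitAlgHom k H) := by
  have := hreg.nontrivial
  refine hp.isHomologicalDeterminant_counit (isStandardGraded_grGrading hreg.connected) hreg.left
    (isModuleAlgebra_grAction hρ hst) (fun n h a ha => grAction_mem hρ hst n h a ha) fun h => ?_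
  -- An arbitrary linear extension to R is used only to carry the invariance of the tensor over to
  -- the associated graded algebra by s ⊗ s.
  obtain ⟨s, hs⟩ := LinearMap.exists_extend (symbolOne V)
  have hs' (z : V) : s z = symbolOne V z := LinearMap.congr_fun hs z
  have horb (z : V) : s ∘ₗ orbit ρ (z : R) = orbit (grAction hρ hst) (symbolOne V z) := by
    refine LinearMap.ext fun h => ?_
    rw [orbit_apply, symbolOne_eq, grAction_symbol]
    exact hs' ⟨ρ h z, hst h z z.2⟩
  have h2 := congrArg (TensorProduct.map s s) (hrel h)
  simp only [map_sum, map_smul, diagonalAction_tmul, TensorProduct.map_tmul, hs'] at h2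
  rw [← h2]
  refine Finset.sum_congr rfl fun i _ => ?_
  rw [← horb, ← horb, TensorProduct.map_comp, LinearMap.comp_apply]

end FilteredRelation

/-! ### The group of characters under convolution. -/

section Characters

variable {k H : Type*} [Field k] [Ring H] [HopfAlgebra k H]

/-- The inverse `χ ∘ S` of the character `χ` with respect to convolution. -/
def characterInv (χ : H →ₐ[k] k) : H →ₐ[k] k :=
  AlgHom.ofLinearMap (χ.toLinearMap ∘ₗ HopfAlgebra.antipode k)
    (by simp [HopfAlgebra.antipode_one])
    (fun a b => by simp [HopfAlgebra.antipode_mul_antidistrib, mul_comm])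

theorem characterInv_apply (χ : H →ₐ[k] k) (h : H) :
    characterInv χ h = χ (HopfAlgebra.antipode k h) := rfl

theorem convMul_character_apply (ψ χ : H →ₐ[k] k) (h : H) :
    (WithConv.toConv ψ * WithConv.toConv χ).ofConv h =
      LinearMap.mul' k k (TensorProduct.map ψ.toLinearMap χ.toLinearMap (Coalgebra.comul h)) := rfl

/-- The characters of a Hopf algebra form a group under convolution. -/
instance characterGroup : Group (WithConv (H →ₐ[k] k)) where
  inv χ := WithConv.toConv (characterInv χ.ofConv)
  inv_mul_cancel χ := by
    refine WithConv.ofConv_injective (AlgHom.ext fun h => ?_)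
    have e : LinearMap.mul' k k ∘ₗ TensorProduct.map (characterInv χ.ofConv).toLinearMap
        χ.ofConv.toLinearMap = χ.ofConv.toLinearMap ∘ₗ LinearMap.mul' k H ∘ₗ
          (HopfAlgebra.antipode k).rTensor H := by
      ext x y
      simp [characterInv_apply]
    refine (convMul_character_apply _ χ.ofConv h).trans ?_
    refine (LinearMap.congr_fun e (Coalgebra.comul h)).trans ?_
    simp only [LinearMap.comp_apply, HopfAlgebra.mul_antipode_rTensor_comul_apply]
    exact χ.ofConv.commutes _

end Characters

/-! ### The weight of the relation. -/

section RelationCharacter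

variable {k : Type*} [Field k] {R : Type u} [Ring R] [Algebra k R] {V U : Submodule k R}

theorem IsFilteredASRegular.of_one_sup_eq {d : ℕ} {U' : Submodule k R}
    (hR : IsFilteredASRegular R U d) (h : 1 ⊔ U' = 1 ⊔ U) (h1 : (1 : R) ∉ U') :
    IsFilteredASRegular R U' d where
  finite := by
    have hone : (1 : Submodule k R).FG := by
      rw [Submodule.one_eq_span]
      exact Submodule.fg_span_singleton 1
    have := (Submodule.fg_iff_finiteDimensional _).1 (hone.sup hR.finite)
    rw [Submodule.fg_iff_finiteDimensional]
    exact Submodule.finiteDimensional_of_le (h ▸ le_sup_right : U' ≤ 1 ⊔ U)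
  one_notMem := h1
  generates := by
    rw [eq_top_iff, ← hR.generates, Algebra.adjoin_le_iff]
    have : U ≤ Subalgebra.toSubmodule (Algebra.adjoin k (U' : Set R)) :=
      (le_sup_right.trans h.ge).trans (sup_le
        (Submodule.one_le.2 (one_mem (Algebra.adjoin k (U' : Set R)))) Algebra.subset_adjoin)
    exact this
  regular := h ▸ hR.regular

theorem exists_tmul_coeff {ι : Type*} [Fintype ι] {x : ι → R} (hli : LinearIndependent k x)
    (i : ι) : ∃ c : R ⊗[k] R →ₗ[k] R, ∀ f : ι → R, c (∑ j, f j ⊗ₜ x j) = f i := by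
  classical
  obtain ⟨g, hg⟩ := LinearMap.exists_leftInverse_of_injective (Fintype.linearCombination k x)
    (LinearMap.ker_eq_bot.2 hli.fintypeLinearCombination_injective)
  refine ⟨(TensorProduct.rid k R).toLinearMap ∘ₗ (LinearMap.proj i ∘ₗ g).lTensor R, fun f => ?_⟩
  have hgx (j : ι) : g (x j) = Pi.single j 1 := by
    have := LinearMap.congr_fun hg (Pi.single j 1)
    rwa [LinearMap.comp_apply, Fintype.linearCombination_apply_single, one_smul] at this
  simp [hgx, Pi.single_apply]

theorem sum_tmul_injective {ι : Type*} [Fintype ι] {x : ι → R} (hli : LinearIndependent k x)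
    {f g : ι → R} (h : ∑ j, f j ⊗ₜ[k] x j = ∑ j, g j ⊗ₜ x j) : f = g := by
  funext i
  obtain ⟨c, hc⟩ := exists_tmul_coeff hli i
  rw [← hc f, h, hc]

theorem exists_sum_tmul_eq {ι κ : Type*} [Fintype ι] [Fintype κ] {x : ι → R} {r y : κ → R}
    (hx : Submodule.span k (Set.range x) = U) (hr : ∀ i, r i ∈ U) (hy : ∀ i, y i ∈ U) :
    ∃ f : ι → R, (∀ i, f i ∈ U) ∧ ∑ i, r i ⊗ₜ[k] y i = ∑ i, f i ⊗ₜ[k] x i := by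
  have h (i : κ) : ∃ c : ι → k, ∑ j, c j • x j = y i := by
    rw [← Submodule.mem_span_range_iff_exists_fun, hx]
    exact hy i
  choose c hc using h
  refine ⟨fun j => ∑ i, c i j • r i, fun j => sum_mem fun i _ => U.smul_mem _ (hr i), ?_⟩
  simp_rw [← hc, TensorProduct.tmul_sum, TensorProduct.sum_tmul]
  rw [Finset.sum_comm]
  simp_rw [TensorProduct.smul_tmul]

theorem finrank_eq_two (hV : V = 1 ⊔ U) (h1 : (1 : R) ∉ U)
    (hreg : IsASRegular (k := k) (Gr V) (grGrading V) 2) : Module.finrank k U = 2 := by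
  have := hreg.nontrivial
  let f : U →ₗ[k] grGrading V 1 := LinearMap.codRestrict _
    (symbolOne V ∘ₗ Submodule.inclusion (le_of_eq_one_sup hV)) fun _ => symbolOne_mem _
  have hf : Function.Bijective f := by
    refine ⟨fun x y h => ?_, fun ⟨a, ha⟩ => ?_⟩
    · have := eq_of_symbolOne_eq h1 (x := Submodule.inclusion (le_of_eq_one_sup hV) x)
        (y := Submodule.inclusion (le_of_eq_one_sup hV) y) x.2 y.2 (congrArg Subtype.val h)
      exact Subtype.ext (congrArg (fun z : V => (z : R)) this)
    · obtain ⟨x, hx, rfl⟩ := exists_mem_symbolOne_eq hV ha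
      exact ⟨⟨x, hx⟩, rfl⟩
  rw [(LinearEquiv.ofBijective f hf).finrank_eq,
    (isStandardGraded_grGrading hreg.connected).finrank_eq hreg.finite hreg.left hreg.gkdim]

variable {H : Type*} [Ring H] [HopfAlgebra k H] {ρ : H →ₐ[k] Module.End k R}

theorem IsModuleAlgebra.isStable_one (hρ : IsModuleAlgebra ρ) : IsStable ρ 1 := by
  intro h x hx
  obtain ⟨c, rfl⟩ := Submodule.mem_one.1 hx
  rw [Algebra.algebraMap_eq_smul_one, map_smul, hρ.act_one]
  exact Submodule.smul_mem _ _ (Submodule.mem_one.2 ⟨_, rfl⟩)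

/-- The quadratic relation spans a one-dimensional submodule of `U ⊗ U`. -/
theorem exists_relation_character (hρ : IsModuleAlgebra ρ)
    (hstV : IsStable ρ V) (hst : IsStable ρ U) {ι : Type} [Fintype ι] [Nonempty ι] {x r : ι → V}
    (hli : LinearIndependent k fun i => (x i : R))
    (hx : Submodule.span k (Set.range fun i => (x i : R)) = U) (hr : ∀ i, (r i : R) ∈ U)
    (hspan : Submodule.span k (Set.range fun i => (r i : R)) = U)
    (hmem : ∑ i, (r i : R) * x i ∈ V)
    (huniq : ∀ f : ι → R, (∀ i, f i ∈ U) → ∑ i, f i * x i ∈ V → ∃ c : k, ∀ i, f i = c • (r i : R)) :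
    ∑ i, (r i : R) ⊗ₜ[k] (x i : R) ≠ 0 ∧
    ∃ χ : H →ₐ[k] k, ∀ h, diagonalAction ρ h (∑ i, (r i : R) ⊗ₜ (x i : R)) =
      χ h • ∑ i, (r i : R) ⊗ₜ[k] (x i : R) := by
  have hne : ∑ i, (r i : R) ⊗ₜ[k] (x i : R) ≠ 0 := by
    intro h0
    have : (fun i => (r i : R)) = 0 := sum_tmul_injective hli (by rw [h0]; simp)
    rw [this] at hspan
    obtain ⟨i⟩ := ‹Nonempty ι›
    refine hli.ne_zero i ?_
    have hxi : (x i : R) ∈ U := hx ▸ Submodule.subset_span ⟨i, rfl⟩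
    rw [← hspan] at hxi
    have hb : Submodule.span k (Set.range (0 : ι → R)) ≤ ⊥ :=
      Submodule.span_le.2 (by rintro _ ⟨_, rfl⟩; rfl)
    exact hb hxi
  refine ⟨hne, exists_character hne fun h => ?_⟩
  obtain ⟨f, hf, he⟩ := hst.exists_diagonalAction_eq hx hr h
  have h2 := congrArg (LinearMap.mul' k R) he
  rw [hρ.mul_diagonalAction] at h2
  simp only [map_sum, LinearMap.mul'_apply] at h2
  -- The product of h·t is h applied to ∑ rᵢxᵢ ∈ V, so it stays in V; uniqueness of the relation
  -- makes h·t a multiple of t.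
  obtain ⟨c, hc⟩ := huniq f hf (by
    rw [← h2, ← map_sum]
    exact hstV h _ hmem)
  refine ⟨c, ?_⟩
  rw [he, Finset.smul_sum]
  exact Finset.sum_congr rfl fun i _ => by rw [hc, TensorProduct.smul_tmul']

/-- Coefficients of the relation in a basis of weight vectors. -/
theorem relation_coeff_eq {u v : R} {ψ χ : H →ₐ[k] k} (hli : LinearIndependent k ![u, v])
    (hu : ∀ h, ρ h u = ψ h • u) (hv : ∀ h, ρ h v = χ h • v)
    (hχ : χ ≠ Bialgebra.counitAlgHom k H) {r : Fin 2 → R}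
    (hspan : Submodule.span k (Set.range r) = Submodule.span k {u, v})
    (hrel : ∀ h, diagonalAction ρ h (∑ i, r i ⊗ₜ ![u, v] i) =
      χ h • ∑ i, r i ⊗ₜ[k] ![u, v] i) :
    ψ = Bialgebra.counitAlgHom k H ∧ ∃ β γ : k, r = ![γ • v, β • u] := by
  have hr (i : Fin 2) : ∃ a b : k, a • u + b • v = r i := by
    rw [← Submodule.mem_span_pair, ← hspan]
    exact Submodule.subset_span ⟨i, rfl⟩
  obtain ⟨α, γ, h0⟩ := hr 0
  obtain ⟨β, κ, h1⟩ := hr 1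
  have hpair := LinearIndependent.pair_iff.1 hli
  let P := WithConv.toConv ψ
  let X := WithConv.toConv χ
  -- With r = (αu + γv, βu + κv), comparison of coefficients in the weight equation shows that a
  -- tensor occurs in the relation only if its weight equals χ.
  have key (h : H) : ((P * P).ofConv h * α = χ h * α ∧ (X * P).ofConv h * γ = χ h * γ) ∧
      (P * X).ofConv h * β = χ h * β ∧ (X * X).ofConv h * κ = χ h * κ := by
    have e : ∑ i, ![((P * P).ofConv h * α) • u + ((X * P).ofConv h * γ) • v,
        ((P * X).ofConv h * β) • u + ((X * X).ofConv h * κ) • v] i ⊗ₜ[k] ![u, v] i =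
        ∑ i, (χ h • r) i ⊗ₜ[k] ![u, v] i := by
      have h2 := hrel h
      simp only [Fin.sum_univ_two, ← h0, ← h1, Matrix.cons_val_zero, Matrix.cons_val_one,
        TensorProduct.add_tmul, map_add, ← TensorProduct.smul_tmul', map_smul,
        diagonalAction_tmul_of_weight hu hu, diagonalAction_tmul_of_weight hv hu,
        diagonalAction_tmul_of_weight hu hv, diagonalAction_tmul_of_weight hv hv] at h2
      simp only [Fin.sum_univ_two, ← h0, ← h1, Matrix.cons_val_zero, Matrix.cons_val_one,
        TensorProduct.add_tmul, Pi.smul_apply, smul_add, ← TensorProduct.smul_tmul', mul_smul]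
      simp only [smul_add] at h2
      rw [← h2]
      simp only [smul_comm α, smul_comm β, smul_comm γ, smul_comm κ]
      rfl
    have e2 := sum_tmul_injective hli e
    have e3 := congrFun e2 0
    have e4 := congrFun e2 1
    simp only [Matrix.cons_val_zero, Matrix.cons_val_one, Pi.smul_apply, ← h0, ← h1] at e3 e4
    have split {a b c d : k} (hs : a • u + b • v = χ h • (c • u + d • v)) :
        a = χ h * c ∧ b = χ h * d := by
      have := hpair (a - χ h * c) (b - χ h * d) (by
        rw [sub_smul, sub_smul, mul_smul, mul_smul, sub_add_sub_comm, hs, ← smul_add, sub_self])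
      exact ⟨sub_eq_zero.1 this.1, sub_eq_zero.1 this.2⟩
    exact ⟨split e3, split e4⟩
  have hcancel {A : WithConv (H →ₐ[k] k)} {c : k} (hA : A ≠ X)
      (h : ∀ h, A.ofConv h * c = χ h * c) : c = 0 := by
    by_contra hc
    exact hA (congrArg WithConv.toConv (AlgHom.ext fun x => mul_right_cancel₀ hc (h x)))
  have hX1 : X ≠ 1 := fun h => hχ (congrArg WithConv.ofConv h)
  have hκ : κ = 0 := hcancel (A := X * X) (fun h => hX1 (mul_eq_left.1 h)) fun h => (key h).2.2
  have hv0 : v ∈ Submodule.span k (Set.range r) := by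
    rw [hspan]; exact Submodule.subset_span (Or.inr rfl)
  -- Otherwise neither χψ nor ψχ equals χ; then β = γ = κ = 0 and the rᵢ span at most ku, which does
  -- not contain v.
  have hψ : P = 1 := by
    by_contra hP
    have hγ : γ = 0 := hcancel (A := X * P) (fun h => hP (mul_eq_left.1 h)) fun h => (key h).1.2
    have hβ : β = 0 := hcancel (A := P * X) (fun h => hP (mul_eq_right.1 h)) fun h => (key h).2.1
    have hle : Submodule.span k (Set.range r) ≤ Submodule.span k {u} := by
      rw [Submodule.span_le]
      rintro _ ⟨i, rfl⟩
      fin_cases i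
      · simp only [Fin.zero_eta, ← h0, hγ, zero_smul, add_zero]
        exact Submodule.smul_mem _ _ (Submodule.mem_span_singleton_self u)
      · simp only [Fin.mk_one, ← h1, hβ, hκ, zero_smul, add_zero]
        exact zero_mem _
    obtain ⟨c, hc⟩ := Submodule.mem_span_singleton.1 (hle hv0)
    have := hpair c (-1) (by rw [hc, neg_smul, one_smul, add_neg_cancel])
    simp at this
  have hα : α = 0 := by
    refine hcancel (A := P * P) (fun h => hX1 ?_) fun h => (key h).1.1
    rw [← h, hψ, mul_one]
  refine ⟨congrArg WithConv.ofConv hψ, β, γ, ?_⟩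
  funext i
  fin_cases i
  · simp [← h0, hα]
  · simp [← h1, hκ]

end RelationCharacter

/-! ### The basis u, v with vu = uv + v. -/

section WeightBasis

variable {k : Type*} [Field k] {R : Type u} [Ring R] [Algebra k R] {V U : Submodule k R}
variable {H : Type*} [Ring H] [HopfAlgebra k H] {ρ : H →ₐ[k] Module.End k R}

/-- If the relation is homogeneous of weight zero in `u`, then a shift of `u` makes it
homogeneous or brings it to the form `vu - uv = v`. -/
theorem exists_shift_relation (hρ : IsModuleAlgebra ρ)
    (hR : IsFilteredASRegular R U 2) (hV : V = 1 ⊔ U) (hgraded : ¬ IsGradedAction hρ 2)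
    {χ : H →ₐ[k] k} {u v : V} (hspan : Submodule.span k {(u : R), (v : R)} = U)
    (hu : ∀ h, ρ h u = Coalgebra.counit (R := k) h • (u : R)) (hv : ∀ h, ρ h v = χ h • (v : R))
    {β γ s : k} (hs : s ≠ 0)
    (hp : IsKoszulPair (grGrading V) (fun i => symbolOne V (![u, v] i))
      (fun i => symbolOne V (![γ • v, β • u] i)))
    (hrel : γ • ((v : R) * u) + β • ((u : R) * v) = s • (v : R)) : γ = -β ∧ β ≠ 0 := by
  have hvU : (v : R) ∈ U := hspan ▸ Submodule.subset_span (Or.inr rfl)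
  have hne : (u : R) ∉ Submodule.span k {1, (v : R)} := by
    intro hmem
    obtain ⟨a, b, hab⟩ := Submodule.mem_span_pair.1 hmem
    have h0 : symbolOne V (u - b • v) = 0 := by
      rw [symbolOne_eq_zero, Submodule.mem_one]
      refine ⟨a, ?_⟩
      rw [Algebra.algebraMap_eq_smul_one]
      exact eq_sub_of_add_eq hab
    have hli := hp.linearIndependent
    rw [show (fun i => symbolOne V (![u, v] i)) = ![symbolOne V u, symbolOne V v] by
      funext i; fin_cases i <;> rfl, LinearIndependent.pair_iff] at hli
    have := (hli 1 (-b) (by rw [← h0, map_sub, map_smul, one_smul, neg_smul, sub_eq_add_neg])).1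
    exact one_ne_zero this
  have hsum : γ + β = 0 := by
    by_contra hsum
    refine hgraded ?_
    -- Replacing u by u - t changes the left side of the relation by -t(γ + β)v, so this t makes the
    -- relation homogeneous. The symbols, and k1 + U, are unchanged, and u - t is still fixed by H.
    set t := s / (γ + β) with ht
    have hst : t * (γ + β) = s := div_mul_cancel₀ _ hsum
    have h1V : (1 : R) ∈ V := Submodule.one_le.1 (one_le_of_eq_one_sup hV)
    let u' : V := u - t • ⟨1, h1V⟩
    have hu' : (u' : R) = u - t • 1 := rfl
    have hsymb : symbolOne V u' = symbolOne V u := by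
      have h0 : symbolOne V ⟨1, h1V⟩ = 0 := symbolOne_eq_zero.2 (Submodule.one_le.1 le_rfl)
      rw [map_sub, map_smul, h0, smul_zero, sub_zero]
    set U' := Submodule.span k {(u' : R), (v : R)} with hU'
    have hVU' : V = 1 ⊔ U' := by
      have h1 : (1 : R) ∈ (1 : Submodule k R) ⊔ U' :=
        Submodule.mem_sup_left (Submodule.one_le.1 le_rfl)
      refine le_antisymm ?_ (sup_le (one_le_of_eq_one_sup hV) (Submodule.span_le.2 ?_))
      · refine hV.le.trans (sup_le le_sup_left (hspan ▸ Submodule.span_le.2 ?_))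
        rintro z (rfl | rfl)
        · have e : (u : R) = t • 1 + u' := by rw [hu']; abel
          rw [SetLike.mem_coe, e]
          exact add_mem (Submodule.smul_mem _ _ h1)
            (Submodule.mem_sup_right (Submodule.subset_span (Or.inl rfl)))
        · exact Submodule.mem_sup_right (Submodule.subset_span (Or.inr rfl))
      · rintro z (rfl | rfl)
        · exact u'.2
        · exact v.2
    have h1U' : (1 : R) ∉ U' := by
      intro hmem
      obtain ⟨a, b, hab⟩ := Submodule.mem_span_pair.1 hmem
      rcases eq_or_ne a 0 with rfl | ha
      · rw [zero_smul, zero_add] at hab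
        exact hR.one_notMem (hab ▸ U.smul_mem _ hvU)
      · refine hne (Submodule.mem_span_pair.2 ⟨t + a⁻¹, -(a⁻¹ * b), ?_⟩)
        have : a⁻¹ • (1 : R) = u' + (a⁻¹ * b) • (v : R) := by
          rw [← hab, smul_add, smul_smul, smul_smul, inv_mul_cancel₀ ha, one_smul]
        rw [add_smul, this, hu', neg_smul]
        abel
    refine isGradedAction_of_relation (hR.of_one_sup_eq (hVU'.symm.trans hV) h1U')
      (x := ![u', v]) (r := ![γ • v, β • u']) hVU' ?_ ?_ ?_ ?_ hρ ?_
    · congr 1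
      ext z
      constructor
      · rintro ⟨i, rfl⟩
        fin_cases i
        · exact Or.inl rfl
        · exact Or.inr rfl
      · rintro (rfl | rfl)
        · exact ⟨0, rfl⟩
        · exact ⟨1, rfl⟩
    · intro i
      fin_cases i
      · exact Submodule.smul_mem _ _ (Submodule.subset_span (Or.inr rfl))
      · exact Submodule.smul_mem _ _ (Submodule.subset_span (Or.inl rfl))
    · convert hp using 2 with i i
      · fin_cases i
        · exact hsymb
        · rfl
      · fin_cases i
        · rfl
        · change symbolOne V (β • u') = symbolOne V (β • u)
          rw [map_smul, map_smul, hsymb]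
    · rw [Fin.sum_univ_two]
      change γ • (v : R) * (u - t • 1) + β • ((u : R) - t • 1) * v = 0
      simp only [smul_mul_assoc, mul_sub, sub_mul, mul_smul_comm, mul_one, one_mul, smul_sub]
      rw [sub_add_sub_comm, hrel, ← hst, smul_smul, smul_smul, ← add_smul, ← sub_smul]
      rw [show t * (γ + β) - (t * γ + β * t) = 0 by ring, zero_smul]
    · intro h z hz
      obtain ⟨a, b, rfl⟩ := Submodule.mem_span_pair.1 hz
      have : ρ h (u' : R) = Coalgebra.counit (R := k) h • (u' : R) := by
        rw [hu', map_sub, map_smul, hu, hρ.act_one, Algebra.algebraMap_eq_smul_one, smul_sub,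
          smul_comm t]
      rw [map_add, map_smul, map_smul, this, hv]
      exact add_mem
        (Submodule.smul_mem _ _ (Submodule.smul_mem _ _ (Submodule.subset_span (Or.inl rfl))))
        (Submodule.smul_mem _ _ (Submodule.smul_mem _ _ (Submodule.subset_span (Or.inr rfl))))
  refine ⟨eq_neg_of_add_eq_zero_left hsum, ?_⟩
  rintro rfl
  rw [add_zero] at hsum
  rw [hsum, zero_smul, zero_smul, zero_add] at hrel
  have hv0 : (v : R) = 0 := (smul_eq_zero.1 hrel.symm).resolve_left hs
  refine hp.linearIndependent.ne_zero 1 ?_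
  change symbolOne V v = 0
  rw [show v = 0 from Subtype.ext hv0, map_zero]

/-- v is δ = ∑ rᵢxᵢ, the element of V by which the relation fails to be homogeneous, and u spans an
H-stable complement of kv in U, rescaled at the end. Nontriviality of the homological determinant
enters only through χ ≠ ε. Non-gradedness gives first δ ≠ 0, later γ = -β. -/
theorem exists_weight_basis [IsSemisimpleRing H] (hρ : IsModuleAlgebra ρ)
    (hR : IsFilteredASRegular R U 2) (hV : V = 1 ⊔ U) (hstV : IsStable ρ V) (hst : IsStable ρ U)
    (hreg : IsASRegular (k := k) (Gr V) (grGrading V) 2) (hgraded : ¬ IsGradedAction hρ 2)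
    (hdet : ¬ IsHomologicalDeterminant (grAction hρ hstV) (grGrading V) 2
      (Bialgebra.counitAlgHom k H)) :
    ∃ (χ : H →ₐ[k] k) (u v : V), χ ≠ Bialgebra.counitAlgHom k H ∧
      (∀ h, ρ h u = Coalgebra.counit (R := k) h • (u : R)) ∧ (∀ h, ρ h v = χ h • (v : R)) ∧
      V = Submodule.span k {1, (u : R), (v : R)} ∧ (v : R) * u = u * v + v := by
  have h1 := hR.one_notMem
  have hUV := le_of_eq_one_sup hV
  have hfin2 := finrank_eq_two hV h1 hreg
  have : FiniteDimensional k U := Module.finite_of_finrank_eq_succ hfin2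
  let b : Module.Basis (Fin 2) k U := Module.finBasisOfFinrankEq k U hfin2
  let x : Fin 2 → V := fun i => ⟨b i, hUV (b i).2⟩
  have hxli : LinearIndependent k fun i => (x i : R) :=
    b.linearIndependent.map' U.subtype (Submodule.ker_subtype _)
  have hxspan : Submodule.span k (Set.range fun i => (x i : R)) = U := by
    have := congrArg (Submodule.map U.subtype) b.span_eq
    rwa [Submodule.map_span, ← Set.range_comp, Submodule.map_top, Submodule.range_subtype] at this
  have hxU (i : Fin 2) : (x i : R) ∈ U := (b i).2
  obtain ⟨r, hrU, hp, hrspan, hrmem, hruniq⟩ := exists_relation hV h1 hreg hxli hxspan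
  obtain ⟨hp0, χ, hχ⟩ := exists_relation_character hρ hstV hst hxli hxspan hrU hrspan hrmem hruniq
  have hχε : χ ≠ Bialgebra.counitAlgHom k H := by
    rintro rfl
    exact hdet (isHomologicalDeterminant_grAction_counit hρ hstV hreg hp hχ)
  set δ := ∑ i, (r i : R) * x i with hδ
  have hδχ (h : H) : ρ h δ = χ h • δ := by
    have := congrArg (LinearMap.mul' k R) (hχ h)
    rw [hρ.mul_diagonalAction, map_smul] at this
    simpa [hδ] using this
  -- The scalar part of δ has weight ε while δ has weight χ; an h with χ(h) ≠ ε(h) separates them,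
  -- using that U is stable and does not contain 1.
  have hδU : δ ∈ U := by
    obtain ⟨c, hc, ℓ, hℓ, hcℓ⟩ := Submodule.mem_sup.1 (hV.le hrmem)
    obtain ⟨c, rfl⟩ := Submodule.mem_one.1 hc
    obtain ⟨h, hh⟩ : ∃ h, χ h ≠ Coalgebra.counit (R := k) h := by
      by_contra! hall
      exact hχε (AlgHom.ext hall)
    have hmem : (c * (χ h - Coalgebra.counit (R := k) h)) • (1 : R) ∈ U := by
      have e := hδχ h
      rw [← hcℓ, map_add, Algebra.algebraMap_eq_smul_one, map_smul, hρ.act_one,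
        Algebra.algebraMap_eq_smul_one, smul_add, smul_smul, smul_smul] at e
      have e2 : (c * (χ h - Coalgebra.counit (R := k) h)) • (1 : R) = ρ h ℓ - χ h • ℓ := by
        rw [mul_sub, sub_smul, mul_comm c (χ h), sub_eq_sub_iff_add_eq_add, ← e, add_comm]
      rw [e2]
      exact sub_mem (hst h ℓ hℓ) (U.smul_mem _ hℓ)
    have hc0 : c = 0 := by
      by_contra hc
      refine h1 ?_
      have hne := mul_ne_zero hc (sub_ne_zero.2 hh)
      have := U.smul_mem (c * (χ h - Coalgebra.counit (R := k) h))⁻¹ hmem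
      rwa [smul_smul, inv_mul_cancel₀ hne, one_smul] at this
    rw [← hcℓ, hc0, map_zero, zero_add]
    exact hℓ
  have hδ0 : δ ≠ 0 := fun h0 =>
    hgraded (isGradedAction_of_relation hR hV hxspan hrU hp h0 hρ hst)
  have hlst : IsStable ρ (Submodule.span k {δ}) := by
    intro h z hz
    obtain ⟨a, rfl⟩ := Submodule.mem_span_singleton.1 hz
    rw [map_smul, hδχ]
    exact Submodule.smul_mem _ _ (Submodule.smul_mem _ _ (Submodule.mem_span_singleton_self δ))
  obtain ⟨W, hW, hsup, hdisj⟩ := hst.exists_compl hlst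
    ((Submodule.span_singleton_le_iff_mem δ U).2 hδU)
  have hWU : W ≤ U := hsup ▸ le_sup_right
  have hWfin : Module.finrank k W = 1 := by
    have : FiniteDimensional k W := Submodule.finiteDimensional_of_le hWU
    have e := Submodule.finrank_sup_add_finrank_inf_eq (Submodule.span k {δ}) W
    rw [hsup, hdisj.eq_bot, finrank_bot, finrank_span_singleton hδ0, hfin2] at e
    omega
  obtain ⟨⟨u, huW⟩, hu0, hu⟩ := finrank_eq_one_iff'.1 hWfin
  have hu0' : u ≠ 0 := fun h => hu0 (Subtype.ext h)
  have hWspan (z : R) (hz : z ∈ W) : ∃ c : k, c • u = z := by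
    obtain ⟨c, hc⟩ := hu ⟨z, hz⟩
    exact ⟨c, congrArg Subtype.val hc⟩
  obtain ⟨ψ, hψ⟩ := exists_character (τ := ρ) hu0' fun h => by
    obtain ⟨c, hc⟩ := hWspan _ (hW h u huW)
    exact ⟨c, hc.symm⟩
  have hspan : Submodule.span k {u, δ} = U := by
    rw [Submodule.span_insert, sup_comm, ← hsup]
    congr 1
    refine le_antisymm ((Submodule.span_singleton_le_iff_mem u W).2 huW) fun z hz => ?_
    exact Submodule.mem_span_singleton.2 (hWspan z hz)
  have hli : LinearIndependent k ![u, δ] := by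
    rw [LinearIndependent.pair_iff' hu0']
    intro a ha
    exact hδ0 (Submodule.disjoint_def.1 hdisj δ (Submodule.mem_span_singleton_self δ)
      (ha ▸ W.smul_mem a huW))
  let u₁ : V := ⟨u, hUV (hWU huW)⟩
  let v₁ : V := ⟨δ, hrmem⟩
  have hcoe : (fun i => ((![u₁, v₁] : Fin 2 → V) i : R)) = ![u, δ] := by
    funext i; fin_cases i <;> rfl
  have hrange : Set.range ![u, δ] = {u, δ} := by
    simp [Set.pair_comm]
  obtain ⟨q, hqU, hp', hqspan, hqmem, hquniq⟩ := exists_relation hV h1 hreg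
    (x := ![u₁, v₁]) (by rwa [hcoe]) (by rw [hcoe, hrange, hspan])
  -- The old relation tensor, rewritten in the basis (u, δ), is a nonzero multiple c of the relation
  -- for that basis. Its product in R is still δ, which gives the constant c⁻¹ in the final
  -- relation.
  obtain ⟨f, hfU, hf⟩ := exists_sum_tmul_eq (x := ![u, δ]) (by rw [hrange, hspan]) hrU hxU
  have hfmul : ∑ i, f i * ![u, δ] i = δ := by
    have := congrArg (LinearMap.mul' k R) hf
    simp only [map_sum, LinearMap.mul'_apply] at this
    rw [← this]
  obtain ⟨c, hc⟩ := hquniq f hfU (by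
    have e := hfmul
    rw [← hcoe] at e
    rw [e]
    exact hrmem)
  have hpq : ∑ i, (r i : R) ⊗ₜ[k] (x i : R) = c • ∑ i, (q i : R) ⊗ₜ ![u, δ] i := by
    rw [hf, Finset.smul_sum]
    exact Finset.sum_congr rfl fun i _ => by rw [hc, TensorProduct.smul_tmul']
  have hc0 : c ≠ 0 := by
    rintro rfl
    exact hp0 (by rw [hpq, zero_smul])
  have hqχ (h : H) : diagonalAction ρ h (∑ i, (q i : R) ⊗ₜ ![u, δ] i) =
      χ h • ∑ i, (q i : R) ⊗ₜ[k] ![u, δ] i := by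
    have := hχ h
    rw [hpq, map_smul, smul_comm] at this
    exact smul_right_injective _ hc0 this
  obtain ⟨hψε, β, γ, hq⟩ := relation_coeff_eq hli hψ hδχ hχε (hqspan.trans hspan.symm) hqχ
  have hq' : q = ![γ • v₁, β • u₁] := by
    funext i
    refine Subtype.ext ((congrFun hq i).trans ?_)
    fin_cases i <;> rfl
  subst hq'
  have huε (h : H) : ρ h u = Coalgebra.counit (R := k) h • u := by
    rw [hψ, hψε]; rfl
  have hrel : γ • (δ * u) + β • (u * δ) = c⁻¹ • δ := by
    have e := hfmul
    simp only [Fin.sum_univ_two, hc] at e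
    change (c • γ • δ) * u + (c • β • u) * δ = δ at e
    simp only [smul_mul_assoc] at e
    rw [← smul_add] at e
    rw [eq_inv_smul_iff₀ hc0, e]
  obtain ⟨hγ, hβ⟩ := exists_shift_relation hρ hR hV hgraded (u := u₁) (v := v₁) hspan huε hδχ
    (inv_ne_zero hc0) hp' hrel
  have hcβ : c * γ ≠ 0 := mul_ne_zero hc0 (hγ ▸ neg_ne_zero.2 hβ)
  refine ⟨χ, (c * γ) • u₁, v₁, hχε, fun h => ?_, hδχ, ?_, ?_⟩
  · change ρ h ((c * γ) • u) = _ • (c * γ) • u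
    rw [map_smul, huε, smul_comm]
  · change V = Submodule.span k {1, (c * γ) • u, δ}
    rw [hV, Submodule.span_insert, ← Submodule.one_eq_span, ← hspan, Submodule.span_insert,
      Submodule.span_insert, Submodule.span_singleton_smul_eq (IsUnit.mk0 _ hcβ)]
  · change δ * ((c * γ) • u) = ((c * γ) • u) * δ + δ
    have e := congrArg (c • ·) hrel
    simp only [smul_add, smul_smul, mul_inv_cancel₀ hc0, one_smul] at e
    rw [show c * β = -(c * γ) by rw [hγ]; ring, neg_smul, ← sub_eq_add_neg] at e
    rw [mul_smul_comm, smul_mul_assoc]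
    exact sub_eq_iff_eq_add'.1 e

theorem exists_weights [IsSemisimpleRing H] (hR : IsFilteredASRegular R U 2)
    (hρ : IsModuleAlgebra ρ) (hU : IsStable ρ (1 ⊔ U)) (hgraded : ¬ IsGradedAction hρ 2)
    (hdet : ¬ IsHomologicalDeterminant (grAction hρ hU) (grGrading (1 ⊔ U)) 2
      (Bialgebra.counitAlgHom k H)) :
    ∃ (χ : H →ₐ[k] k) (u v : R), χ ≠ Bialgebra.counitAlgHom k H ∧
      (∀ h, ρ h u = Coalgebra.counit (R := k) h • u) ∧ (∀ h, ρ h v = χ h • v) ∧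
      1 ⊔ U = Submodule.span k {1, u, v} ∧ IsShiftOre u v (1 : k) := by
  obtain ⟨U', hst, hsup, hdisj⟩ := hU.exists_compl hρ.isStable_one le_sup_left
  have h1U' : (1 : R) ∉ U' := fun h => by
    have h0 := Submodule.disjoint_def.1 hdisj 1 (Submodule.one_le.1 le_rfl) h
    exact hR.one_notMem (h0 ▸ zero_mem _)
  obtain ⟨χ, u, v, hχ, hu, hv, hspan, hrel⟩ := exists_weight_basis hρ
    (hR.of_one_sup_eq hsup h1U') hsup.symm hU hst hR.regular hgraded hdet
  refine ⟨χ, u, v, hχ, hu, hv, hspan, isShiftOre_of_regular hR.regular le_sup_left hspan ?_ hrel⟩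
  rw [eq_top_iff, ← hR.generates]
  exact Algebra.adjoin_mono (SetLike.coe_subset_coe.2 le_sup_right)

end WeightBasis

/-! ### The powers of a character as coordinates; the group algebra of a cyclic group. -/

section CyclicGroupAlgebra

variable {k H : Type*} [Field k] [Ring H] [HopfAlgebra k H]

/-- The convolution powers of a character. -/
def charPow (χ : H →ₐ[k] k) (n : ℕ) : H →ₐ[k] k := (WithConv.toConv χ ^ n).ofConv

theorem charPow_zero_apply (χ : H →ₐ[k] k) (h : H) :
    charPow χ 0 h = Coalgebra.counit (R := k) h := by
  rw [charPow, pow_zero]; rfl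

theorem charPow_one (χ : H →ₐ[k] k) : charPow χ 1 = χ := by
  rw [charPow, pow_one]

theorem charPow_add_apply (χ : H →ₐ[k] k) (i j : ℕ) (h : H) : charPow χ (i + j) h =
    LinearMap.mul' k k (TensorProduct.map (charPow χ i).toLinearMap (charPow χ j).toLinearMap
      (Coalgebra.comul h)) := by
  rw [charPow, pow_add]
  exact convMul_character_apply (charPow χ i) (charPow χ j) h

theorem charPow_mod_orderOf (χ : H →ₐ[k] k) (n : ℕ) :
    charPow χ (n % orderOf (WithConv.toConv χ)) = charPow χ n := by
  rw [charPow, charPow, pow_mod_orderOf]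

theorem map_eq_sum_of_coordinates {ι : Type*} [Fintype ι] (c : ι → H →ₗ[k] k) {M : Type*}
    [AddCommGroup M] [Module k M] (f : H →ₗ[k] M) (d : ι → M) (hf : ∀ h, f h = ∑ i, c i h • d i)
    (t : H ⊗[k] H) : TensorProduct.map f f t =
      ∑ i, ∑ j, LinearMap.mul' k k (TensorProduct.map (c i) (c j) t) • d i ⊗ₜ[k] d j := by
  induction t with
  | zero => simp
  | tmul x y =>
    simp only [TensorProduct.map_tmul, hf, TensorProduct.sum_tmul, TensorProduct.tmul_sum,
      LinearMap.mul'_apply]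
    rw [Finset.sum_comm]
    refine Finset.sum_congr rfl fun i _ => Finset.sum_congr rfl fun j _ => ?_
    rw [TensorProduct.smul_tmul_smul]
  | add s t hs ht =>
    simp only [map_add, hs, ht, add_smul, Finset.sum_add_distrib]

/-- The vectors come from a section of C on its range, so ∑ Cᵢ(h)dᵢ agrees with h modulo the kernel
of C. Thus identities in (H/ker C) ⊗ (H/ker C) can be checked on coordinates. -/
theorem exists_dual_vectors {ι : Type*} [Fintype ι] (C : H →ₗ[k] ι → k) :
    ∃ d : ι → H, ∀ h, C (∑ i, C h i • d i) = C h := by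
  classical
  obtain ⟨s, hs⟩ := LinearMap.exists_rightInverse_of_surjective C.rangeRestrict
    (LinearMap.range_rangeRestrict C)
  obtain ⟨e, he⟩ := LinearMap.exists_extend s
  refine ⟨fun i => e (Pi.single i 1), fun h => ?_⟩
  have h1 : ∑ i, C h i • e (Pi.single i 1) = e (C h) := by
    conv_rhs => rw [pi_eq_sum_univ' (C h)]
    rw [map_sum]
    refine Finset.sum_congr rfl fun i _ => ?_
    rw [map_smul]
  have h2 : e (C h) = s ⟨C h, h, rfl⟩ := LinearMap.congr_fun he ⟨C h, h, rfl⟩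
  rw [h1, h2]
  exact congrArg Subtype.val (LinearMap.congr_fun hs ⟨C h, h, rfl⟩)

/-- The powers `1, χ, …, χ^(m-1)` of a character of order `m`. -/
def charPows (χ : H →ₐ[k] k) : H →ₐ[k] (Fin (orderOf (WithConv.toConv χ)) → k) :=
  AlgHom.pi fun j => charPow χ j

theorem charPows_apply (χ : H →ₐ[k] k) (h : H) (j : Fin (orderOf (WithConv.toConv χ))) :
    charPows χ h j = charPow χ j h := rfl

theorem charPow_eq_zero {χ : H →ₐ[k] k} (hχ : 0 < orderOf (WithConv.toConv χ)) {h : H}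
    (h0 : charPows χ h = 0) (n : ℕ) : charPow χ n h = 0 := by
  rw [← charPow_mod_orderOf]
  exact congrFun h0 ⟨_, Nat.mod_lt n hχ⟩

/-- The common kernel of the powers of a character of finite order is a Hopf ideal. -/
theorem isHopfIdeal_ker_charPows {χ : H →ₐ[k] k} (hχ : 0 < orderOf (WithConv.toConv χ)) :
    (RingHom.ker (charPows χ)).IsHopfIdeal k where
  counit_eq_zero x hx := by
    rw [← charPow_zero_apply χ]
    exact charPow_eq_zero hχ hx 0
  map_mkQ_comul_eq_zero x hx := by
    set I := (RingHom.ker (charPows χ)).restrictScalars k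
    obtain ⟨d, hd⟩ := exists_dual_vectors (charPows χ).toLinearMap
    have hmk (h : H) : I.mkQ h = ∑ j : Fin (orderOf (WithConv.toConv χ)),
        (charPow χ (j : ℕ)).toLinearMap h • I.mkQ (d j) := by
      have hs : ∑ j : Fin (orderOf (WithConv.toConv χ)),
          (charPow χ (j : ℕ)).toLinearMap h • I.mkQ (d j) =
          I.mkQ (∑ j, (charPows χ).toLinearMap h j • d j) := by
        rw [map_sum]
        exact Finset.sum_congr rfl fun j _ => (map_smul I.mkQ _ _).symm
      rw [hs, ← sub_eq_zero, ← map_sub, Submodule.mkQ_apply, Submodule.Quotient.mk_eq_zero]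
      change charPows χ _ = 0
      rw [map_sub, sub_eq_zero]
      exact (hd h).symm
    rw [map_eq_sum_of_coordinates (fun j : Fin (orderOf (WithConv.toConv χ)) =>
      (charPow χ (j : ℕ)).toLinearMap) I.mkQ _ hmk]
    refine Finset.sum_eq_zero fun i _ => Finset.sum_eq_zero fun j _ => ?_
    rw [← charPow_add_apply, charPow_eq_zero hχ hx, zero_smul]
  antipode_mem x hx := by
    refine (RingHom.mem_ker).2 (funext fun j => ?_)
    have h1 : charPow χ j (HopfAlgebra.antipode k x) =
        ((WithConv.toConv χ ^ (j : ℕ))⁻¹).ofConv x := rfl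
    -- The antipode inverts characters, and since χ has finite order the inverse is again a power of
    -- χ.
    have h2 : (WithConv.toConv χ ^ (j : ℕ))⁻¹ =
        WithConv.toConv χ ^ (orderOf (WithConv.toConv χ) - j) := by
      rw [inv_eq_iff_mul_eq_one, ← pow_add, Nat.add_sub_cancel' j.2.le, pow_orderOf_eq_one]
    rw [charPows_apply, h1, h2]
    exact charPow_eq_zero hχ hx _

theorem orderOf_character_pos [FiniteDimensional k H] (χ : H →ₐ[k] k) :
    0 < orderOf (WithConv.toConv χ) := by
  have : Finite (WithConv (H →ₐ[k] k)) := Finite.of_equiv _ (WithConv.equiv (H →ₐ[k] k)).symm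
  exact orderOf_pos _

/-- Distinct characters are linearly independent, so dim H ≥ m; injectivity gives dim H ≤ m. -/
theorem charPows_surjective [FiniteDimensional k H] {χ : H →ₐ[k] k}
    (hinj : Function.Injective (charPows χ)) : Function.Bijective (charPows χ) := by
  refine ⟨hinj, ?_⟩
  have h1 : LinearIndependent k
      (fun j : Fin (orderOf (WithConv.toConv χ)) => (charPow χ j).toLinearMap) := by
    refine (linearIndependent_toLinearMap k H k).comp
      (fun j : Fin (orderOf (WithConv.toConv χ)) => charPow χ j) fun i j hij => ?_
    exact Fin.ext (pow_injOn_Iio_orderOf i.2 j.2 (WithConv.ofConv_injective hij))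
  have h2 : orderOf (WithConv.toConv χ) ≤ Module.finrank k H := by
    have := h1.fintype_card_le_finrank
    rwa [Fintype.card_fin, Module.finrank_linearMap, Module.finrank_self, mul_one] at this
  have h3 := LinearMap.finrank_le_finrank_of_injective
    (f := (charPows χ).toLinearMap) hinj
  rw [Module.finrank_fin_fun] at h3
  exact (LinearMap.injective_iff_surjective_of_finrank_eq_finrank (f := (charPows χ).toLinearMap)
    (by rw [Module.finrank_fin_fun]; omega)).1 hinj

/-- g is defined by its coordinates ξʲ. It is group-like because both Δ(g) and g ⊗ g have the
coordinates χⁱ⁺ʲ(g) = ξⁱ⁺ʲ = ξⁱξʲ. -/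
theorem exists_groupLike [FiniteDimensional k H] {χ : H →ₐ[k] k}
    (hbij : Function.Bijective (charPows χ)) {ξ : k} (hξ : ξ ^ orderOf (WithConv.toConv χ) = 1) :
    ∃ g : GroupLike k H, ∀ n, charPow χ n g.1 = ξ ^ n := by
  have hpos := orderOf_character_pos χ
  obtain ⟨g, hg⟩ := hbij.2 fun j => ξ ^ (j : ℕ)
  have hn (n : ℕ) : charPow χ n g = ξ ^ n := by
    rw [← charPow_mod_orderOf]
    refine (congrFun hg ⟨_, Nat.mod_lt n hpos⟩).trans ?_
    conv_rhs => rw [← Nat.mod_add_div n (orderOf (WithConv.toConv χ)), pow_add, pow_mul, hξ,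
      one_pow, mul_one]
  refine ⟨⟨g, ⟨?_, ?_⟩⟩, hn⟩
  · rw [← charPow_zero_apply χ, hn, pow_zero]
  · obtain ⟨d, hd⟩ := exists_dual_vectors (charPows χ).toLinearMap
    have hid (h : H) : LinearMap.id (R := k) h =
        ∑ j : Fin (orderOf (WithConv.toConv χ)), (charPow χ (j : ℕ)).toLinearMap h • d j := (hbij.1 (hd h)).symm
    have key := map_eq_sum_of_coordinates (fun j : Fin (orderOf (WithConv.toConv χ)) =>
      (charPow χ (j : ℕ)).toLinearMap) LinearMap.id d hid
    simp only [TensorProduct.map_id, LinearMap.id_apply] at key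
    rw [key (Coalgebra.comul g), key (g ⊗ₜ g)]
    refine Finset.sum_congr rfl fun i _ => Finset.sum_congr rfl fun j _ => ?_
    rw [← charPow_add_apply, hn]
    simp [hn, pow_add]

/-- A Hopf algebra whose characters are the powers of a faithful one is the group algebra of a
cyclic group. -/
theorem exists_cyclicGroupAlgebra_equiv [FiniteDimensional k H] {χ : H →ₐ[k] k}
    (hinj : Function.Injective (charPows χ)) {ξ : k}
    (hξ : IsPrimitiveRoot ξ (orderOf (WithConv.toConv χ))) :
    ∃ α : H ≃ₐc[k] MonoidAlgebra k (Multiplicative (ZMod (orderOf (WithConv.toConv χ)))),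
      χ (α.symm (MonoidAlgebra.of k _ (Multiplicative.ofAdd 1))) = ξ := by
  have hbij := charPows_surjective hinj
  set m := orderOf (WithConv.toConv χ) with hm
  have hpos : 0 < m := orderOf_character_pos χ
  have : NeZero m := ⟨hpos.ne'⟩
  obtain ⟨g, hg⟩ := exists_groupLike hbij hξ.pow_eq_one
  have hpow (n i : ℕ) : charPow χ i (g ^ n).1 = ξ ^ (i * n) := by
    rw [GroupLike.val_pow, map_pow, hg, pow_mul]
  have hgm : g ^ m = 1 := by
    refine GroupLike.val_injective (hbij.1 (funext fun j => ?_))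
    rw [charPows_apply, hpow, mul_comm, pow_mul, hξ.pow_eq_one, one_pow, GroupLike.val_one, map_one]
    rfl
  let F : Multiplicative (ZMod m) →* GroupLike k H := AddMonoidHom.toMultiplicativeLeft
    (ZMod.lift m ⟨(zmultiplesHom (Additive (GroupLike k H))) (Additive.ofMul g), by
      simp [← ofMul_pow, hgm]⟩)
  have hF (n : ℕ) : F (Multiplicative.ofAdd (n : ZMod m)) = g ^ n := by
    have := ZMod.lift_coe m ⟨(zmultiplesHom (Additive (GroupLike k H))) (Additive.ofMul g), by
      simp [← ofMul_pow, hgm]⟩ (n : ℤ)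
    change Additive.toMul (ZMod.lift m _ (n : ZMod m)) = _
    rw [Int.cast_natCast] at this
    rw [this]
    simp
  -- χ(gⁿ) = ξⁿ and ξ is primitive, so the powers of g are distinct. Distinct group-like elements
  -- are linearly independent, and equality of dimensions does the rest.
  have hFinj : Function.Injective F := by
    intro a b hab
    obtain ⟨i, hi, rfl⟩ : ∃ i < m, a = Multiplicative.ofAdd (i : ZMod m) :=
      ⟨ZMod.val a.toAdd, ZMod.val_lt _, by simp⟩
    obtain ⟨j, hj, rfl⟩ : ∃ j < m, b = Multiplicative.ofAdd (j : ZMod m) :=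
      ⟨ZMod.val b.toAdd, ZMod.val_lt _, by simp⟩
    rw [hF, hF] at hab
    have := congrArg (fun x : GroupLike k H => charPow χ 1 x.1) hab
    simp only [hpow, one_mul] at this
    rw [hξ.pow_inj hi hj this]
  let B : MonoidAlgebra k (Multiplicative (ZMod m)) →ₐc[k] H :=
    (MonoidAlgebra.liftGroupLikeBialgHom).comp (MonoidAlgebra.mapDomainBialgHom k F)
  have hB (a : Multiplicative (ZMod m)) : B (MonoidAlgebra.of k _ a) = (F a).1 := by
    simp [B]
  have hli : LinearIndependent k fun a => (F a).1 := linearIndep_groupLikeVal.comp F hFinj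
  have hBc (z : MonoidAlgebra k (Multiplicative (ZMod m))) :
      B z = Finsupp.linearCombination k (fun a => (F a).1) (MonoidAlgebra.coeffLinearEquiv k z) := by
    obtain ⟨z, rfl⟩ := (MonoidAlgebra.coeffLinearEquiv k).symm.surjective z
    rw [LinearEquiv.apply_symm_apply]
    induction z using Finsupp.induction_linear with
    | zero => simp
    | add y z hy hz => simp only [map_add, hy, hz]
    | single a c =>
      rw [Finsupp.linearCombination_single, ← hB, ← map_smul]
      congr 1
      simp [MonoidAlgebra.of_apply]
  have hBinj : Function.Injective B := by
    intro y z hyz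
    rw [hBc, hBc] at hyz
    exact (MonoidAlgebra.coeffLinearEquiv k).injective (hli hyz)
  have hrank : Module.finrank k (MonoidAlgebra k (Multiplicative (ZMod m))) =
      Module.finrank k H := by
    have h1 := (LinearEquiv.ofBijective (charPows χ).toLinearMap hbij).finrank_eq
    rw [Module.finrank_fin_fun] at h1
    rw [h1, (MonoidAlgebra.coeffLinearEquiv (S := k) k).finrank_eq, Module.finrank_finsupp_self]
    exact (Fintype.card_multiplicative _).trans (ZMod.card m)
  have : Module.Finite k (MonoidAlgebra k (Multiplicative (ZMod m))) :=
    Module.Finite.equiv (MonoidAlgebra.coeffLinearEquiv (S := k) k).symm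
  have hBbij : Function.Bijective B := ⟨hBinj,
    (LinearMap.injective_iff_surjective_of_finrank_eq_finrank
      (f := (B : MonoidAlgebra k (Multiplicative (ZMod m)) →ₗ[k] H)) hrank).1 hBinj⟩
  refine ⟨(BialgEquiv.ofBijective B hBbij).symm, ?_⟩
  refine (congrArg χ (hB _)).trans ?_
  have := hpow 1 1
  rw [charPow_one] at this
  rw [← Nat.cast_one, hF, this, mul_one, pow_one]

end CyclicGroupAlgebra

/-! ### Identification with the Ore extension as a skew polynomial ring. -/

section OreExtension

open Polynomial

variable {k : Type*} [Field k]

theorem iterate_algEquivAevalXAddC (c : k) (n : ℕ) (p : k[X]) :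
    (algEquivAevalXAddC c : k[X] →+* k[X])^[n] p = taylor (n * c) p := by
  induction n with
  | zero => simp
  | succ n ih =>
    rw [Function.iterate_succ_apply', ih]
    have h (q : k[X]) : (algEquivAevalXAddC c : k[X] →+* k[X]) q = taylor c q := by
      rw [taylor_apply, comp_eq_aeval]
      rfl
    rw [h, taylor_taylor]
    congr 2
    push_cast
    ring

/-- The commutation rule for all powers of y gives a ring homomorphism, and in the coordinates of
the skew polynomial ring it is `oreMap`, so it is bijective. -/
theorem IsShiftOre.exists_oreExtension_equiv {S : Type*} [Ring S] [Algebra k S] {x y : S} {c : k}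
    (h : IsShiftOre x y c) :
    ∃ Φ : OreExtension (algEquivAevalXAddC c : k[X] →+* k[X]) ≃+* S,
      (∀ p : k[X], Φ (OreExtension.const _ p) = aeval x p) ∧ Φ (OreExtension.var _) = y := by
  let σ : k[X] →+* k[X] := algEquivAevalXAddC c
  let f : OreBase σ →+* S := (aeval x : k[X] →ₐ[k] S).toRingHom
  have hf (p : k[X]) : f (show OreBase σ from p) = aeval x p := rfl
  let g : Multiplicative ℕ →* S := powersHom S y
  have hg (n : Multiplicative ℕ) : g n = y ^ n.toAdd := rfl
  let F : OreExtension σ →+* S := SkewMonoidAlgebra.liftNCRingHom f g (by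
    intro p n
    have e : n • p = (show OreBase σ from taylor (n.toAdd * c) p) :=
      iterate_algEquivAevalXAddC c n.toAdd p
    rw [e, hf, hg]
    exact (pow_mul_aeval_of_mul_eq h.rel n.toAdd p).symm)
  have hF (n : Multiplicative ℕ) (p : OreBase σ) :
      F (SkewMonoidAlgebra.single n p) = f p * g n :=
    SkewMonoidAlgebra.liftNC_single _ _ _ _
  let e : OreExtension σ ≃+ (ℕ →₀ k[X]) := SkewMonoidAlgebra.coeffAddEquiv
  have he (z : OreExtension σ) : F z = oreMap x y (e z) := by
    have : (F : OreExtension σ →+ S) = (oreMap x y).toAddMonoidHom.comp e.toAddMonoidHom := by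
      refine SkewMonoidAlgebra.addHom_ext fun n p => ?_
      refine (hF n p).trans ?_
      have h2 : e (SkewMonoidAlgebra.single n p) =
        Finsupp.single n.toAdd (show k[X] from p) := rfl
      change _ = oreMap x y (e (SkewMonoidAlgebra.single n p))
      rw [h2, oreMap_single]
      rfl
    exact DFunLike.congr_fun this z
  have hbij : Function.Bijective F := by
    rw [show (F : OreExtension σ → S) = oreMap x y ∘ e from funext he]
    exact h.bij.comp e.bijective
  refine ⟨RingEquiv.ofBijective F hbij, fun p => ?_, ?_⟩
  · refine (hF 1 p).trans ?_
    rw [map_one, mul_one]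
    rfl
  · refine (hF (Multiplicative.ofAdd 1) 1).trans ?_
    rw [map_one, one_mul, hg]
    exact pow_one y

end OreExtension

/-! ### Faithfulness of χ and the fixed ring. -/

section FixedRing

open Polynomial

variable {k H R : Type*} [Field k] [Ring H] [HopfAlgebra k H] [Ring R] [Algebra k R]
  {ρ : H →ₐ[k] Module.End k R} {χ : H →ₐ[k] k} {u v : R}

theorem act_pow_of_weight (hρ : IsModuleAlgebra ρ) (hv : ∀ h, ρ h v = χ h • v) (n : ℕ) (h : H) :
    ρ h (v ^ n) = charPow χ n h • v ^ n := by
  induction n generalizing h with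
  | zero => rw [pow_zero, hρ.act_one, charPow_zero_apply, Algebra.algebraMap_eq_smul_one]
  | succ n ih =>
    rw [pow_succ, hρ.act_mul_of_weight ih hv, charPow, charPow, pow_succ]

theorem aeval_mem_fixedSubalgebra (hρ : IsModuleAlgebra ρ)
    (hu : ∀ h, ρ h u = Coalgebra.counit (R := k) h • u) (p : k[X]) :
    aeval u p ∈ fixedSubalgebra ρ hρ := by
  have : aeval u p = (fixedSubalgebra ρ hρ).val (aeval (⟨u, hu⟩ : fixedSubalgebra ρ hρ) p) := by
    rw [← aeval_algHom_apply]
    rfl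
  rw [this]
  exact Subtype.prop _

theorem act_oreMap_single (hρ : IsModuleAlgebra ρ)
    (hu : ∀ h, ρ h u = Coalgebra.counit (R := k) h • u) (hv : ∀ h, ρ h v = χ h • v) (j : ℕ)
    (p : k[X]) (h : H) : ρ h (oreMap u v (Finsupp.single j p)) =
      charPow χ j h • oreMap u v (Finsupp.single j p) := by
  rw [oreMap_single, hρ.act_mul_of_weight (ψ := Bialgebra.counitAlgHom k H)
    (aeval_mem_fixedSubalgebra hρ hu p) (act_pow_of_weight hρ hv j)]
  have : WithConv.toConv (Bialgebra.counitAlgHom k H) = 1 := rfl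
  rw [this, one_mul]

/-- R is spanned by vectors p(u)vʲ of weight χʲ, so the common kernel of the powers of χ, a Hopf
ideal, acts by zero. -/
theorem charPows_injective (hρ : IsModuleAlgebra ρ)
    (hu : ∀ h, ρ h u = Coalgebra.counit (R := k) h • u) (hv : ∀ h, ρ h v = χ h • v)
    (hore : IsShiftOre u v (1 : k)) (hχ : 0 < orderOf (WithConv.toConv χ))
    (hfaithful : IsInnerFaithful ρ) : Function.Injective (charPows χ) := by
  refine (RingHom.injective_iff_ker_eq_bot (charPows χ)).2 ?_
  refine hfaithful _ inferInstance (isHopfIdeal_ker_charPows hχ) fun h hh r => ?_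
  obtain ⟨q, rfl⟩ := hore.bij.2 r
  induction q using Finsupp.induction_linear with
  | zero => simp
  | add p q hp hq => rw [map_add, map_add, hp, hq, add_zero]
  | single j p => rw [act_oreMap_single hρ hu hv, charPow_eq_zero hχ hh, zero_smul]

theorem fixedSubalgebra_eq_adjoin [FiniteDimensional k H] (hρ : IsModuleAlgebra ρ)
    (hu : ∀ h, ρ h u = Coalgebra.counit (R := k) h • u) (hv : ∀ h, ρ h v = χ h • v)
    (hore : IsShiftOre u v (1 : k)) (hbij : Function.Bijective (charPows χ)) :
    fixedSubalgebra ρ hρ = Algebra.adjoin k {u, v ^ orderOf (WithConv.toConv χ)} := by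
  set m := orderOf (WithConv.toConv χ) with hm
  have hpos : 0 < m := orderOf_character_pos χ
  have hvm : v ^ m ∈ fixedSubalgebra ρ hρ := by
    intro h
    rw [act_pow_of_weight hρ hv, ← charPow_mod_orderOf, ← hm, Nat.mod_self, charPow_zero_apply]
  refine le_antisymm (fun a ha => ?_) (Algebra.adjoin_le ?_)
  · obtain ⟨e, he⟩ := hbij.2 (Pi.single ⟨0, hpos⟩ 1)
    have hej (j : ℕ) : charPow χ j e = if m ∣ j then 1 else 0 := by
      rw [← charPow_mod_orderOf]
      refine (congrFun he ⟨_, Nat.mod_lt j hpos⟩).trans ?_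
      simp [Pi.single_apply, Nat.dvd_iff_mod_eq_zero, hm]
    have hae : ρ e a = a := by
      have h0 := hej 0
      rw [charPow_zero_apply, if_pos (dvd_zero m)] at h0
      rw [ha e, h0, one_smul]
    rw [← hae]
    obtain ⟨q, rfl⟩ := hore.bij.2 a
    clear ha hae
    induction q using Finsupp.induction_linear with
    | zero => simp
    | add p q hp hq => rw [map_add, map_add]; exact add_mem hp hq
    | single j p =>
      rw [act_oreMap_single hρ hu hv, hej]
      split_ifs with hj
      · obtain ⟨i, rfl⟩ := hj
        rw [one_smul, oreMap_single, pow_mul]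
        have hmem : v ^ m ∈ Algebra.adjoin k {u, v ^ m} := Algebra.subset_adjoin (by simp)
        refine mul_mem ?_ (pow_mem hmem i)
        have hle : Algebra.adjoin k {u} ≤ Algebra.adjoin k {u, v ^ m} :=
          Algebra.adjoin_mono (by simp)
        exact hle (aeval_mem_adjoin_singleton k u)
      · rw [zero_smul]
        exact zero_mem _
  · rintro z (rfl | rfl)
    · exact hu
    · exact hvm

theorem IsShiftOre.pow_of_eq_adjoin {c : k} (hore : IsShiftOre u v c) {m : ℕ} (hm : 0 < m)
    {F : Subalgebra k R} (hF : F = Algebra.adjoin k {u, v ^ m}) {x y : F} (hx : (x : R) = u)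
    (hy : (y : R) = v ^ m) : IsShiftOre x y (m * c) := by
  have hrel : y * x = (x + algebraMap k F (m * c)) * y := by
    refine Subtype.ext ?_
    have := pow_mul_aeval_of_mul_eq hore.rel m X
    rw [taylor_X, map_add, aeval_X, aeval_C] at this
    change (y : R) * x = ((x : R) + algebraMap k R (m * c)) * y
    rw [hx, hy, this]
  refine ⟨hrel, ?_, oreMap_surjective hrel ?_⟩
  · intro p q hpq
    -- In the coordinates of the big ring, those of the subring are spread out along j ↦ mj, which
    -- is injective as m > 0.
    have h1 (q : ℕ →₀ k[X]) : F.val (oreMap x y q) =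
        oreMap u v (Finsupp.lmapDomain k[X] k (m * ·) q) := by
      rw [map_oreMap]
      change oreMap (x : R) (y : R) q = _
      rw [hx, hy]
      induction q using Finsupp.induction_linear with
      | zero => simp
      | add p q hp hq => simp only [map_add, hp, hq]
      | single j p => simp [oreMap_single, pow_mul]
    have h2 := congrArg F.val hpq
    rw [h1, h1] at h2
    exact Finsupp.mapDomain_injective (mul_right_injective₀ hm.ne') (hore.bij.1 h2)
  · refine Subalgebra.map_injective (f := F.val) Subtype.val_injective ?_
    rw [AlgHom.map_adjoin, Algebra.map_top, Subalgebra.range_val, Set.image_pair]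
    change Algebra.adjoin k {(x : R), (y : R)} = _
    rw [hx, hy, ← hF]

end FixedRing

end FilteredHopf

end

open FilteredHopf in
theorem proposition3p3 {k : Type*} [Field k] [IsAlgClosed k] [CharZero k]
    {H : Type*} [Ring H] [HopfAlgebra k H] [FiniteDimensional k H] [IsSemisimpleRing H]
    {R : Type u} [Ring R] [Algebra k R]
    (U : Submodule k R) (hR : IsFilteredASRegular R U 2)
    (ρ : H →ₐ[k] Module.End k R) (hρ : IsModuleAlgebra ρ) (hU : IsStable ρ (1 ⊔ U))
    (hfaithful : IsInnerFaithful ρ)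
    (hgraded : ¬ IsGradedAction hρ 2)
    (hdet : ¬ IsHomologicalDeterminant (grAction hρ hU) (grGrading (1 ⊔ U)) 2
      (Bialgebra.counitAlgHom k H)) :
    ∃ (m : ℕ) (ξ : k) (α : H ≃ₐc[k] MonoidAlgebra k (Multiplicative (ZMod m)))
      (φ : ShiftAlgebra k ≃ₐ[k] R) (u v : R),
      2 ≤ m ∧ IsPrimitiveRoot ξ m ∧
      u = φ (ShiftAlgebra.gen k 0) ∧ v = φ (ShiftAlgebra.gen k 1) ∧
      1 ⊔ U = Submodule.span k {1, u, v} ∧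
      ρ (α.symm (MonoidAlgebra.of k _ (Multiplicative.ofAdd 1))) u = u ∧
      ρ (α.symm (MonoidAlgebra.of k _ (Multiplicative.ofAdd 1))) v = ξ • v ∧
      fixedSubalgebra ρ hρ = Algebra.adjoin k {u, v ^ m} ∧
      (∃ Φ : OreExtension (Polynomial.algEquivAevalXAddC (m : k) : k[X] →+* k[X]) ≃+*
          fixedSubalgebra ρ hρ,
        (∀ p : k[X], (Φ (OreExtension.const _ p) : R) = Polynomial.aeval u p) ∧
        (Φ (OreExtension.var _) : R) = v ^ m) ∧
      HasGlobalDimension (fixedSubalgebra ρ hρ) 2 ∧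
      HasGlobalDimension (fixedSubalgebra ρ hρ)ᵐᵒᵖ 2 := by
  obtain ⟨χ, u, v, hχ, hu, hv, hspan, hore⟩ := exists_weights hR hρ hU hgraded hdet
  have hpos := orderOf_character_pos χ
  have hinj := charPows_injective hρ hu hv hore hpos hfaithful
  obtain ⟨φ, hφu, hφv⟩ := hore.exists_shiftAlgebra_equiv
  set m := orderOf (WithConv.toConv χ) with hm
  have hm2 : 2 ≤ m := by
    have h1 : m ≠ 1 := fun h => hχ (congrArg WithConv.ofConv (orderOf_eq_one_iff.1 h))
    omega
  have : NeZero (m : k) := ⟨Nat.cast_ne_zero.2 hpos.ne'⟩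
  obtain ⟨ξ, hξ⟩ := HasEnoughRootsOfUnity.exists_primitiveRoot k m
  obtain ⟨α, hα⟩ := exists_cyclicGroupAlgebra_equiv hinj hξ
  have hfix := fixedSubalgebra_eq_adjoin hρ hu hv hore (charPows_surjective hinj)
  have hvm : v ^ m ∈ fixedSubalgebra ρ hρ := hfix ▸ Algebra.subset_adjoin (Or.inr rfl)
  have hF : IsShiftOre (⟨u, hu⟩ : fixedSubalgebra ρ hρ) ⟨v ^ m, hvm⟩ (m : k) := by
    have := hore.pow_of_eq_adjoin hpos hfix (x := ⟨u, hu⟩) (y := ⟨v ^ m, hvm⟩) rfl rfl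
    rwa [mul_one] at this
  obtain ⟨Φ, hΦ, hΦv⟩ := hF.exists_oreExtension_equiv
  refine ⟨m, ξ, α, φ, u, v, hm2, hξ, hφu.symm, hφv.symm, hspan, ?_, ?_, hfix,
    ⟨Φ, fun p => ?_, ?_⟩, hF.hasGlobalDimension_two, hF.op.hasGlobalDimension_two⟩
  · rw [hu]
    have h1 := CoalgHomClass.counit_comp_apply α.symm
      (MonoidAlgebra.of k (Multiplicative (ZMod m)) (Multiplicative.ofAdd 1))
    rw [h1]
    simp
  · rw [hv, hα]
  · rw [hΦ]
    exact (Polynomial.aeval_algHom_apply (fixedSubalgebra ρ hρ).val ⟨u, hu⟩ p).symm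
  · rw [hΦv]
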